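/- **Theorem (Connected Vertex Cover in subdense graphs).** For a connected graph $G$ on $n\ge 2$ vertices let $\bar d$ be its average degree and $\Delta$ its maximum degree. A connected vertex cover of $G$ is a set of vertices that meets every edge and induces a connected subgraph. For every $\varepsilon>0$ there is a randomized algorithm (a fixed program of a random access machine with unit-cost addition, subtraction and fair coin tosses, and with access to the adjacency matrix of the input) with the following properties. 1. On every connected graph $G$ with $n\ge 2$ vertices and $\Delta\le n/2$ the algorithm always halts with a connected vertex cover of $G$, and with probability at least $1-1/n$ the size of this cover is at most $$\frac{2}{1+\bar d/(2\Delta)}+\varepsilon$$ times the minimum size of a connected vertex cover of $G$. 2. For every $c>0$ there is a constant $C$ such that for every function $\psi:\mathbb N\to\mathbb R$ that is positive for all large $n$ (for instance any $\psi=\omega(1)$), all sufficiently large $n$, and all connected graphs $G$ on $n$ vertices with $c\,n/\psi(n)\le\Delta\le n/2$, the algorithm makes at most $n^{C}\,2^{C\psi(n)\log\log\log n}$ steps on $G$, whatever the outcomes of the coin tosses are. 3. In particular, for every $c>0$ and every such $\psi$, the worst-case number of steps on these graphs, for all sufficiently large $n$, is - polynomial, i.e. at most $n^{k}$ for some constant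 $k$, if $\psi(n)=O(\log n/\log\log\log n)$; - quasi-polynomial, i.e. at most $2^{(\log n)^{k}}$ for some constant $k$, if $\psi(n)=O((\log n)^{j})$ for some constant $j$. -/

import Mathlib

open Filter Asymptotics MeasureTheory

/-! ### Graph notions -/

/-- `S` is a connected vertex cover of `G`: it covers every edge and induces a connected subgraph. -/
structure IsConnectedVertexCover {V : Type*} (G : SimpleGraph V) (S : Finset V) : Prop where
  cover : G.IsVertexCover (S : Set V)
  connected : (G.induce (S : Set V)).Connected

/-- `S` is a connected vertex cover whose size is at most `ρ` times the minimum size of a connected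
vertex cover. -/
def IsApproxConnectedVertexCover {V : Type*} (G : SimpleGraph V) (ρ : ℝ) (S : Finset V) : Prop :=
  IsConnectedVertexCover G S ∧
    ∀ T : Finset V, IsConnectedVertexCover G T → (S.card : ℝ) ≤ ρ * (T.card : ℝ)

open Classical in
/-- The maximum degree `Δ`. -/
noncomputable def maxDeg {n : ℕ} (G : SimpleGraph (Fin n)) : ℕ := G.maxDegree

open Classical in
/-- The average degree `d̄`. -/
noncomputable def avgDeg {n : ℕ} (G : SimpleGraph (Fin n)) : ℝ :=
  (∑ v, (G.degree v : ℝ)) / n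

/-! ### Randomized random access machines

A random access machine over the natural numbers with registers, an indirectly addressed memory,
addition and (truncated) subtraction, a fair coin, and read-only access to the adjacency matrix of
the input graph. Every instruction and every test costs one step. As there is no multiplication,
this cost measure is polynomially related to the running time of a Turing machine. Programs are
structured (`while` programs). -/

/-- Instructions. The arguments `x y z` are names of registers, `k` is a constant. -/
inductive Instr : Type
  /-- `x := k` -/
  | const (x k : ℕ)
  /-- `x := y + z` -/
  | add (x y z : ℕ)
  /-- `x := max (y - z) 0` -/
  | sub (x y z : ℕ)
  /-- `x := memory[y]` -/
  | load (x y : ℕ)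
  /-- `memory[x] := y` -/
  | store (x y : ℕ)
  /-- `x := number of vertices of the input` -/
  | size (x : ℕ)
  /-- `x := 1` if the vertices with the numbers in `y` and `z` are adjacent, and `x := 0` otherwise -/
  | adj (x y z : ℕ)
  /-- `x := ` the outcome (0 or 1) of a fresh toss of a fair coin -/
  | flip (x : ℕ)

/-- Programs. -/
inductive Prog : Type
  | skip
  | instr (i : Instr)
  | seq (p q : Prog)
  /-- run `p` if register `x` is nonzero, and `q` otherwise -/
  | ite (x : ℕ) (p q : Prog)
  /-- repeat `p` as long as register `x` is nonzero -/
  | while (x : ℕ) (p : Prog)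

/-- The state of the machine: registers, memory, and the number of coins tossed so far. -/
structure State : Type where
  reg : ℕ → ℕ
  mem : ℕ → ℕ
  tossed : ℕ

/-- The initial state: everything is zero. -/
def State.init : State := ⟨fun _ => 0, fun _ => 0, 0⟩

/-- Assignment to a register. -/
def State.set (s : State) (x v : ℕ) : State := { s with reg := Function.update s.reg x v }

open Classical in
/-- The entry `(a, b)` of the adjacency matrix, as a number; `0` if `a` or `b` is not a vertex. -/
noncomputable def adjEntry {n : ℕ} (G : SimpleGraph (Fin n)) (a b : ℕ) : ℕ :=
  if ∃ (ha : a < n) (hb : b < n), G.Adj ⟨a, ha⟩ ⟨b, hb⟩ then 1 else 0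

/-- The effect of an instruction on input `G`, where `ω i` is the outcome of the `i`-th coin toss. -/
noncomputable def Instr.eval {n : ℕ} (G : SimpleGraph (Fin n)) (ω : ℕ → Bool) (s : State) :
    Instr → State
  | .const x k => s.set x k
  | .add x y z => s.set x (s.reg y + s.reg z)
  | .sub x y z => s.set x (s.reg y - s.reg z)
  | .load x y => s.set x (s.mem (s.reg y))
  | .store x y => { s with mem := Function.update s.mem (s.reg x) (s.reg y) }
  | .size x => s.set x n
  | .adj x y z => s.set x (adjEntry G (s.reg y) (s.reg z))
  | .flip x => { s.set x (ω s.tossed).toNat with tossed := s.tossed + 1 }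

/-- `Exec G ω p s s' k`: on input `G` and with coin tosses `ω`, the program `p` started in state `s`
halts in state `s'` after exactly `k` steps. -/
inductive Exec {n : ℕ} (G : SimpleGraph (Fin n)) (ω : ℕ → Bool) :
    Prog → State → State → ℕ → Prop
  | skip (s : State) : Exec G ω .skip s s 1
  | instr (i : Instr) (s : State) : Exec G ω (.instr i) s (i.eval G ω s) 1
  | seq {p q : Prog} {s s' s'' : State} {k l : ℕ} :
      Exec G ω p s s' k → Exec G ω q s' s'' l → Exec G ω (.seq p q) s s'' (k + l)
  | ite_true {x : ℕ} {p q : Prog} {s s' : State} {k : ℕ} :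
      s.reg x ≠ 0 → Exec G ω p s s' k → Exec G ω (.ite x p q) s s' (k + 1)
  | ite_false {x : ℕ} {p q : Prog} {s s' : State} {k : ℕ} :
      s.reg x = 0 → Exec G ω q s s' k → Exec G ω (.ite x p q) s s' (k + 1)
  | while_true {x : ℕ} {p : Prog} {s s' s'' : State} {k l : ℕ} :
      s.reg x ≠ 0 → Exec G ω p s s' k → Exec G ω (.while x p) s' s'' l →
        Exec G ω (.while x p) s s'' (k + l + 1)
  | while_false {x : ℕ} {p : Prog} {s : State} :
      s.reg x = 0 → Exec G ω (.while x p) s s 1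

/-- The final state and the number of steps are determined by the input and the coin tosses. -/
theorem Exec.deterministic {n : ℕ} {G : SimpleGraph (Fin n)} {ω : ℕ → Bool} {p : Prog}
    {s s₁ s₂ : State} {k₁ k₂ : ℕ} (h₁ : Exec G ω p s s₁ k₁) (h₂ : Exec G ω p s s₂ k₂) :
    s₁ = s₂ ∧ k₁ = k₂ := by
  induction h₁ generalizing s₂ k₂ with
  | skip s => cases h₂; exact ⟨rfl, rfl⟩
  | instr i s => cases h₂; exact ⟨rfl, rfl⟩
  | seq _ _ ih₁ ih₂ =>
    cases h₂ with
    | seq a b =>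
      obtain ⟨rfl, rfl⟩ := ih₁ a
      obtain ⟨rfl, rfl⟩ := ih₂ b
      exact ⟨rfl, rfl⟩
  | ite_true hx _ ih =>
    cases h₂ with
    | ite_true _ a => obtain ⟨rfl, rfl⟩ := ih a; exact ⟨rfl, rfl⟩
    | ite_false hy _ => exact absurd hy hx
  | ite_false hx _ ih =>
    cases h₂ with
    | ite_true hy _ => exact absurd hx hy
    | ite_false _ a => obtain ⟨rfl, rfl⟩ := ih a; exact ⟨rfl, rfl⟩
  | while_true hx _ _ ih₁ ih₂ =>
    cases h₂ with
    | while_true _ a b =>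
      obtain ⟨rfl, rfl⟩ := ih₁ a
      obtain ⟨rfl, rfl⟩ := ih₂ b
      exact ⟨rfl, rfl⟩
    | while_false hy => exact absurd hy hx
  | while_false hx =>
    cases h₂ with
    | while_true hy _ _ => exact absurd hx hy
    | while_false _ => exact ⟨rfl, rfl⟩

/-- The vertex set written to the memory: `v` belongs to it iff `memory[v]` is nonzero. -/
def State.output (n : ℕ) (s : State) : Finset (Fin n) :=
  Finset.univ.filter fun v => s.mem v ≠ 0

/-- On input `G` with coin tosses `ω` the program `P` halts with output `S`. -/
def Prog.Outputs {n : ℕ} (P : Prog) (G : SimpleGraph (Fin n)) (ω : ℕ → Bool)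
    (S : Finset (Fin n)) : Prop :=
  ∃ s k, Exec G ω P State.init s k ∧ s.output n = S

/-- On input `G` the program `P` halts after at most `T` steps, whatever the coin tosses are. -/
def Prog.HaltsWithin {n : ℕ} (P : Prog) (G : SimpleGraph (Fin n)) (T : ℝ) : Prop :=
  ∀ ω, ∃ s k, Exec G ω P State.init s k ∧ (k : ℝ) ≤ T

/-- The law of an infinite sequence of independent tosses of a fair coin. -/
noncomputable def coinMeasure : Measure (ℕ → Bool) :=
  Measure.infinitePi fun _ => (PMF.uniformOfFintype Bool).toMeasure

/-! ### The instances -/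

/-- The admissible inputs: connected graphs with at least two vertices and `Δ ≤ n / 2`. -/
structure IsInstance {n : ℕ} (G : SimpleGraph (Fin n)) : Prop where
  two_le : 2 ≤ n
  connected : G.Connected
  maxDeg_le : (maxDeg G : ℝ) ≤ (n : ℝ) / 2

/-- `P` runs in time `T` on the admissible inputs with `Δ ≥ c n / ψ(n)`, for all large `n`. -/
def Prog.RunsInTime (P : Prog) (c : ℝ) (ψ : ℕ → ℝ) (T : ℕ → ℝ) : Prop :=
  ∀ᶠ n : ℕ in atTop, ∀ G : SimpleGraph (Fin n), IsInstance G →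
    c * ((n : ℝ) / ψ n) ≤ (maxDeg G : ℝ) → P.HaltsWithin G (T n)

/-- `log log log n`. -/
noncomputable def logloglog (n : ℕ) : ℝ := Real.log (Real.log (Real.log n))

/-!
Write `γ = d̄ / (2 Δ)`; we have `γ n ≤ |C|` for every vertex cover `C`, because each vertex covers at
most `Δ` of the `γ n Δ` edges. The algorithm repeatedly guesses a vertex set `W`, grows a connected
vertex cover that takes vertices of `W` whenever possible, and outputs the best cover found.

*Growing.* Starting with the empty set `T`, take a vertex of `W` that is adjacent to `T` if there is
one, and otherwise both ends of an uncovered edge with an end adjacent to `T` (`GrowStep`). As `G` is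
connected, the final `T` is a connected vertex cover (`Grown.isConnectedVertexCover`). An edge that
avoids `W` contains a new vertex of `C \ W`; an edge that meets `W` is followed by the rest of the
part of `W` that it reaches. So if `W` is a union of `R` connected pieces, then
`|T| ≤ |W| + 2 |C \ W| + R = 2 |C| - |W| + 2 |W \ C| + R` (`Grown.card_le`). A good guess is therefore
a large set `W` that is nearly contained in `C` and has few pieces.

*Guessing.* `W` is a union of `2 R` random stars with `R ≈ q ^ 3 n / Δ`, where `q` is a constant. The
stars with centres outside of the optimal cover `C` have their leaves in `C`. In a first phase the
centres are vertices outside of `C` with at least `Δ / q` neighbours outside of `W`, as long as there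
are `n / q` of them; since each such star adds `Δ / q` vertices to `W`, the phase comes to its end
within `R` rounds (`potential_step`, `outer_phase`). The set `H` of all vertices that then still have
`Δ / q` neighbours outside of `W` is contained in `C` up to `n / q` vertices, and the algorithm can
compute `H`. In a second phase the leaves are restricted to `H` (`inner_phase`), and afterwards all
but `2 n / q` vertices of `H` belong to `W` (`card_le_of_richSet`). Now nearly all edges meet `W`,
whence `|W| ≥ γ n - O(n / q)`, and altogether `|T| ≤ 2 |C| - γ n + O(n / q)`
(`Grown.card_le_of_phases`). As the output has at most `n` vertices, too, this gives the ratio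
`2 / (1 + γ) + ε` (`le_ratio_mul`), provided that `γ` is not small and that `Δ ≥ q ^ 4`, so that the
`2 R` centres and pieces do not count. If `γ ≤ ε / 2`, the guess `W = ∅` is good enough; if
`Δ < q ^ 4`, then `R` is linear in `n` and `W = C` itself may be guessed.

*Probability and time.* A guess is good as soon as each of the `2 R` draws falls into a certain set of
constant density, so that it is good with probability `2 ^ (-K R)` for a constant `K`
(`IsInstance.exists_goodTrial`). The algorithm makes `n 2 ^ (K R)` trials, and all of them fail with
probability at most `exp (-n) ≤ 1 / n` (`coinProb_forall_not_le`, `IsInstance.le_coinMeasure`). The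
number of steps is a polynomial in `n` times `2 ^ (K R)` (`main_spec`), and `R = O(ψ)` if
`Δ ≥ c n / ψ` (`exists_cost_le`).
-/

/-! ### Reasoning about programs -/

@[simp] theorem State.reg_set (s : State) (x v r : ℕ) :
    (s.set x v).reg r = if r = x then v else s.reg r := by
  simp [State.set, Function.update_apply]

@[simp] theorem State.mem_set (s : State) (x v : ℕ) : (s.set x v).mem = s.mem := rfl

@[simp] theorem State.tossed_set (s : State) (x v : ℕ) : (s.set x v).tossed = s.tossed := rfl

/-- The register `r` is assigned to by the instruction. -/
def Instr.writes (r : ℕ) : Instr → Bool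
  | .const x _ => x == r
  | .add x _ _ => x == r
  | .sub x _ _ => x == r
  | .load x _ => x == r
  | .store _ _ => false
  | .size x => x == r
  | .adj x _ _ => x == r
  | .flip x => x == r

/-- The register `r` is assigned to somewhere in the program. -/
def Prog.writes (r : ℕ) : Prog → Bool
  | .skip => false
  | .instr i => i.writes r
  | .seq p q => p.writes r || q.writes r
  | .ite _ p q => p.writes r || q.writes r
  | .while _ p => p.writes r

/-- The program contains a `store`. -/
def Prog.stores : Prog → Bool
  | .skip => false
  | .instr i => match i with
    | .store _ _ => true
    | _ => false
  | .seq p q => p.stores || q.stores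
  | .ite _ p q => p.stores || q.stores
  | .while _ p => p.stores

/-- The program contains a `flip`. -/
def Prog.flips : Prog → Bool
  | .skip => false
  | .instr i => match i with
    | .flip _ => true
    | _ => false
  | .seq p q => p.flips || q.flips
  | .ite _ p q => p.flips || q.flips
  | .while _ p => p.flips

/-- The part of the state that `p` cannot change, by inspection of its text, is the same in
`s` and in `s'`. -/
structure Frame (p : Prog) (s s' : State) : Prop where
  reg : ∀ r, p.writes r = false → s'.reg r = s.reg r
  mem : p.stores = false → s'.mem = s.mem
  tossed : p.flips = false → s'.tossed = s.tossed

theorem Frame.refl (p : Prog) (s : State) : Frame p s s :=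
  ⟨fun _ _ => rfl, fun _ => rfl, fun _ => rfl⟩

theorem Frame.trans {p : Prog} {s s' s'' : State} (h : Frame p s s') (h' : Frame p s' s'') :
    Frame p s s'' :=
  ⟨fun r hr => (h'.reg r hr).trans (h.reg r hr), fun hm => (h'.mem hm).trans (h.mem hm),
    fun ht => (h'.tossed ht).trans (h.tossed ht)⟩

theorem Frame.mono {p q : Prog} {s s' : State} (h : Frame p s s')
    (hr : ∀ r, q.writes r = false → p.writes r = false)
    (hm : q.stores = false → p.stores = false) (hf : q.flips = false → p.flips = false) :
    Frame q s s' :=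
  ⟨fun r h' => h.reg r (hr r h'), fun h' => h.mem (hm h'), fun h' => h.tossed (hf h')⟩

theorem Frame.seq_left {p q : Prog} {s s' : State} (h : Frame p s s') : Frame (.seq p q) s s' :=
  h.mono (by simp +contextual [Prog.writes]) (by simp +contextual [Prog.stores])
    (by simp +contextual [Prog.flips])

theorem Frame.seq_right {p q : Prog} {s s' : State} (h : Frame q s s') : Frame (.seq p q) s s' :=
  h.mono (by simp +contextual [Prog.writes]) (by simp +contextual [Prog.stores])
    (by simp +contextual [Prog.flips])

theorem Frame.while {p : Prog} {x : ℕ} {s s' : State} (h : Frame p s s') :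
    Frame (.while x p) s s' :=
  h.mono (by simp [Prog.writes]) (by simp [Prog.stores]) (by simp [Prog.flips])

/-- An execution changes nothing but what occurs in the text of the program. -/
theorem Exec.frame {n : ℕ} {G : SimpleGraph (Fin n)} {ω : ℕ → Bool} {p : Prog} {s s' : State}
    {k : ℕ} (h : Exec G ω p s s' k) : Frame p s s' := by
  induction h with
  | skip s => exact Frame.refl _ _
  | instr i s =>
    cases i <;> refine ⟨fun r hr => ?_, fun hm => ?_, fun ht => ?_⟩ <;>
      simp_all [Instr.eval, Prog.writes, Instr.writes, Prog.stores, Prog.flips] <;>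
      exact fun h => absurd h.symm hr
  | seq _ _ ih₁ ih₂ => exact ih₁.seq_left.trans ih₂.seq_right
  | ite_true _ _ ih =>
    exact ih.mono (by simp +contextual [Prog.writes]) (by simp +contextual [Prog.stores])
      (by simp +contextual [Prog.flips])
  | ite_false _ _ ih =>
    exact ih.mono (by simp +contextual [Prog.writes]) (by simp +contextual [Prog.stores])
      (by simp +contextual [Prog.flips])
  | while_true _ _ _ ih₁ ih₂ => exact ih₁.while.trans ih₂
  | while_false _ => exact Frame.refl _ _

/-- Started in `s`, the program `p` halts after at most `T` steps in a state that satisfies `Q`. -/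
def RunsTo {n : ℕ} (G : SimpleGraph (Fin n)) (ω : ℕ → Bool) (p : Prog) (s : State) (T : ℕ)
    (Q : State → Prop) : Prop :=
  ∃ s' k, Exec G ω p s s' k ∧ k ≤ T ∧ Q s'

namespace RunsTo

variable {n : ℕ} {G : SimpleGraph (Fin n)} {ω : ℕ → Bool} {p q : Prog} {s : State} {T T₁ T₂ : ℕ}
  {Q Q₁ : State → Prop}

theorem mono (h : RunsTo G ω p s T₁ Q₁) (hT : T₁ ≤ T)
    (hQ : ∀ s', Q₁ s' → Frame p s s' → Q s') : RunsTo G ω p s T Q := by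
  obtain ⟨s', k, he, hk, hq⟩ := h
  exact ⟨s', k, he, hk.trans hT, hQ s' hq he.frame⟩

theorem skip (h : Q s) : RunsTo G ω .skip s (T + 1) Q :=
  ⟨s, 1, .skip s, by omega, h⟩

theorem instr {i : Instr} (h : Q (i.eval G ω s)) : RunsTo G ω (.instr i) s (T + 1) Q :=
  ⟨_, 1, .instr i s, by omega, h⟩

theorem seq (h₁ : RunsTo G ω p s T₁ Q₁) (hT : T₁ + T₂ ≤ T)
    (h₂ : ∀ s', Q₁ s' → Frame p s s' → RunsTo G ω q s' T₂ Q) : RunsTo G ω (.seq p q) s T Q := by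
  obtain ⟨s', k, he, hk, hq⟩ := h₁
  obtain ⟨s'', l, he', hl, hq'⟩ := h₂ s' hq he.frame
  exact ⟨s'', k + l, .seq he he', by omega, hq'⟩

theorem instr_seq {i : Instr} (h : RunsTo G ω q (i.eval G ω s) T Q) :
    RunsTo G ω (.seq (.instr i) q) s (T + 1) Q :=
  (instr (T := 0) (Q := fun s' => s' = i.eval G ω s) rfl).seq (by omega) fun s' h' _ => h' ▸ h

theorem ite {x : ℕ} (h₁ : s.reg x ≠ 0 → RunsTo G ω p s T Q)
    (h₂ : s.reg x = 0 → RunsTo G ω q s T Q) : RunsTo G ω (.ite x p q) s (T + 1) Q := by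
  by_cases hx : s.reg x = 0
  · obtain ⟨s', k, he, hk, hq⟩ := h₂ hx
    exact ⟨s', k + 1, .ite_false hx he, by omega, hq⟩
  · obtain ⟨s', k, he, hk, hq⟩ := h₁ hx
    exact ⟨s', k + 1, .ite_true hx he, by omega, hq⟩

/-- A loop whose body is entered with a positive value of the variant at most `m` times. -/
theorem loop {x : ℕ} {I : ℕ → State → Prop} (m : ℕ) (h₀ : I m s)
    (step : ∀ j s', I j s' → Frame p s s' → s'.reg x ≠ 0 →
      ∃ i, j = i + 1 ∧ RunsTo G ω p s' T (I i))
    (hQ : ∀ j s', I j s' → Frame p s s' → s'.reg x = 0 → Q s') :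
    RunsTo G ω (.while x p) s (m * (T + 1) + 1) Q := by
  suffices H : ∀ m s', I m s' → Frame p s s' →
      RunsTo G ω (.while x p) s' (m * (T + 1) + 1) Q from H m s h₀ (Frame.refl _ _)
  intro m
  induction m with
  | zero =>
    intro s' h hf
    by_cases hx : s'.reg x = 0
    · exact ⟨s', 1, .while_false hx, by omega, hQ _ _ h hf hx⟩
    · obtain ⟨i, hi, -⟩ := step _ _ h hf hx
      omega
  | succ m ih =>
    intro s' h hf
    by_cases hx : s'.reg x = 0
    · exact ⟨s', 1, .while_false hx, by omega, hQ _ _ h hf hx⟩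
    · obtain ⟨i, hi, s₁, k, he, hk, hI⟩ := step _ _ h hf hx
      obtain rfl : m = i := by omega
      obtain ⟨s₂, l, he', hl, hq⟩ := ih s₁ hI (hf.trans he.frame)
      refine ⟨s₂, k + l + 1, .while_true hx he he', ?_, hq⟩
      rw [Nat.succ_mul]
      omega

end RunsTo

/-! ### Registers, loops and arrays -/

/-!
The registers `0, …, 4` hold the constants `0`, `1`, `n`, `2 n` and `3 n`. These numbers, with
`rZero` for `0` and `rSize` for `n`, are the offsets of the arrays with the best cover so far (where
the output is expected), the growing cover `T`, the set `H`, and the guessed set `W`. The last array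
has nothing behind it, so that an index beyond its end does no harm.

`rDeg`, `rScale`, `rWork` hold the parameters `Δ`, `q` and `q ^ 3 n`, `rBest` the size of the best
cover, `rTrials` the number of trials left, and `rRem` the counter of the loop over the random stars.
`rTest`, `rAddr`, `rTmp` are used within loops, array accesses and tests; `rX` and `rY` run through
the vertices; `rDraw` and `rPow` belong to the drawing of a random number; `rCount` counts;
`rFound`, `rFst`, `rSnd`, `rStarted` belong to the growth of `T`; `rFlag` is the coin that decides
whether a trial starts with the empty set.
-/

notation "rZero" => (0 : ℕ)
notation "rOne" => (1 : ℕ)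
notation "rSize" => (2 : ℕ)
notation "rOffH" => (3 : ℕ)
notation "rOffW" => (4 : ℕ)
notation "rDeg" => (5 : ℕ)
notation "rScale" => (6 : ℕ)
notation "rWork" => (7 : ℕ)
notation "rTest" => (8 : ℕ)
notation "rAddr" => (9 : ℕ)
notation "rTmp" => (10 : ℕ)
notation "rRem" => (11 : ℕ)
notation "rX" => (12 : ℕ)
notation "rY" => (13 : ℕ)
notation "rDraw" => (14 : ℕ)
notation "rPow" => (15 : ℕ)
notation "rCount" => (16 : ℕ)
notation "rFound" => (17 : ℕ)
notation "rFst" => (18 : ℕ)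
notation "rSnd" => (19 : ℕ)
notation "rStarted" => (20 : ℕ)
notation "rFlag" => (21 : ℕ)
notation "rBest" => (22 : ℕ)
notation "rTrials" => (23 : ℕ)

infixr:60 " ;; " => Prog.seq

namespace Prog

abbrev const (x k : ℕ) : Prog := .instr (.const x k)
abbrev add (x y z : ℕ) : Prog := .instr (.add x y z)
abbrev sub (x y z : ℕ) : Prog := .instr (.sub x y z)
abbrev load (x y : ℕ) : Prog := .instr (.load x y)
abbrev store (x y : ℕ) : Prog := .instr (.store x y)
abbrev size (x : ℕ) : Prog := .instr (.size x)
abbrev adj (x y z : ℕ) : Prog := .instr (.adj x y z)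
abbrev flip (x : ℕ) : Prog := .instr (.flip x)

/-- Run `p` with register `i` equal to `0, …, n - 1`. -/
def forEach (i : ℕ) (p : Prog) : Prog :=
  .const i 0 ;; .add rTest rSize rZero ;;
    .while rTest (p ;; .add i i rOne ;; .sub rTest rSize i)

/-- Subtract register `d` from register `c` and run `p`, until `c` is zero. -/
def countdown (c d : ℕ) (p : Prog) : Prog :=
  .while c (.sub c c d ;; p)

/-- Run `p` a fixed number of times. -/
def rep : ℕ → Prog → Prog
  | 0, _ => .skip
  | m + 1, p => p ;; rep m p

/-- Branch on the entry with the index in register `x` of the array with the offset in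
register `o`. -/
def ifEntry (o x : ℕ) (p q : Prog) : Prog :=
  .add rAddr o x ;; .load rTmp rAddr ;; .ite rTmp p q

/-- Write register `y` into the entry with the index in register `x` of the array with the offset
in register `o`. -/
def setEntry (o x y : ℕ) : Prog :=
  .add rAddr o x ;; .store rAddr y

/-- Branch on the adjacency of the vertices in the registers `x` and `y`. -/
def ifAdj (x y : ℕ) (p q : Prog) : Prog :=
  .adj rTmp x y ;; .ite rTmp p q

end Prog

/-- The registers that hold `0`, `1`, `n` and the offsets of the arrays have their values. -/
structure Env (n : ℕ) (s : State) : Prop where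
  zero : s.reg rZero = 0
  one : s.reg rOne = 1
  size : s.reg rSize = n
  offH : s.reg rOffH = 2 * n
  offW : s.reg rOffW = 3 * n

theorem Env.of_reg {n : ℕ} {s s' : State} (h : Env n s) (h' : ∀ r < 5, s'.reg r = s.reg r) :
    Env n s' :=
  ⟨(h' _ (by omega)).trans h.zero, (h' _ (by omega)).trans h.one, (h' _ (by omega)).trans h.size,
    (h' _ (by omega)).trans h.offH, (h' _ (by omega)).trans h.offW⟩

theorem Env.set {n : ℕ} {s : State} (h : Env n s) {x v : ℕ} (hx : 5 ≤ x) : Env n (s.set x v) :=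
  h.of_reg fun r hr => by rw [State.reg_set, if_neg (by omega)]

/-- The program leaves the registers `0, …, 4` alone. This is decided by evaluation. -/
def Prog.keepsEnv (p : Prog) : Bool :=
  !(p.writes 0 || p.writes 1 || p.writes 2 || p.writes 3 || p.writes 4)

theorem Env.frame {n : ℕ} {p : Prog} {s s' : State} (h : Env n s) (hf : Frame p s s')
    (hp : p.keepsEnv = true) : Env n s' := by
  simp only [Prog.keepsEnv, Bool.not_eq_true', Bool.or_eq_false_iff] at hp
  refine h.of_reg fun r hr => hf.reg r ?_
  interval_cases r <;> tauto

/-- The set stored in the `k`-th array: the array of length `n` at the address `k * n`. -/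
def arr (n k : ℕ) (m : ℕ → ℕ) : Finset (Fin n) :=
  Finset.univ.filter fun v => m (k * n + v) ≠ 0

theorem mem_arr {n k : ℕ} {m : ℕ → ℕ} {v : Fin n} : v ∈ arr n k m ↔ m (k * n + v) ≠ 0 := by
  simp [arr]

theorem arr_update_self {n k : ℕ} {m : ℕ → ℕ} {j c : ℕ} {v : Fin n} :
    v ∈ arr n k (Function.update m (k * n + j) c) ↔
      if (v : ℕ) = j then c ≠ 0 else v ∈ arr n k m := by
  simp only [mem_arr, Function.update_apply]
  by_cases h : (v : ℕ) = j <;> simp [h]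

theorem arr_update_of_ne {n k k' : ℕ} {m : ℕ → ℕ} {j c : ℕ} (hj : j < n) (hk : k' ≠ k) :
    arr n k' (Function.update m (k * n + j) c) = arr n k' m := by
  ext v
  have hv := v.2
  have : k' * n + (v : ℕ) ≠ k * n + j := by
    intro h
    rcases lt_or_gt_of_ne hk with h' | h'
    · nlinarith [Nat.mul_le_mul_right n (Nat.succ_le_of_lt h')]
    · nlinarith [Nat.mul_le_mul_right n (Nat.succ_le_of_lt h')]
  simp [mem_arr, this]

/-- Other than in `arr_update_of_ne`, the index `j` may lie beyond the end of the `k`-th array. -/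
theorem arr_update_of_lt {n k k' : ℕ} {m : ℕ → ℕ} {j c : ℕ} (hk : k' < k) :
    arr n k' (Function.update m (k * n + j) c) = arr n k' m := by
  ext v
  have hv := v.2
  have : k' * n + (v : ℕ) ≠ k * n + j := by
    intro h
    nlinarith [Nat.mul_le_mul_right n (Nat.succ_le_of_lt hk)]
  simp [mem_arr, this]

theorem adjEntry_ne_zero {n : ℕ} {G : SimpleGraph (Fin n)} {a b : Fin n} :
    adjEntry G a b ≠ 0 ↔ G.Adj a b := by
  simp [adjEntry]

namespace RunsTo

variable {n : ℕ} {G : SimpleGraph (Fin n)} {ω : ℕ → Bool} {p q : Prog} {s : State} {T T₁ T₂ : ℕ}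
  {Q Q₁ : State → Prop}

/-- The rule for loops over all vertices: the invariant `I j` holds when `j` vertices have been
treated. -/
theorem forEach {i : ℕ} {I : ℕ → State → Prop} (he : Env n s) (hi : 5 ≤ i ∧ i ≠ rTest)
    (hp : p.keepsEnv = true) (hpi : p.writes i = false)
    (hI : ∀ j s' r v, r = i ∨ r = rTest → I j s' → I j (s'.set r v)) (h₀ : I 0 s)
    (step : ∀ j, j < n → ∀ s', I j s' → s'.reg i = j → Frame (.forEach i p) s s' → Env n s' →
      RunsTo G ω p s' T (I (j + 1))) :
    RunsTo G ω (.forEach i p) s ((T + 4) * (n + 1)) (I n) := by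
  have hcost : n * (T + 2 + 1) + 1 + 1 + 1 ≤ (T + 4) * (n + 1) := by nlinarith
  refine RunsTo.mono (Q₁ := I n) ?_ hcost fun _ h _ => h
  have h8 : i ≠ 8 := hi.2
  refine instr_seq (instr_seq ?_)
  simp only [Instr.eval]
  set s₀ := (s.set i 0).set rTest ((s.set i 0).reg rSize + (s.set i 0).reg rZero) with hs₀
  have hi2 : ¬ 2 = i := by omega
  have hi0 : ¬ 0 = i := by omega
  have hf₀ : Frame (.forEach i p) s s₀ := by
    refine ⟨fun r hr => ?_, fun _ => rfl, fun _ => rfl⟩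
    simp only [Prog.forEach, Prog.writes, Instr.writes, Bool.or_eq_false_iff, beq_eq_false_iff_ne]
      at hr
    simp [hs₀, Ne.symm hr.2.1, Ne.symm hr.1]
  refine RunsTo.loop (I := fun m s' => ∃ j, j + m = n ∧ I j s' ∧ s'.reg i = j ∧ s'.reg rTest = m) n
    ⟨0, by omega, hI _ _ _ _ (.inr rfl) (hI _ _ _ _ (.inl rfl) h₀), ?_, ?_⟩ ?_ ?_
  · simp [hs₀, h8]
  · simp [hs₀, hi2, hi0, he.size, he.zero]
  · rintro m s' ⟨j, hj, hIj, hij, hm⟩ hf hne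
    have hf' : Frame (.forEach i p) s s' := hf₀.trans
      (hf.mono (by simp +contextual [Prog.forEach, Prog.writes])
        (by simp +contextual [Prog.forEach, Prog.stores])
        (by simp +contextual [Prog.forEach, Prog.flips]))
    have he' : Env n s' := he.frame hf' (by
      simp only [Prog.keepsEnv, Bool.not_eq_true', Bool.or_eq_false_iff] at hp ⊢
      simp only [Prog.forEach, Prog.writes, Instr.writes, Bool.or_eq_false_iff,
        beq_eq_false_iff_ne]
      refine ⟨⟨⟨⟨?_, ?_⟩, ?_⟩, ?_⟩, ?_⟩ <;> (have := hi.1; simp [hp]; omega))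
    obtain ⟨m, rfl⟩ : ∃ m', m = m' + 1 := ⟨m - 1, by omega⟩
    refine ⟨m, rfl, (step j (by omega) s' hIj hij hf' he').seq le_rfl fun s₁ hI₁ hf₁ => ?_⟩
    have he₁ := he'.frame hf₁ hp
    refine instr_seq (instr (T := 0) ⟨j + 1, by omega, hI _ _ _ _ (.inr rfl)
      (hI _ _ _ _ (.inl rfl) hI₁), ?_, ?_⟩)
    · simp [Instr.eval, h8, hf₁.reg i hpi, hij, he₁.one]
    · simp [Instr.eval, hi2, hf₁.reg i hpi, hij, he₁.one, he₁.size]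
      omega
  · rintro m s' ⟨j, hj, hIj, -, hm⟩ - h0
    obtain rfl : j = n := by omega
    exact hIj

/-- The rule for loops that count down from `M` in steps of `D`. -/
theorem countdown {c d M D : ℕ} {I : ℕ → State → Prop} (hc : s.reg c = M) (hd : s.reg d = D)
    (hD : 0 < D) (hcd : c ≠ d) (hpc : p.writes c = false) (hpd : p.writes d = false)
    (hI : ∀ j s' v, I j s' → I j (s'.set c v)) (h₀ : I 0 s)
    (step : ∀ j, j < M ⌈/⌉ D → ∀ s', I j s' → Frame (.countdown c d p) s s' →
      RunsTo G ω p s' T (I (j + 1))) :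
    RunsTo G ω (.countdown c d p) s ((M ⌈/⌉ D) * (T + 2) + 1) (I (M ⌈/⌉ D)) := by
  have key : ∀ j, j < M ⌈/⌉ D ↔ D * j < M := fun j => by
    rw [← not_le, ceilDiv_le_iff_le_mul hD, not_le]
  refine RunsTo.loop (I := fun m s' => ∃ j, j + m = M ⌈/⌉ D ∧ I j s' ∧ s'.reg c = M - D * j)
    (M ⌈/⌉ D) ⟨0, by omega, h₀, by simp [hc]⟩ ?_ ?_
  · rintro m s' ⟨j, hj, hIj, hm⟩ hf hne
    have hf' : Frame (.countdown c d p) s s' := hf.while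
    have hlt : j < M ⌈/⌉ D := (key j).2 (by omega)
    obtain ⟨m, rfl⟩ : ∃ m', m = m' + 1 := ⟨m - 1, by omega⟩
    refine ⟨m, rfl, instr_seq ((step j hlt _ (hI _ _ _ hIj) ?_).mono le_rfl ?_)⟩
    · refine hf'.trans ⟨fun r hr => ?_, fun _ => rfl, fun _ => rfl⟩
      simp only [Prog.countdown, Prog.writes, Instr.writes, Bool.or_eq_false_iff,
        beq_eq_false_iff_ne] at hr
      simp [Ne.symm hr.1]
    · intro s'' hI'' hf''
      refine ⟨j + 1, by omega, hI'', ?_⟩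
      rw [hf''.reg c hpc]
      have hd' : s'.reg d = D := by
        rw [hf'.reg d, hd]
        simp [Prog.countdown, Prog.writes, Instr.writes, hpd, hcd]
      simp [hm, hd', Nat.mul_succ]
      omega
  · rintro m s' ⟨j, hj, hIj, hm⟩ - h0
    have : ¬ j < M ⌈/⌉ D := fun h => by have := (key j).1 h; omega
    obtain rfl : j = M ⌈/⌉ D := by omega
    exact hIj

theorem rep {I : ℕ → State → Prop} (m : ℕ) (h₀ : I 0 s)
    (step : ∀ j s', I j s' → RunsTo G ω p s' T (I (j + 1))) :
    RunsTo G ω (.rep m p) s (m * T + 1) (I m) := by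
  suffices H : ∀ m j s, I j s → RunsTo G ω (.rep m p) s (m * T + 1) (I (j + m)) by
    simpa using H m 0 s h₀
  intro m
  induction m with
  | zero => exact fun j s h => skip (T := 0 * T) h
  | succ m ih =>
    intro j s h
    refine (step j s h).seq (T₂ := m * T + 1) (by rw [Nat.succ_mul]; omega) fun s' h' _ => ?_
    have := ih (j + 1) s' h'
    rwa [show j + 1 + m = j + (m + 1) by omega] at this

theorem ifEntry {k o x : ℕ} {v : Fin n} (ho : s.reg o = k * n) (hx : s.reg x = v)
    (h₁ : ∀ a b, v ∈ arr n k s.mem → RunsTo G ω p ((s.set rAddr a).set rTmp b) T Q)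
    (h₂ : ∀ a b, v ∉ arr n k s.mem → RunsTo G ω q ((s.set rAddr a).set rTmp b) T Q) :
    RunsTo G ω (.ifEntry o x p q) s (T + 3) Q := by
  refine instr_seq (instr_seq (ite (fun h => h₁ _ _ ?_) (fun h => h₂ _ _ ?_)))
  · simpa [Instr.eval, ho, hx, mem_arr] using h
  · simpa [Instr.eval, ho, hx, mem_arr] using h

theorem ifAdj {x y a b : ℕ} (hx : s.reg x = a) (hy : s.reg y = b)
    (h₁ : ∀ c, adjEntry G a b ≠ 0 → RunsTo G ω p (s.set rTmp c) T Q)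
    (h₂ : ∀ c, adjEntry G a b = 0 → RunsTo G ω q (s.set rTmp c) T Q) :
    RunsTo G ω (.ifAdj x y p q) s (T + 2) Q := by
  refine instr_seq (ite (fun h => h₁ _ ?_) (fun h => h₂ _ ?_))
  · simpa [Instr.eval, hx, hy] using h
  · simpa [Instr.eval, hx, hy] using h

theorem setEntry {k o x y j c : ℕ} (ho : s.reg o = k * n) (hx : s.reg x = j) (hc : s.reg y = c)
    (hy : y ≠ rAddr)
    (h : ∀ a, Q { s.set rAddr a with mem := Function.update s.mem (k * n + j) c }) :
    RunsTo G ω (.setEntry o x y) s (T + 2) Q := by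
  refine instr_seq (instr ?_)
  simpa [Instr.eval, hy, ho, hx, hc] using h (k * n + j)

theorem setEntry_seq {k o x y j c : ℕ} (ho : s.reg o = k * n) (hx : s.reg x = j)
    (hc : s.reg y = c) (hy : y ≠ rAddr)
    (h : ∀ a, RunsTo G ω q
      { s.set rAddr a with mem := Function.update s.mem (k * n + j) c } T Q) :
    RunsTo G ω (.setEntry o x y ;; q) s (T + 2) Q :=
  (setEntry (T := 0) (Q := fun s' => RunsTo G ω q s' T Q) ho hx hc hy h).seq (by omega)
    fun _ h _ => h

end RunsTo

/-! ### Drawing random stars -/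

/-- The number with the binary digits of `a` followed by the `L` coin tosses from the `k`-th on. -/
def drawFrom (ω : ℕ → Bool) : ℕ → ℕ → ℕ → ℕ
  | a, _, 0 => a
  | a, k, L + 1 => drawFrom ω (2 * a + (ω k).toNat) (k + 1) L

/-- The number of coin tosses per random number: the least `b` with `2 n ≤ 2 ^ b`. -/
def drawLen (n : ℕ) : ℕ := Nat.clog 2 (2 * n)

/-- The vertex `v` together with its neighbours in `H`, as a subset of the set of all vertices:
`v` need not be a vertex, and then the set is empty. -/
noncomputable def starSet {n : ℕ} (G : SimpleGraph (Fin n)) (H : Finset (Fin n)) (v : ℕ) :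
    Finset (Fin n) :=
  Finset.univ.filter fun u => (u : ℕ) = v ∨ (adjEntry G v u ≠ 0 ∧ u ∈ H)

/-- The union of `W` and of `R` random stars with leaves in `H`; the centres are drawn with the
coin tosses from the `k`-th on. -/
noncomputable def addStars {n : ℕ} (G : SimpleGraph (Fin n)) (H : Finset (Fin n)) (ω : ℕ → Bool) :
    ℕ → ℕ → Finset (Fin n) → Finset (Fin n)
  | _, 0, W => W
  | k, R + 1, W =>
    addStars G H ω (k + drawLen n) R (W ∪ starSet G H (drawFrom ω 0 k (drawLen n)))

namespace Prog

/-- Draw a number with `drawLen n` random binary digits. -/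
def draw : Prog :=
  .const rDraw 0 ;; .add rPow rOne rZero ;; .sub rTest rOffH rPow ;;
    .while rTest (.flip rTmp ;; .add rDraw rDraw rDraw ;; .add rDraw rDraw rTmp ;;
      .add rPow rPow rPow ;; .sub rTest rOffH rPow)

/-- Add a random star to `W`. -/
def round : Prog :=
  draw ;; setEntry rOffW rDraw rOne ;;
    forEach rX (ifAdj rDraw rX (ifEntry rOffH rX (setEntry rOffW rX rOne) .skip) .skip)

/-- Add random stars to `W`. -/
def rounds : Prog :=
  .add rRem rWork rZero ;; countdown rRem rDeg round

/-- Empty `T`, fill `H`, and let `W` be random or, if `rFlag` is set, empty. -/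
def reset : Prog :=
  forEach rX (.flip rTmp ;; .sub rTmp rTmp rFlag ;; setEntry rSize rX rZero ;;
    setEntry rOffH rX rOne ;; setEntry rOffW rX rTmp)

end Prog

variable {n : ℕ} {G : SimpleGraph (Fin n)} {ω : ℕ → Bool} {s : State}

theorem draw_spec {k : ℕ} (he : Env n s) (hk : s.tossed = k) :
    RunsTo G ω .draw s (12 * n + 4) fun s' =>
      s'.reg rDraw = drawFrom ω 0 k (drawLen n) ∧ s'.tossed = k + drawLen n := by
  have hb : drawLen n ≤ 2 * n := Nat.clog_le_of_le_pow (Nat.lt_two_pow_self).le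
  have hlt : ∀ i, i < drawLen n ↔ 2 ^ i < 2 * n := fun i => by
    rw [drawLen, Nat.lt_clog_iff_pow_lt (by norm_num)]
  refine RunsTo.mono (T₁ := drawLen n * 6 + 1 + 1 + 1 + 1) (RunsTo.instr_seq (RunsTo.instr_seq
    (RunsTo.instr_seq (RunsTo.loop (T := 5) (I := fun m s' => ∃ i, i + m = drawLen n ∧
      s'.tossed = k + i ∧ s'.reg rPow = 2 ^ i ∧ s'.reg rTest = 2 * n - 2 ^ i ∧
      drawFrom ω (s'.reg rDraw) (k + i) m = drawFrom ω 0 k (drawLen n)) (drawLen n)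
      ?_ ?_ ?_)))) (by omega) fun _ h _ => h
  · exact ⟨0, by omega, by simp [Instr.eval, hk, he.one, he.zero, he.offH]⟩
  · rintro m s' ⟨i, hi, ht, hp, hr, hd⟩ hf hne
    have hi' : i < drawLen n := (hlt i).2 (by omega)
    obtain ⟨m, rfl⟩ : ∃ m', m = m' + 1 := ⟨m - 1, by omega⟩
    refine ⟨m, rfl, RunsTo.instr_seq (RunsTo.instr_seq (RunsTo.instr_seq (RunsTo.instr_seq
      (RunsTo.instr (T := 0) ⟨i + 1, by omega, ?_⟩))))⟩
    have hoff : s'.reg rOffH = 2 * n := (hf.reg _ rfl).trans (by simp [Instr.eval, he.offH])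
    refine ⟨by simp [Instr.eval, ht, Nat.add_assoc], by simp [Instr.eval, hp, pow_succ]; omega,
      by simp [Instr.eval, hp, hoff, pow_succ]; omega, ?_⟩
    rw [drawFrom] at hd
    rw [← hd]
    simp [Instr.eval, ht, two_mul, Nat.add_assoc]
  · rintro m s' ⟨i, hi, ht, hp, hr, hd⟩ - h0
    have : ¬ i < drawLen n := fun h => by have := (hlt i).1 h; omega
    obtain rfl : i = drawLen n := by omega
    obtain rfl : m = 0 := by omega
    exact ⟨hd, ht⟩

theorem round_spec {k : ℕ} (he : Env n s) (hk : s.tossed = k) :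
    RunsTo G ω .round s (24 * (n + 1)) fun s' =>
      s'.tossed = k + drawLen n ∧
      arr n 3 s'.mem = arr n 3 s.mem ∪ starSet G (arr n 2 s.mem) (drawFrom ω 0 k (drawLen n)) ∧
      ∀ i < 3, arr n i s'.mem = arr n i s.mem := by
  refine (draw_spec he hk).seq (T₂ := 2 + 11 * (n + 1)) (by omega) fun s₁ h₁ hf₁ => ?_
  obtain ⟨hd, ht⟩ := h₁
  have he₁ := he.frame hf₁ rfl
  have hm₁ : s₁.mem = s.mem := hf₁.mem rfl
  set v := drawFrom ω 0 k (drawLen n)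
  refine (RunsTo.setEntry (T := 0) (Q := fun s' => s'.mem = Function.update s.mem (3 * n + v) 1 ∧
    s'.tossed = k + drawLen n ∧ s'.reg rDraw = v ∧ Env n s')
    he₁.offW hd he₁.one (by decide) fun a => ?_).seq
    (T₂ := 11 * (n + 1)) (by omega) fun s₂ h₂ hf₂ => ?_
  · refine ⟨by simp [hm₁], by simp [ht], by simp [hd], ?_⟩
    exact (he₁.set (x := rAddr) (v := a) (by omega)).of_reg fun _ _ => rfl
  obtain ⟨hm₂, ht₂, hd₂, he₂⟩ := h₂
  refine (RunsTo.forEach (T := 7) (I := fun j s' => s'.tossed = k + drawLen n ∧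
    (∀ u, u ∈ arr n 3 s'.mem ↔ u ∈ arr n 3 s.mem ∨ (u : ℕ) = v ∨
      ((u : ℕ) < j ∧ adjEntry G v u ≠ 0 ∧ u ∈ arr n 2 s.mem)) ∧
    ∀ i < 3, arr n i s'.mem = arr n i s.mem) he₂ (by decide) rfl rfl ?_ ?_ ?_).mono le_rfl ?_
  · intro j s' r w _ h
    exact h
  · refine ⟨ht₂, fun u => ?_, fun i hi => by rw [hm₂, arr_update_of_lt hi]⟩
    rw [hm₂, arr_update_self]
    by_cases h : (u : ℕ) = v <;> simp [h]
  · rintro j hj s' ⟨hts, hW, hA⟩ hx hf he'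
    have hds : s'.reg rDraw = v := (hf.reg _ rfl).trans hd₂
    have hlt : ∀ u : Fin n, (u : ℕ) < j + 1 ↔ (u : ℕ) < j ∨ u = ⟨j, hj⟩ := fun u => by
      rw [Fin.ext_iff]; exact Nat.lt_succ_iff_lt_or_eq
    refine RunsTo.ifAdj (T := 5) hds hx (fun c hc => ?_) fun c hc => ?_
    · refine RunsTo.ifEntry (T := 2) (k := 2) (v := ⟨j, hj⟩) (by simp [he'.offH]) (by simp [hx])
        (fun a b h => ?_) fun a b h => ?_
      · rw [State.mem_set, hA 2 (by omega)] at h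
        refine RunsTo.setEntry (T := 0) (k := 3) (j := j) (c := 1) (by simp [he'.offW])
          (by simp [hx]) (by simp [he'.one]) (by decide) fun a' => ⟨hts, fun u => ?_, fun i hi => ?_⟩
        · simp only [State.mem_set, arr_update_self, hlt, hW]
          by_cases hu : u = ⟨j, hj⟩
          · subst hu
            simp [hc, h]
          · have : (u : ℕ) ≠ j := fun h => hu (Fin.ext h)
            simp [hu, this]
        · exact (arr_update_of_lt hi).trans (hA i hi)
      · rw [State.mem_set, hA 2 (by omega)] at h
        refine RunsTo.skip ⟨hts, fun u => ?_, hA⟩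
        simp only [State.mem_set, hW, hlt]
        by_cases hu : u = ⟨j, hj⟩
        · subst hu; simp [h]
        · simp [hu]
    · refine RunsTo.skip ⟨hts, fun u => ?_, hA⟩
      simp only [State.mem_set, hW, hlt]
      by_cases hu : u = ⟨j, hj⟩
      · subst hu; simp [hc]
      · simp [hu]
  · rintro s' ⟨hts, hW, hA⟩ -
    refine ⟨hts, ?_, hA⟩
    ext u
    simp [hW, starSet]

/-- The state between the parts of the main loop: the global parameters are in their registers. -/
structure Ready (G : SimpleGraph (Fin n)) (q : ℕ) (s : State) : Prop extends Env n s where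
  deg : s.reg rDeg = maxDeg G
  scale : s.reg rScale = q
  work : s.reg rWork = q ^ 3 * n

/-- The program leaves the registers `0, …, 7` alone. -/
def Prog.keepsReady (p : Prog) : Bool :=
  p.keepsEnv && !(p.writes 5 || p.writes 6 || p.writes 7)

theorem Ready.frame {q : ℕ} {p : Prog} {s s' : State} (h : Ready G q s) (hf : Frame p s s')
    (hp : p.keepsReady = true) : Ready G q s' := by
  simp only [Prog.keepsReady, Bool.and_eq_true, Bool.not_eq_true', Bool.or_eq_false_iff] at hp
  exact ⟨h.toEnv.frame hf hp.1, (hf.reg _ hp.2.1.1).trans h.deg,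
    (hf.reg _ hp.2.1.2).trans h.scale, (hf.reg _ hp.2.2).trans h.work⟩

/-- The number of random stars that are drawn in a row: about `q ^ 3 n / Δ`. -/
noncomputable def numRounds (G : SimpleGraph (Fin n)) (q : ℕ) : ℕ := (q ^ 3 * n) ⌈/⌉ maxDeg G

theorem rounds_spec {q k : ℕ} (he : Ready G q s) (hΔ : 0 < maxDeg G) (hk : s.tossed = k) :
    RunsTo G ω .rounds s (numRounds G q * (24 * (n + 1) + 2) + 2) fun s' =>
      s'.tossed = k + numRounds G q * drawLen n ∧
      arr n 3 s'.mem = addStars G (arr n 2 s.mem) ω k (numRounds G q) (arr n 3 s.mem) ∧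
      ∀ i < 3, arr n i s'.mem = arr n i s.mem := by
  refine RunsTo.instr_seq ?_
  refine (RunsTo.countdown (M := q ^ 3 * n) (D := maxDeg G) (I := fun j s' =>
    s'.tossed = k + j * drawLen n ∧ addStars G (arr n 2 s.mem) ω (k + j * drawLen n)
      (numRounds G q - j) (arr n 3 s'.mem) =
        addStars G (arr n 2 s.mem) ω k (numRounds G q) (arr n 3 s.mem) ∧
      ∀ i < 3, arr n i s'.mem = arr n i s.mem) ?_ ?_ hΔ (by decide) rfl rfl ?_ ?_ ?_).mono le_rfl ?_
  · simp [Instr.eval, he.work, he.zero]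
  · simp [Instr.eval, he.deg]
  · intro j s' v h
    exact h
  · exact ⟨by simp [Instr.eval, hk], by simp [Instr.eval], fun i _ => rfl⟩
  · rintro j hj s' ⟨ht, hW, hA⟩ hf
    have he' : Env n s' := (he.toEnv.set (x := rRem) (by decide)).frame hf rfl
    refine (round_spec he' ht).mono le_rfl ?_
    rintro s₁ ⟨ht₁, hW₁, hA₁⟩ -
    refine ⟨by rw [ht₁]; ring, ?_, fun i hi => (hA₁ i hi).trans (hA i hi)⟩
    obtain ⟨r, hr⟩ : ∃ r, numRounds G q - j = r + 1 := ⟨numRounds G q - j - 1, by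
      have : j < numRounds G q := hj
      omega⟩
    rw [← hW, hr, hW₁, hA 2 (by omega), addStars,
      show numRounds G q - (j + 1) = r by omega, Nat.succ_mul, Nat.add_assoc]
  · rintro s' ⟨ht, hW, hA⟩ -
    refine ⟨ht, ?_, hA⟩
    rw [← hW, numRounds, Nat.sub_self, addStars]

theorem reset_spec {z k : ℕ} (he : Env n s) (hz : s.reg rFlag = z) (hk : s.tossed = k) :
    RunsTo G ω .reset s (12 * (n + 1)) fun s' =>
      s'.tossed = k + n ∧ arr n 0 s'.mem = arr n 0 s.mem ∧ arr n 1 s'.mem = ∅ ∧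
      arr n 2 s'.mem = Finset.univ ∧
      arr n 3 s'.mem = Finset.univ.filter fun u : Fin n => (ω (k + u)).toNat - z ≠ 0 := by
  refine (RunsTo.forEach (T := 8) (I := fun j s' => s'.tossed = k + j ∧
    arr n 0 s'.mem = arr n 0 s.mem ∧ (∀ u : Fin n, (u : ℕ) < j → u ∉ arr n 1 s'.mem) ∧
    (∀ u : Fin n, (u : ℕ) < j → u ∈ arr n 2 s'.mem) ∧
    (∀ u : Fin n, (u : ℕ) < j → (u ∈ arr n 3 s'.mem ↔ (ω (k + u)).toNat - z ≠ 0)))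
    he (by decide) rfl rfl ?_ ?_ ?_).mono le_rfl ?_
  · intro j s' r w _ h
    exact h
  · simp [hk]
  · rintro j hj s₀ ⟨ht, h0, h1, h2, h3⟩ hx hf he'
    have hz' : s₀.reg rFlag = z := (hf.reg _ rfl).trans hz
    refine RunsTo.instr_seq (RunsTo.instr_seq (RunsTo.setEntry_seq (k := 1) (j := j) (c := 0)
      (by simp [Instr.eval, he'.size]) (by simp [Instr.eval, hx]) (by simp [Instr.eval, he'.zero])
      (by decide) fun a₁ => RunsTo.setEntry_seq (k := 2) (j := j) (c := 1)
      (by simp [Instr.eval, he'.offH]) (by simp [Instr.eval, hx]) (by simp [Instr.eval, he'.one])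
      (by decide) fun a₂ => RunsTo.setEntry (T := 0) (k := 3) (j := j)
      (c := (ω (k + j)).toNat - z)
      (by simp [Instr.eval, he'.offW]) (by simp [Instr.eval, hx]) (by simp [Instr.eval, hz', ht])
      (by decide) fun a₃ => ?_))
    simp only [Instr.eval, State.mem_set, State.tossed_set]
    have hlt : ∀ u : Fin n, (u : ℕ) < j + 1 → (u : ℕ) = j ∨ ((u : ℕ) < j ∧ (u : ℕ) ≠ j) :=
      fun u hu => by omega
    refine ⟨by omega, ?_, fun u hu => ?_, fun u hu => ?_, fun u hu => ?_⟩
    · rw [arr_update_of_ne hj (by decide), arr_update_of_ne hj (by decide),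
        arr_update_of_ne hj (by decide), h0]
    · rw [arr_update_of_ne hj (by decide), arr_update_of_ne hj (by decide), arr_update_self]
      obtain h | ⟨h, h'⟩ := hlt u hu
      · simp [h]
      · simpa [h'] using h1 u h
    · rw [arr_update_of_ne hj (by decide), arr_update_self]
      obtain h | ⟨h, h'⟩ := hlt u hu
      · simp [h]
      · rw [if_neg h', arr_update_of_ne hj (by decide)]
        exact h2 u h
    · rw [arr_update_self]
      obtain h | ⟨h, h'⟩ := hlt u hu
      · simp [h]
      · rw [if_neg h', arr_update_of_ne hj (by decide), arr_update_of_ne hj (by decide)]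
        exact h3 u h
  · rintro s' ⟨ht, h0, h1, h2, h3⟩ -
    refine ⟨ht, h0, ?_, ?_, ?_⟩ <;> ext u
    · simp [h1 u u.2]
    · simp [h2 u u.2]
    · simp [h3 u u.2]

/-! ### Growing a connected vertex cover -/

/-- The vertex `x` may join `T`: it is adjacent to `T`, or `T` is still empty. -/
def Reach {n : ℕ} (G : SimpleGraph (Fin n)) (T : Finset (Fin n)) (x : Fin n) : Prop :=
  T = ∅ ∨ ∃ y ∈ T, G.Adj x y

/-- One step in the growth of `T`: it takes a reachable vertex of `W` or, if there is none, both
ends of an uncovered edge with a reachable end. -/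
inductive GrowStep {n : ℕ} (G : SimpleGraph (Fin n)) (W T : Finset (Fin n)) :
    Finset (Fin n) → Prop
  | take (x : Fin n) : x ∈ W → x ∉ T → Reach G T x → GrowStep G W T (insert x T)
  | edge (x y : Fin n) : (∀ z ∈ W, z ∉ T → ¬ Reach G T z) → x ∉ T → Reach G T x → y ∉ T →
      G.Adj x y → GrowStep G W T (insert y (insert x T))

/-- No step is possible. -/
structure Stuck {n : ℕ} (G : SimpleGraph (Fin n)) (W T : Finset (Fin n)) : Prop where
  take : ∀ z ∈ W, z ∉ T → ¬ Reach G T z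
  edge : ∀ x ∉ T, Reach G T x → ∀ y ∉ T, ¬ G.Adj x y

/-- `T` is the final result of a growth with preferred vertices `W`. -/
def Grown {n : ℕ} (G : SimpleGraph (Fin n)) (W T : Finset (Fin n)) : Prop :=
  Relation.ReflTransGen (GrowStep G W) ∅ T ∧ Stuck G W T

theorem GrowStep.card_lt {n : ℕ} {G : SimpleGraph (Fin n)} {W T T' : Finset (Fin n)}
    (h : GrowStep G W T T') : T.card < T'.card := by
  cases h with
  | take x _ hx _ => simp [hx]
  | edge x y _ hx _ hy hxy =>
    have : y ∉ insert x T := by simp [hy, hxy.ne']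
    rw [Finset.card_insert_of_notMem this, Finset.card_insert_of_notMem hx]
    omega

theorem GrowStep.nonempty {n : ℕ} {G : SimpleGraph (Fin n)} {W T T' : Finset (Fin n)}
    (h : GrowStep G W T T') : T' ≠ ∅ := by
  cases h <;> simp

namespace Prog

/-- `rCount` becomes nonzero iff the vertex in `rX` is reachable. -/
def reach : Prog :=
  .sub rCount rOne rStarted ;;
    forEach rY (ifEntry rSize rY (.adj rTmp rX rY ;; .add rCount rCount rTmp) .skip)

/-- Run `p` if the vertex in `rX` lies outside of `T` and is reachable. -/
def ifFrontier (p : Prog) : Prog :=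
  ifEntry rSize rX .skip (reach ;; .ite rCount p .skip)

/-- Search for an uncovered edge with a reachable end. -/
def findEdge : Prog :=
  forEach rX (ifFrontier (forEach rY (ifEntry rSize rY .skip (ifAdj rX rY
    (.add rFst rX rZero ;; .add rSnd rY rZero ;; .const rFound 1) .skip))))

/-- Search for a reachable vertex of `W`. -/
def findVertex : Prog :=
  forEach rX (ifFrontier (ifEntry rOffW rX
    (.add rFst rX rZero ;; .add rSnd rX rZero ;; .const rFound 1) .skip))

/-- One step in the growth of `T`. A vertex of `W` overrides an edge that was found before. -/
def growStep : Prog :=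
  .const rFound 0 ;; findEdge ;; findVertex ;;
    .ite rFound (setEntry rSize rFst rOne ;; setEntry rSize rSnd rOne ;; .const rStarted 1) .skip

/-- Grow `T` from the empty set. -/
def grow : Prog :=
  .const rStarted 0 ;; .const rFound 1 ;; .while rFound growStep

end Prog

theorem Finset.card_filter_lt_succ (P : Fin n → Prop) [DecidablePred P] {j : ℕ} (hj : j < n) :
    (Finset.univ.filter fun v : Fin n => (v : ℕ) < j + 1 ∧ P v).card =
      (Finset.univ.filter fun v : Fin n => (v : ℕ) < j ∧ P v).card +
        if P ⟨j, hj⟩ then 1 else 0 := by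
  have key : (Finset.univ.filter fun v : Fin n => (v : ℕ) < j + 1 ∧ P v) =
      (Finset.univ.filter fun v : Fin n => (v : ℕ) < j ∧ P v) ∪
        (Finset.univ.filter fun v : Fin n => v = ⟨j, hj⟩ ∧ P v) := by
    ext v
    simp only [Finset.mem_filter, Finset.mem_univ, true_and, Finset.mem_union, Fin.ext_iff]
    rw [Nat.lt_succ_iff_lt_or_eq]
    tauto
  rw [key, Finset.card_union_of_disjoint]
  · congr 1
    split_ifs with h
    · rw [Finset.card_eq_one]
      exact ⟨⟨j, hj⟩, by ext v; simp +contextual [h]⟩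
    · rw [Finset.card_eq_zero]
      ext v
      simp +contextual [h]
  · rw [Finset.disjoint_left]
    simp +contextual [Fin.ext_iff]
    omega

/-- The rule for loops that count in `rCount`, with weight `w`, the vertices that satisfy `P`. -/
theorem RunsTo.count {i w c T : ℕ} {p : Prog} (P : Fin n → Prop) [DecidablePred P] (he : Env n s)
    (hi : 5 ≤ i ∧ i ≠ rTest ∧ i ≠ rCount) (hp : p.keepsEnv = true) (hpi : p.writes i = false)
    (hc : s.reg rCount = c)
    (step : ∀ v : Fin n, ∀ s' : State, s'.reg i = v → Frame (.forEach i p) s s' → Env n s' →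
      RunsTo G ω p s' T fun s'' => s''.reg rCount = s'.reg rCount + if P v then w else 0) :
    RunsTo G ω (.forEach i p) s ((T + 4) * (n + 1)) fun s' =>
      s'.reg rCount = c + w * (Finset.univ.filter P).card := by
  refine (RunsTo.forEach (I := fun j s' => s'.reg rCount =
    c + w * (Finset.univ.filter fun v : Fin n => (v : ℕ) < j ∧ P v).card) he ⟨hi.1, hi.2.1⟩ hp hpi
    ?_ ?_ ?_).mono le_rfl ?_
  · rintro j s' r v hr h
    have : ¬ 16 = r := by rcases hr with rfl | rfl <;> [exact Ne.symm hi.2.2; decide]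
    simpa [this] using h
  · simp [hc]
  · rintro j hj s' h hx hf he'
    refine (step ⟨j, hj⟩ s' hx hf he').mono le_rfl fun s'' h' _ => ?_
    rw [h', h, Finset.card_filter_lt_succ P hj]
    split_ifs <;> ring
  · rintro s' h -
    simpa using h

theorem reach_spec {x : Fin n} (he : Env n s) (hx : s.reg rX = x)
    (hs : s.reg rStarted = if arr n 1 s.mem = ∅ then 0 else 1) :
    RunsTo G ω .reach s (9 * (n + 1) + 1) fun s' =>
      s'.reg rCount ≠ 0 ↔ Reach G (arr n 1 s.mem) x := by
  classical
  refine RunsTo.instr_seq ((RunsTo.count (T := 5) (w := 1) (c := 1 - s.reg rStarted)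
    (P := fun y => y ∈ arr n 1 s.mem ∧ G.Adj x y) (he.set (by decide)) (by decide) rfl rfl
    (by simp [he.one]) ?_).mono le_rfl ?_)
  · intro y s' hy hf he'
    have hx' : s'.reg rX = x := (hf.reg _ rfl).trans (by simp [hx])
    have hm : s'.mem = s.mem := hf.mem rfl
    refine RunsTo.ifEntry (T := 2) (k := 1) (v := y) (by simp [he'.size]) hy (fun a b h => ?_)
      fun a b h => ?_
    · rw [hm] at h
      refine RunsTo.instr_seq (RunsTo.instr (T := 0) ?_)
      simp [Instr.eval, hx', hy, h, adjEntry]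
    · rw [hm] at h
      exact RunsTo.skip (by simp [h])
  · intro s' h' _
    rw [h', hs, Reach]
    by_cases h : arr n 1 s.mem = ∅
    · simp [h]
    · simp [h, Finset.filter_eq_empty_iff]

theorem ifFrontier_spec {x : Fin n} {p : Prog} {T : ℕ} {Q : State → Prop} (he : Env n s)
    (hx : s.reg rX = x) (hs : s.reg rStarted = if arr n 1 s.mem = ∅ then 0 else 1)
    (h₁ : x ∉ arr n 1 s.mem → Reach G (arr n 1 s.mem) x → ∀ s', Frame (.ifFrontier .skip) s s' →
      RunsTo G ω p s' (T + 1) Q)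
    (h₂ : ¬ (x ∉ arr n 1 s.mem ∧ Reach G (arr n 1 s.mem) x) →
      ∀ s', Frame (.ifFrontier .skip) s s' → Q s') :
    RunsTo G ω (.ifFrontier p) s (9 * (n + 1) + T + 6) Q := by
  have hfr : ∀ a b, Frame (.ifFrontier .skip) s ((s.set rAddr a).set rTmp b) := fun a b => by
    refine ⟨fun r hr => ?_, fun _ => rfl, fun _ => rfl⟩
    have h9 : r ≠ 9 := by rintro rfl; exact absurd hr (by decide)
    have h10 : r ≠ 10 := by rintro rfl; exact absurd hr (by decide)
    simp [h9, h10]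
  refine RunsTo.ifEntry (T := 9 * (n + 1) + T + 3) (k := 1) (v := x) (by simp [he.size]) hx
    (fun a b h => RunsTo.skip (h₂ (by tauto) _ (hfr a b))) fun a b h => ?_
  refine (reach_spec (s := (s.set rAddr a).set rTmp b) (x := x) ((he.set (by decide)).set (by decide)) (by simp [hx])
    hs).seq (T₂ := T + 2) (by omega) fun s' h' hf' => ?_
  have hf'' : Frame (.ifFrontier .skip) s s' := (hfr a b).trans
    (hf'.mono (fun r => by
      simp +contextual [Prog.ifFrontier, Prog.ifEntry, Prog.writes]) (fun _ => rfl) fun _ => rfl)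
  refine RunsTo.ite (fun hc => h₁ h (h'.1 hc) s' hf'') fun hc => RunsTo.skip (h₂ ?_ s' hf'')
  exact fun h => absurd hc (h'.2 h.2)

/-- The registers `rFst` and `rSnd` hold an uncovered edge with a reachable end. -/
def FoundEdge (G : SimpleGraph (Fin n)) (T : Finset (Fin n)) (s : State) : Prop :=
  s.reg rFound = 1 ∧ ∃ x y : Fin n, s.reg rFst = x ∧ s.reg rSnd = y ∧ x ∉ T ∧ Reach G T x ∧
    y ∉ T ∧ G.Adj x y

/-- The registers `rFst` and `rSnd` hold a reachable vertex of `W`. -/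
def FoundVertex (G : SimpleGraph (Fin n)) (W T : Finset (Fin n)) (s : State) : Prop :=
  s.reg rFound = 1 ∧ ∃ x : Fin n, s.reg rFst = x ∧ s.reg rSnd = x ∧ x ∈ W ∧ x ∉ T ∧ Reach G T x

theorem FoundEdge.of_reg {T : Finset (Fin n)} {s s' : State} (h : FoundEdge G T s)
    (hs : ∀ r, 17 ≤ r → r ≤ 19 → s'.reg r = s.reg r) : FoundEdge G T s' := by
  rwa [FoundEdge, hs 17 (by omega) (by omega), hs 18 (by omega) (by omega),
    hs 19 (by omega) (by omega)]

theorem FoundVertex.of_reg {W T : Finset (Fin n)} {s s' : State} (h : FoundVertex G W T s)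
    (hs : ∀ r, 17 ≤ r → r ≤ 19 → s'.reg r = s.reg r) : FoundVertex G W T s' := by
  rwa [FoundVertex, hs 17 (by omega) (by omega), hs 18 (by omega) (by omega),
    hs 19 (by omega) (by omega)]

theorem Frame.found {s s' : State} (h : Frame (.ifFrontier .skip) s s') :
    ∀ r, 17 ≤ r → r ≤ 19 → s'.reg r = s.reg r := fun r h₁ h₂ =>
  h.reg r (by interval_cases r <;> rfl)

theorem State.set_found {s : State} {r v : ℕ} (hr : r < 17) :
    ∀ r', 17 ≤ r' → r' ≤ 19 → (s.set r v).reg r' = s.reg r' := fun r' h₁ _ => by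
  rw [State.reg_set, if_neg (by omega)]

theorem findEdge_spec {T : Finset (Fin n)} (he : Env n s) (hT : arr n 1 s.mem = T)
    (hs : s.reg rStarted = if T = ∅ then 0 else 1) (h0 : s.reg rFound = 0) :
    RunsTo G ω .findEdge s ((22 * (n + 1) + 10) * (n + 1)) fun s' =>
      FoundEdge G T s' ∨
        (s'.reg rFound = 0 ∧ ∀ x ∉ T, Reach G T x → ∀ y ∉ T, ¬ G.Adj x y) := by
  subst hT
  set T := arr n 1 s.mem with hT
  refine (RunsTo.forEach (T := 9 * (n + 1) + 13 * (n + 1) + 6) (I := fun j s' =>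
    FoundEdge G T s' ∨ (s'.reg rFound = 0 ∧
      ∀ x : Fin n, (x : ℕ) < j → x ∉ T → Reach G T x → ∀ y ∉ T, ¬ G.Adj x y)) he
    (by decide) rfl rfl ?_ ?_ ?_).mono (Nat.mul_le_mul_right _ (by omega)) ?_
  · rintro j s' r v hr (h | h)
    · exact .inl (h.of_reg (State.set_found (by omega)))
    · right
      rwa [State.set_found (by omega) 17 le_rfl (by omega)]
  · exact .inr ⟨h0, fun x hx => absurd hx (by omega)⟩
  · rintro j hj s₁ h hx hf he₁
    have hm₁ : s₁.mem = s.mem := hf.mem rfl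
    refine ifFrontier_spec (x := ⟨j, hj⟩) he₁ hx (by rw [hm₁, hf.reg _ rfl, hs]) ?_ ?_
    · intro hxT hxR s₂ hf₂
      rw [hm₁] at hxT hxR
      have he₂ : Env n s₂ := he₁.frame hf₂ rfl
      have hm₂ : s₂.mem = s.mem := (hf₂.mem rfl).trans hm₁
      have hx₂ : s₂.reg rX = j := (hf₂.reg _ rfl).trans hx
      refine (RunsTo.forEach (T := 8) (I := fun i s' => FoundEdge G T s' ∨ (s'.reg rFound = 0 ∧
          (∀ x : Fin n, (x : ℕ) < j → x ∉ T → Reach G T x → ∀ y ∉ T, ¬ G.Adj x y) ∧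
          ∀ y : Fin n, (y : ℕ) < i → y ∉ T → ¬ G.Adj ⟨j, hj⟩ y)) he₂ (by decide) rfl rfl
        ?_ ?_ ?_).mono (by omega) ?_
      · rintro j s' r v hr (h | h)
        · exact .inl (h.of_reg (State.set_found (by omega)))
        · right
          rwa [State.set_found (by omega) 17 le_rfl (by omega)]
      · rcases h with h | ⟨h, h'⟩
        · exact .inl (h.of_reg hf₂.found)
        · exact .inr ⟨(hf₂.reg _ rfl).trans h, h', fun y hy => absurd hy (by omega)⟩
      · rintro i hi s₃ h₃ hy hf₃ he₃
        have hm₃ : s₃.mem = s.mem := (hf₃.mem rfl).trans hm₂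
        have hx₃ : s₃.reg rX = j := (hf₃.reg _ rfl).trans hx₂
        have hskip : ∀ s' : State, (∀ r, 17 ≤ r → r ≤ 19 → s'.reg r = s₃.reg r) →
            ((⟨i, hi⟩ : Fin n) ∉ T → ¬ G.Adj ⟨j, hj⟩ ⟨i, hi⟩) →
            FoundEdge G T s' ∨ (s'.reg rFound = 0 ∧
              (∀ x : Fin n, (x : ℕ) < j → x ∉ T → Reach G T x → ∀ y ∉ T, ¬ G.Adj x y) ∧
              ∀ y : Fin n, (y : ℕ) < i + 1 → y ∉ T → ¬ G.Adj ⟨j, hj⟩ y) := by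
          intro s' hs' hn
          rcases h₃ with h | ⟨h, h', h''⟩
          · exact .inl (h.of_reg hs')
          · refine .inr ⟨(hs' 17 le_rfl (by omega)).trans h, h', fun y hy hyT => ?_⟩
            rcases Nat.lt_succ_iff_lt_or_eq.1 hy with hy | hy
            · exact h'' y hy hyT
            · obtain rfl : y = ⟨i, hi⟩ := Fin.ext hy
              exact hn hyT
        refine RunsTo.ifEntry (T := 5) (k := 1) (v := ⟨i, hi⟩) (by simp [he₃.size]) hy
          (fun a b h => RunsTo.skip (hskip _ (fun r h₁ h₂ => ?_) ?_)) fun a b h =>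
          RunsTo.ifAdj (T := 3) (a := j) (b := i) (by simp [hx₃]) (by simp [hy])
            (fun c hc => ?_) fun c hc => RunsTo.skip (hskip _ (fun r h₁ h₂ => ?_) fun _ h => ?_)
        · simp only [State.reg_set]
          rw [if_neg (by omega), if_neg (by omega)]
        · rw [hm₃] at h
          exact fun h' => absurd h h'
        · rw [hm₃] at h
          refine RunsTo.instr_seq (RunsTo.instr_seq (RunsTo.instr (T := 0) (.inl ⟨?_, ⟨j, hj⟩,
            ⟨i, hi⟩, ?_, ?_, hxT, hxR, h, ?_⟩)))
          · simp [Instr.eval]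
          · simp [Instr.eval, hx₃, he₃.zero]
          · simp [Instr.eval, hy, he₃.zero]
          · exact adjEntry_ne_zero.1 hc
        · simp only [State.reg_set]
          rw [if_neg (by omega), if_neg (by omega), if_neg (by omega)]
        · exact adjEntry_ne_zero.2 h hc
      · rintro s' (h | ⟨h, h', h''⟩) -
        · exact .inl h
        · refine .inr ⟨h, fun x hx hxT hxR y hy => ?_⟩
          rcases Nat.lt_succ_iff_lt_or_eq.1 hx with hx | hx
          · exact h' x hx hxT hxR y hy
          · obtain rfl : x = ⟨j, hj⟩ := Fin.ext hx
            exact h'' y y.2 hy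
    · intro hn s₂ hf₂
      rw [hm₁] at hn
      rcases h with h | ⟨h, h'⟩
      · exact .inl (h.of_reg hf₂.found)
      · refine .inr ⟨(hf₂.reg _ rfl).trans h, fun x hx hxT hxR => ?_⟩
        rcases Nat.lt_succ_iff_lt_or_eq.1 hx with hx | hx
        · exact h' x hx hxT hxR
        · obtain rfl : x = ⟨j, hj⟩ := Fin.ext hx
          exact absurd ⟨hxT, hxR⟩ hn
  · rintro s' (h | ⟨h, h'⟩) -
    · exact .inl h
    · exact .inr ⟨h, fun x => h' x x.2⟩

theorem findVertex_spec {W T : Finset (Fin n)} {f a b : ℕ} (he : Env n s) (hT : arr n 1 s.mem = T)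
    (hW : arr n 3 s.mem = W) (hs : s.reg rStarted = if T = ∅ then 0 else 1)
    (hf : s.reg rFound = f) (ha : s.reg rFst = a) (hb : s.reg rSnd = b) :
    RunsTo G ω .findVertex s ((9 * (n + 1) + 16) * (n + 1)) fun s' =>
      FoundVertex G W T s' ∨ ((s'.reg rFound = f ∧ s'.reg rFst = a ∧ s'.reg rSnd = b) ∧
        ∀ z ∈ W, z ∉ T → ¬ Reach G T z) := by
  have hc : ∀ s s' : State, (∀ r, 17 ≤ r → r ≤ 19 → s'.reg r = s.reg r) →
      (s.reg rFound = f ∧ s.reg rFst = a ∧ s.reg rSnd = b) →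
      s'.reg rFound = f ∧ s'.reg rFst = a ∧ s'.reg rSnd = b := fun s s' h h' => by
    rwa [h 17 (by omega) (by omega), h 18 (by omega) (by omega), h 19 (by omega) (by omega)]
  refine (RunsTo.forEach (T := 9 * (n + 1) + 5 + 6) (I := fun j s' =>
    FoundVertex G W T s' ∨ ((s'.reg rFound = f ∧ s'.reg rFst = a ∧ s'.reg rSnd = b) ∧
      ∀ z : Fin n, (z : ℕ) < j → z ∈ W → z ∉ T → ¬ Reach G T z)) he
    (by decide) rfl rfl ?_ ?_ ?_).mono (Nat.mul_le_mul_right _ (by omega)) ?_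
  · rintro j s' r v hr (h | h)
    · exact .inl (h.of_reg (State.set_found (by omega)))
    · exact .inr ⟨hc _ _ (State.set_found (by omega)) h.1, h.2⟩
  · exact .inr ⟨⟨hf, ha, hb⟩, fun x hx => absurd hx (by omega)⟩
  · rintro j hj s₁ h hx hf₁ he₁
    have hm₁ : s₁.mem = s.mem := hf₁.mem rfl
    have hskip : ∀ s' : State, (∀ r, 17 ≤ r → r ≤ 19 → s'.reg r = s₁.reg r) →
        ((⟨j, hj⟩ : Fin n) ∈ W → (⟨j, hj⟩ : Fin n) ∉ T → ¬ Reach G T ⟨j, hj⟩) →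
        FoundVertex G W T s' ∨ ((s'.reg rFound = f ∧ s'.reg rFst = a ∧ s'.reg rSnd = b) ∧
          ∀ z : Fin n, (z : ℕ) < j + 1 → z ∈ W → z ∉ T → ¬ Reach G T z) := by
      intro s' hs' hn
      rcases h with h | ⟨h, h'⟩
      · exact .inl (h.of_reg hs')
      · refine .inr ⟨hc _ _ hs' h, fun y hy => ?_⟩
        rcases Nat.lt_succ_iff_lt_or_eq.1 hy with hy | hy
        · exact h' y hy
        · obtain rfl : y = ⟨j, hj⟩ := Fin.ext hy
          exact hn
    refine ifFrontier_spec (x := ⟨j, hj⟩) he₁ hx (by rw [hm₁, hf₁.reg _ rfl, hs, hT]) ?_ ?_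
    · intro hxT hxR s₂ hf₂
      rw [hm₁, hT] at hxT hxR
      have he₂ : Env n s₂ := he₁.frame hf₂ rfl
      have hm₂ : s₂.mem = s.mem := (hf₂.mem rfl).trans hm₁
      have hx₂ : s₂.reg rX = j := (hf₂.reg _ rfl).trans hx
      refine RunsTo.ifEntry (T := 3) (k := 3) (v := ⟨j, hj⟩) he₂.offW hx₂ (fun a b h => ?_)
        fun a b h => RunsTo.skip (hskip _ (fun r h₁ h₂ => ?_) ?_)
      · rw [hm₂, hW] at h
        refine RunsTo.instr_seq (RunsTo.instr_seq (RunsTo.instr (T := 0) (.inl ⟨?_, ⟨j, hj⟩, ?_, ?_,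
          h, hxT, hxR⟩)))
        · simp [Instr.eval]
        · simp [Instr.eval, hx₂, he₂.zero]
        · simp [Instr.eval, hx₂, he₂.zero]
      · simp only [State.reg_set]
        rw [if_neg (by omega), if_neg (by omega)]
        exact hf₂.found r h₁ h₂
      · rw [hm₂, hW] at h
        exact fun h' => absurd h' h
    · intro hn s₂ hf₂
      rw [hm₁, hT] at hn
      exact hskip _ hf₂.found fun _ h' h'' => hn ⟨h', h''⟩
  · rintro s' (h | ⟨h, h'⟩) -
    · exact .inl h
    · exact .inr ⟨h, fun z => h' z z.2⟩

theorem growStep_spec {W T : Finset (Fin n)} (he : Env n s) (hT : arr n 1 s.mem = T)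
    (hW : arr n 3 s.mem = W) (hs : s.reg rStarted = if T = ∅ then 0 else 1) :
    RunsTo G ω .growStep s (70 * (n + 1) ^ 2) fun s' =>
      (∀ k, k ≠ 1 → arr n k s'.mem = arr n k s.mem) ∧
      ((s'.reg rFound = 0 ∧ s'.reg rStarted = s.reg rStarted ∧ arr n 1 s'.mem = T ∧
        Stuck G W T) ∨
        (s'.reg rFound = 1 ∧ s'.reg rStarted = 1 ∧ GrowStep G W T (arr n 1 s'.mem))) := by
  have hcost : 1 + (22 * (n + 1) + 10) * (n + 1) + (9 * (n + 1) + 16) * (n + 1) + 6 ≤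
    70 * (n + 1) ^ 2 := by nlinarith
  refine RunsTo.mono (T₁ := (22 * (n + 1) + 10) * (n + 1) + ((9 * (n + 1) + 16) * (n + 1) + 6) + 1)
    (RunsTo.instr_seq ((findEdge_spec (he.set (by decide)) hT (by simpa [Instr.eval] using hs)
      (by simp)).seq le_rfl fun s₁ h₁ hf₁ => ?_)) (by omega) fun _ h _ => h
  have he₁ : Env n s₁ := Env.frame (Env.set he (by decide)) hf₁ rfl
  have hm₁ : s₁.mem = s.mem := hf₁.mem rfl
  have hs₁ : s₁.reg rStarted = if T = ∅ then 0 else 1 :=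
    (hf₁.reg _ rfl).trans (by simpa [Instr.eval] using hs)
  refine (findVertex_spec (G := G) (ω := ω) he₁ (hm₁ ▸ hT) (hm₁ ▸ hW) hs₁ rfl rfl rfl).seq
    le_rfl fun s₂ h₂ hf₂ => ?_
  have he₂ : Env n s₂ := he₁.frame hf₂ rfl
  have hm₂ : s₂.mem = s.mem := (hf₂.mem rfl).trans hm₁
  have key : (s₂.reg rFound = 0 ∧ Stuck G W T) ∨ (s₂.reg rFound = 1 ∧ ∃ x y : Fin n,
      s₂.reg rFst = x ∧ s₂.reg rSnd = y ∧ GrowStep G W T (insert y (insert x T))) := by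
    rcases h₂ with ⟨h, x, hx, hy, hxW, hxT, hxR⟩ | ⟨⟨h, hx, hy⟩, hn⟩
    · exact .inr ⟨h, x, x, hx, hy, by simpa using GrowStep.take x hxW hxT hxR⟩
    · rcases h₁ with ⟨h', x, y, hx', hy', hxT, hxR, hyT, hxy⟩ | ⟨h', hn'⟩
      · exact .inr ⟨h.trans h', x, y, hx.trans hx', hy.trans hy', .edge x y hn hxT hxR hyT hxy⟩
      · exact .inl ⟨h.trans h', hn, hn'⟩
  refine RunsTo.ite (T := 5) (fun hne => ?_) fun h0 => RunsTo.skip ?_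
  · rcases key with ⟨h, -⟩ | ⟨h, x, y, hx, hy, hg⟩
    · exact absurd h hne
    refine RunsTo.setEntry_seq (k := 1) (j := x) (c := 1) (by simp [he₂.size]) hx he₂.one
      (by decide) fun a => RunsTo.setEntry_seq (k := 1) (j := y) (c := 1) (by simp [he₂.size])
      (by simp [hy]) (by simp [he₂.one]) (by decide) fun b => RunsTo.instr (T := 0) ⟨fun k hk => ?_,
      .inr ⟨by simp [Instr.eval, h], by simp [Instr.eval], ?_⟩⟩
    · simp only [Instr.eval, State.mem_set]
      rw [arr_update_of_ne y.2 hk, arr_update_of_ne x.2 hk, hm₂]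
    · convert hg using 1
      ext v
      simp only [Instr.eval, State.mem_set, arr_update_self, hm₂, hT, Finset.mem_insert,
        ← Fin.ext_iff]
      by_cases h1 : v = y <;> by_cases h2 : v = x <;> simp [h1, h2]
  · rcases key with ⟨h, hst⟩ | ⟨h, -⟩
    · refine ⟨fun k _ => by rw [hm₂], .inl ⟨h, ?_, by rw [hm₂, hT], hst⟩⟩
      rw [hf₂.reg _ rfl, hs₁, hs]
    · rw [h0] at h
      exact absurd h (by decide)

theorem grow_spec {W : Finset (Fin n)} (he : Env n s) (hT : arr n 1 s.mem = ∅)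
    (hW : arr n 3 s.mem = W) :
    RunsTo G ω .grow s ((n + 2) * (70 * (n + 1) ^ 2 + 1) + 3) fun s' =>
      (∀ k, k ≠ 1 → arr n k s'.mem = arr n k s.mem) ∧ Grown G W (arr n 1 s'.mem) := by
  refine RunsTo.instr_seq (RunsTo.instr_seq (RunsTo.loop (I := fun m s' =>
    (∀ k, k ≠ 1 → arr n k s'.mem = arr n k s.mem) ∧
    Relation.ReflTransGen (GrowStep G W) ∅ (arr n 1 s'.mem) ∧
    s'.reg rStarted = (if arr n 1 s'.mem = ∅ then 0 else 1) ∧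
    ((s'.reg rFound = 0 ∧ Stuck G W (arr n 1 s'.mem)) ∨
      (s'.reg rFound = 1 ∧ n + 2 ≤ m + (arr n 1 s'.mem).card))) (n + 2) ?_ ?_ ?_))
  · simp [Instr.eval, hT]
    exact Relation.ReflTransGen.refl
  · rintro m s₁ ⟨hA, hG, hs, h⟩ hf hne
    have h : n + 2 ≤ m + (arr n 1 s₁.mem).card := by
      rcases h with h | h
      · exact absurd h.1 hne
      · exact h.2
    have hcard : (arr n 1 s₁.mem).card ≤ n := by simpa using Finset.card_le_univ (arr n 1 s₁.mem)
    have he₁ : Env n s₁ := ((he.set (by decide)).set (by decide)).frame hf rfl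
    refine ⟨m - 1, by omega, (growStep_spec he₁ rfl ((hA 3 (by decide)).trans hW) hs).mono le_rfl ?_⟩
    rintro s₂ ⟨hA₂, h₂⟩ hf₂
    refine ⟨fun k hk => (hA₂ k hk).trans (hA k hk), ?_⟩
    rcases h₂ with ⟨h₂, hs₂, hT₂, hst⟩ | ⟨h₂, hs₂, hg⟩
    · rw [hT₂]
      exact ⟨hG, hs₂.trans hs, .inl ⟨h₂, hst⟩⟩
    · refine ⟨hG.tail hg, by rw [hs₂, if_neg hg.nonempty], .inr ⟨h₂, ?_⟩⟩
      have := hg.card_lt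
      omega
  · rintro m s₁ ⟨hA, hG, hs, h⟩ hf h0
    rcases h with h | h
    · exact ⟨hA, hG, h.2⟩
    · rw [h0] at h
      exact absurd h.1 (by decide)

/-! ### The algorithm -/

open Classical in
/-- The set of the neighbours of a vertex. -/
noncomputable def nbrs {n : ℕ} (G : SimpleGraph (Fin n)) (x : Fin n) : Finset (Fin n) :=
  Finset.univ.filter fun y => G.Adj x y

/-- The vertices with at least `Δ / q` neighbours outside of `W`. -/
noncomputable def highSet {n : ℕ} (G : SimpleGraph (Fin n)) (q : ℕ) (W : Finset (Fin n)) :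
    Finset (Fin n) :=
  Finset.univ.filter fun x => maxDeg G ≤ q * (nbrs G x \ W).card

namespace Prog

/-- Remove from `H` the vertices that have fewer than `Δ / q` neighbours outside of `W`. -/
def markHigh : Prog :=
  forEach rX (.const rCount 0 ;;
    forEach rY (ifEntry rOffW rY .skip (ifAdj rX rY (.add rCount rCount rScale) .skip)) ;;
    .sub rTmp rDeg rCount ;; .ite rTmp (setEntry rOffH rX rZero) .skip)

/-- Replace the best solution by `T`, if `T` is smaller. -/
def update : Prog :=
  .const rCount 0 ;; forEach rX (ifEntry rSize rX (.add rCount rCount rOne) .skip) ;;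
    .sub rTmp rBest rCount ;; .ite rTmp (.add rBest rCount rZero ;;
      forEach rX (ifEntry rSize rX (setEntry rZero rX rOne) (setEntry rZero rX rZero))) .skip

/-- Guess a set `W`, grow a connected vertex cover that prefers `W`, and keep it if it is the best
one so far. -/
def trial : Prog :=
  .flip rFlag ;; reset ;; rounds ;; markHigh ;; rounds ;; grow ;; update

/-- Compute the maximum degree. -/
def findDeg : Prog :=
  forEach rX (.const rCount 0 ;; forEach rY (ifAdj rX rY (.add rCount rCount rOne) .skip) ;;
    .sub rTmp rCount rDeg ;; .add rDeg rDeg rTmp)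

/-- Compute the parameters; the first solution is the set of all vertices. -/
def setup (q K : ℕ) : Prog :=
  .const rOne 1 ;; .size rSize ;; .add rOffH rSize rSize ;; .add rOffW rOffH rSize ;;
    forEach rX (setEntry rZero rX rOne) ;; findDeg ;; .add rBest rSize rZero ;;
    .const rScale q ;; rep (q ^ 3) (.add rWork rWork rSize) ;; .add rTrials rSize rZero ;;
    .add rRem rWork rZero ;; countdown rRem rDeg (rep K (.add rTrials rTrials rTrials))

/-- The whole algorithm. -/
def main (q K : ℕ) : Prog :=
  setup q K ;; countdown rTrials rOne trial

end Prog

theorem mem_nbrs {x y : Fin n} : y ∈ nbrs G x ↔ G.Adj x y := by simp [nbrs]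

theorem markHigh_spec {q : ℕ} (he : Ready G q s) :
    RunsTo G ω .markHigh s ((11 * (n + 1) + 9) * (n + 1)) fun s' =>
      arr n 2 s'.mem = arr n 2 s.mem ∩ highSet G q (arr n 3 s.mem) ∧
      ∀ k, k ≠ 2 → arr n k s'.mem = arr n k s.mem := by
  classical
  set W := arr n 3 s.mem with hW
  refine (RunsTo.forEach (T := 11 * (n + 1) + 5) (I := fun j s' =>
    (∀ u : Fin n, u ∈ arr n 2 s'.mem ↔ u ∈ arr n 2 s.mem ∧ ((u : ℕ) < j → u ∈ highSet G q W)) ∧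
    ∀ k, k ≠ 2 → arr n k s'.mem = arr n k s.mem) he.toEnv (by decide) rfl rfl ?_ ?_ ?_).mono
    (Nat.mul_le_mul_right _ (by omega)) ?_
  · intro j s' r w _ h
    exact h
  · simp
  · rintro j hj s₁ ⟨h2, hA⟩ hx hf he₁
    have hdeg : s₁.reg rDeg = maxDeg G := (hf.reg _ rfl).trans he.deg
    have hscale : s₁.reg rScale = q := (hf.reg _ rfl).trans he.scale
    refine RunsTo.instr_seq ((RunsTo.count (T := 7) (w := q) (c := 0)
      (P := fun y => y ∉ W ∧ G.Adj ⟨j, hj⟩ y) (he₁.set (by decide)) (by decide) rfl rfl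
      (by simp) ?_).seq (T₂ := 4) (by omega) fun s₂ h₂ hf₂ => ?_)
    · intro y s' hy hf' he'
      have hx' : s'.reg rX = j := (hf'.reg _ rfl).trans (by simp [hx])
      have hq' : s'.reg rScale = q := (hf'.reg _ rfl).trans (by simp [hscale])
      have hm : s'.mem = s₁.mem := hf'.mem rfl
      refine RunsTo.ifEntry (T := 4) (k := 3) (v := y) he'.offW hy (fun a b h => ?_)
        fun a b h => RunsTo.ifAdj (T := 2) (a := j) (b := y) (by simp [hx']) (by simp [hy])
          (fun c hc => ?_) fun c hc => ?_
      · rw [hm, hA 3 (by decide)] at h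
        exact RunsTo.skip (by simp [hW, h])
      · rw [hm, hA 3 (by decide)] at h
        have : G.Adj ⟨j, hj⟩ y := adjEntry_ne_zero.1 hc
        exact RunsTo.instr (by simp [Instr.eval, hW, h, this, hq'])
      · have : ¬ G.Adj ⟨j, hj⟩ y := fun h' =>
          adjEntry_ne_zero.2 h' hc
        exact RunsTo.skip (by simp [this])
    · have he₂ : Env n s₂ := Env.frame (he₁.set (by decide)) hf₂ rfl
      have hm₂ : s₂.mem = s₁.mem := hf₂.mem rfl
      have hx₂ : s₂.reg rX = j := (hf₂.reg _ rfl).trans (by simp [hx])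
      have hdeg₂ : s₂.reg rDeg = maxDeg G := (hf₂.reg _ rfl).trans (by simp [hdeg])
      have hcard : (Finset.univ.filter fun y => y ∉ W ∧ G.Adj ⟨j, hj⟩ y) =
          nbrs G ⟨j, hj⟩ \ W := by
        ext y
        simp [mem_nbrs, and_comm]
      rw [hcard, zero_add] at h₂
      have hlt : ∀ u : Fin n, (u : ℕ) < j + 1 ↔ (u : ℕ) < j ∨ u = ⟨j, hj⟩ := fun u => by
        rw [Fin.ext_iff]; exact Nat.lt_succ_iff_lt_or_eq
      have hhigh : (⟨j, hj⟩ : Fin n) ∈ highSet G q W ↔ maxDeg G ≤ s₂.reg rCount := by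
        simp [highSet, h₂]
      refine RunsTo.instr_seq (RunsTo.ite (T := 2) (fun hne => ?_) fun h0 => ?_)
      · refine RunsTo.setEntry (T := 0) (k := 2) (j := j) (c := 0) (by simp [Instr.eval, he₂.offH])
          (by simp [Instr.eval, hx₂]) (by simp [Instr.eval, he₂.zero]) (by decide)
          fun a => ⟨fun u => ?_, fun k hk => ?_⟩
        · simp only [Instr.eval, State.mem_set, arr_update_self, hlt, hm₂, h2]
          by_cases hu : u = ⟨j, hj⟩
          · subst hu
            simp only [Instr.eval, State.reg_set, if_true, hdeg₂] at hne
            have : ¬ (⟨j, hj⟩ : Fin n) ∈ highSet G q W := by rw [hhigh]; omega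
            simp [this]
          · have : (u : ℕ) ≠ j := fun h => hu (Fin.ext h)
            simp [hu, this]
        · simp only [Instr.eval, State.mem_set]
          rw [arr_update_of_ne hj hk, hm₂, hA k hk]
      · refine RunsTo.skip ⟨fun u => ?_, fun k hk => ?_⟩
        · simp only [Instr.eval, State.mem_set, hlt, hm₂, h2]
          by_cases hu : u = ⟨j, hj⟩
          · subst hu
            simp only [Instr.eval, State.reg_set, if_true, hdeg₂] at h0
            have : (⟨j, hj⟩ : Fin n) ∈ highSet G q W := by rw [hhigh]; omega
            simp [this]
          · simp [hu]
        · simp only [Instr.eval, State.mem_set]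
          rw [hm₂, hA k hk]
  · rintro s' ⟨h2, hA⟩ -
    refine ⟨?_, hA⟩
    ext u
    simp [h2]

/-- What happens to the best solution when it is compared with `T`. -/
def Improved (n : ℕ) (s s' : State) (T : Finset (Fin n)) : Prop :=
  (arr n 0 s'.mem = arr n 0 s.mem ∧ s'.reg rBest = s.reg rBest ∧ s.reg rBest ≤ T.card) ∨
    (arr n 0 s'.mem = T ∧ s'.reg rBest = T.card ∧ T.card ≤ s.reg rBest)

theorem update_spec (he : Env n s) :
    RunsTo G ω .update s (22 * (n + 1)) fun s' => Improved n s s' (arr n 1 s.mem) := by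
  set T := arr n 1 s.mem with hT
  refine RunsTo.mono (T₁ := (4 + 4) * (n + 1) + ((5 + 4) * (n + 1) + 3) + 1)
    (RunsTo.instr_seq ((RunsTo.count (T := 4) (w := 1) (c := 0)
    (P := fun y => y ∈ T) (he.set (by decide)) (by decide) rfl rfl (by simp) ?_).seq
      le_rfl fun s₁ h₁ hf₁ => ?_)) (by omega) fun _ h _ => h
  · intro y s' hy hf' he'
    have hm : s'.mem = s.mem := hf'.mem rfl
    refine RunsTo.ifEntry (T := 1) (k := 1) (v := y) (by simp [he'.size]) hy (fun a b h => ?_)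
      fun a b h => ?_
    · rw [hm] at h
      exact RunsTo.instr (by simp [Instr.eval, he'.one, hT, h])
    · rw [hm] at h
      exact RunsTo.skip (by simp [hT, h])
  · have he₁ : Env n s₁ := Env.frame (he.set (by decide)) hf₁ rfl
    have hm₁ : s₁.mem = s.mem := hf₁.mem rfl
    have hb₁ : s₁.reg rBest = s.reg rBest := (hf₁.reg _ rfl).trans (by simp)
    have hc₁ : s₁.reg rCount = T.card := by simpa using h₁
    refine RunsTo.instr_seq (RunsTo.ite (fun hne => ?_) fun h0 => ?_)
    · refine RunsTo.instr_seq ((RunsTo.forEach (T := 5) (I := fun j s' =>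
        (∀ u : Fin n, (u : ℕ) < j → (u ∈ arr n 0 s'.mem ↔ u ∈ T)) ∧ arr n 1 s'.mem = T ∧
        s'.reg rBest = T.card) ((he₁.set (by decide)).set (by decide)) ⟨by decide, by decide⟩
        rfl rfl ?_ ?_ ?_).mono le_rfl ?_)
      · rintro j s' r w hr ⟨h, h', h''⟩
        have : ¬ 22 = r := by rcases hr with rfl | rfl <;> decide
        exact ⟨h, h', by simpa [this] using h''⟩
      · simp [Instr.eval, hc₁, he₁.zero, hm₁, hT]
      · rintro j hj s' ⟨h, h', h''⟩ hx hf he'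
        have hlt : ∀ u : Fin n, (u : ℕ) < j + 1 → u = ⟨j, hj⟩ ∨ ((u : ℕ) < j ∧ (u : ℕ) ≠ j) :=
          fun u hu => by
            rw [Fin.ext_iff]
            change (u : ℕ) = j ∨ _
            omega
        refine RunsTo.ifEntry (T := 2) (k := 1) (v := ⟨j, hj⟩) (by simp [he'.size]) hx
          (fun a b hjT => RunsTo.setEntry (T := 0) (k := 0) (j := j) (c := 1)
            (by simp [he'.zero]) (by simp [hx]) (by simp [he'.one]) (by decide) fun a' =>
              ⟨fun u hu => ?_, ?_, by simpa using h''⟩)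
          fun a b hjT => RunsTo.setEntry (T := 0) (k := 0) (j := j) (c := 0)
            (by simp [he'.zero]) (by simp [hx]) (by simp [he'.zero]) (by decide) fun a' =>
              ⟨fun u hu => ?_, ?_, by simpa using h''⟩
        · rw [h'] at hjT
          simp only [State.mem_set, arr_update_self]
          obtain rfl | ⟨hu, hu'⟩ := hlt u hu
          · simp [hjT]
          · simp [hu', h u hu]
        · simp only [State.mem_set]
          rw [arr_update_of_ne hj (by decide), h']
        · rw [h'] at hjT
          simp only [State.mem_set, arr_update_self]
          obtain rfl | ⟨hu, hu'⟩ := hlt u hu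
          · simp [hjT]
          · simp [hu', h u hu]
        · simp only [State.mem_set]
          rw [arr_update_of_ne hj (by decide), h']
      · rintro s' ⟨h, -, h'⟩ -
        simp only [Instr.eval, State.reg_set, if_true, hb₁, hc₁] at hne
        refine .inr ⟨?_, h', by omega⟩
        ext u
        exact h u u.2
    · simp only [Instr.eval, State.reg_set, if_true, hb₁, hc₁] at h0
      exact RunsTo.skip (.inl ⟨by simp [Instr.eval, hm₁], by simp [Instr.eval, hb₁], by omega⟩)

/-- The random set from which the first random stars are added in a trial. -/
def trialStart (n : ℕ) (ω : ℕ → Bool) (k : ℕ) : Finset (Fin n) :=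
  Finset.univ.filter fun u : Fin n => (ω (k + 1 + u)).toNat - (ω k).toNat ≠ 0

/-- The set `W` after the first phase of the trial that begins with the `k`-th coin toss. -/
noncomputable def trialMid (G : SimpleGraph (Fin n)) (q : ℕ) (ω : ℕ → Bool) (k : ℕ) :
    Finset (Fin n) :=
  addStars G Finset.univ ω (k + 1 + n) (numRounds G q) (trialStart n ω k)

/-- The set `W` that is guessed in the trial that begins with the `k`-th coin toss. -/
noncomputable def trialSet (G : SimpleGraph (Fin n)) (q : ℕ) (ω : ℕ → Bool) (k : ℕ) :
    Finset (Fin n) :=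
  addStars G (highSet G q (trialMid G q ω k)) ω (k + 1 + n + numRounds G q * drawLen n)
    (numRounds G q) (trialMid G q ω k)

/-- The number of coin tosses in a trial. -/
noncomputable def trialLen (G : SimpleGraph (Fin n)) (q : ℕ) : ℕ :=
  1 + n + numRounds G q * drawLen n + numRounds G q * drawLen n

theorem numRounds_le (G : SimpleGraph (Fin n)) (q : ℕ) (hΔ : 0 < maxDeg G) :
    numRounds G q ≤ q ^ 3 * n := by
  rw [numRounds, ceilDiv_le_iff_le_mul hΔ]
  exact Nat.le_mul_of_pos_left _ hΔ

theorem trial_spec {q k : ℕ} (he : Ready G q s) (hΔ : 0 < maxDeg G) (hk : s.tossed = k) :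
    RunsTo G ω .trial s (300 * (q ^ 3 + 1) * (n + 1) ^ 3) fun s' =>
      Ready G q s' ∧ s'.tossed = k + trialLen G q ∧
      ∃ T, Grown G (trialSet G q ω k) T ∧ Improved n s s' T := by
  set R := numRounds G q with hR
  have hcost : 12 * (n + 1) + (R * (24 * (n + 1) + 2) + 2 + ((11 * (n + 1) + 9) * (n + 1) +
      (R * (24 * (n + 1) + 2) + 2 + ((n + 2) * (70 * (n + 1) ^ 2 + 1) + 3 + 22 * (n + 1)))))
      + 1 ≤ 300 * (q ^ 3 + 1) * (n + 1) ^ 3 := by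
    have hR' : R * (24 * (n + 1) + 2) ≤ (q ^ 3 * n) * (26 * (n + 1)) :=
      Nat.mul_le_mul (numRounds_le G q hΔ) (by omega)
    have h1 : q ^ 3 * n * (26 * (n + 1)) ≤ 26 * q ^ 3 * (n + 1) ^ 3 := by
      have : n * (n + 1) ≤ (n + 1) ^ 3 := by nlinarith [Nat.zero_le (n ^ 3), Nat.zero_le (n ^ 2)]
      nlinarith [Nat.mul_le_mul_left (26 * q ^ 3) this]
    have h2 : 12 * (n + 1) + (2 + ((11 * (n + 1) + 9) * (n + 1) + (2 +
        ((n + 2) * (70 * (n + 1) ^ 2 + 1) + 3 + 22 * (n + 1))))) + 1 ≤ 240 * (n + 1) ^ 3 := by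
      nlinarith [Nat.zero_le (n ^ 3), Nat.zero_le (n ^ 2)]
    nlinarith [Nat.zero_le (q ^ 3 * (n + 1) ^ 3)]
  have hf₀ : Frame (.flip rFlag) s (Instr.eval G ω s (.flip rFlag)) :=
    (Exec.instr (G := G) (ω := ω) (.flip rFlag) s).frame
  refine RunsTo.mono (RunsTo.instr_seq ((reset_spec (z := (ω k).toNat) (k := k + 1)
    (he.toEnv.frame hf₀ rfl) ?_ ?_).seq le_rfl fun s₁ h₁ hf₁ => ?_)) hcost fun _ h _ => h
  · simp [Instr.eval, hk]
  · simp [Instr.eval, hk]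
  obtain ⟨ht₁, h01, h11, h21, h31⟩ := h₁
  have he₁ : Ready G q s₁ := (he.frame hf₀ rfl).frame hf₁ rfl
  have hb₁ : s₁.reg rBest = s.reg rBest := (hf₁.reg _ rfl).trans (hf₀.reg _ rfl)
  refine (rounds_spec he₁ hΔ ht₁).seq le_rfl fun s₂ h₂ hf₂ => ?_
  obtain ⟨ht₂, h32, hA₂⟩ := h₂
  have he₂ := he₁.frame hf₂ rfl
  have h3mid : arr n 3 s₂.mem = trialMid G q ω k := by
    rw [h32, h21, h31]
    rfl
  refine (markHigh_spec he₂).seq le_rfl fun s₃ h₃ hf₃ => ?_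
  obtain ⟨h23, hA₃⟩ := h₃
  have he₃ := he₂.frame hf₃ rfl
  have ht₃ : s₃.tossed = k + 1 + n + R * drawLen n := (hf₃.tossed rfl).trans ht₂
  refine (rounds_spec he₃ hΔ ht₃).seq le_rfl fun s₄ h₄ hf₄ => ?_
  obtain ⟨ht₄, h34, hA₄⟩ := h₄
  have he₄ := he₃.frame hf₄ rfl
  have h3set : arr n 3 s₄.mem = trialSet G q ω k := by
    rw [h34, hA₃ 3 (by decide), h23, hA₂ 2 (by decide), h21, h3mid, Finset.univ_inter]
    rfl
  have h1 : arr n 1 s₄.mem = ∅ := by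
    rw [hA₄ 1 (by decide), hA₃ 1 (by decide), hA₂ 1 (by decide), h11]
  have h0 : arr n 0 s₄.mem = arr n 0 s.mem := by
    rw [hA₄ 0 (by decide), hA₃ 0 (by decide), hA₂ 0 (by decide), h01]
    rfl
  refine (grow_spec he₄.toEnv h1 h3set).seq le_rfl fun s₅ h₅ hf₅ => ?_
  obtain ⟨hA₅, hG⟩ := h₅
  have he₅ := he₄.frame hf₅ rfl
  refine (update_spec he₅.toEnv).mono le_rfl fun s₆ h₆ hf₆ => ?_
  have hb : s₅.reg rBest = s.reg rBest := by
    rw [hf₅.reg _ rfl, hf₄.reg _ rfl, hf₃.reg _ rfl, hf₂.reg _ rfl, hb₁]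
  refine ⟨he₅.frame hf₆ rfl, ?_, _, hG, ?_⟩
  · rw [hf₆.tossed rfl, hf₅.tossed rfl, ht₄, trialLen]
    ring
  · rw [Improved, hb, hA₅ 0 (by decide), h0] at h₆
    exact h₆

theorem degree_eq_card_nbrs [DecidableRel G.Adj] (x : Fin n) : G.degree x = (nbrs G x).card := by
  rw [← SimpleGraph.card_neighborFinset_eq_degree]
  congr 1
  ext y
  simp [mem_nbrs]

theorem card_nbrs_le (G : SimpleGraph (Fin n)) (x : Fin n) : (nbrs G x).card ≤ maxDeg G := by
  classical
  rw [← degree_eq_card_nbrs, maxDeg]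
  convert G.degree_le_maxDegree x

theorem maxDeg_le_of_forall {d : ℕ} (h : ∀ x, (nbrs G x).card ≤ d) : maxDeg G ≤ d := by
  classical
  rw [maxDeg]
  refine SimpleGraph.maxDegree_le_of_forall_degree_le _ _ fun v => ?_
  rw [degree_eq_card_nbrs]
  exact h v

theorem findDeg_spec (he : Env n s) (h0 : s.reg rDeg = 0) :
    RunsTo G ω .findDeg s ((8 * (n + 1) + 7) * (n + 1)) fun s' => s'.reg rDeg = maxDeg G := by
  classical
  refine (RunsTo.forEach (i := rX) (T := 8 * (n + 1) + 3) (I := fun j s' =>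
    s'.reg rDeg ≤ maxDeg G ∧ ∀ x : Fin n, (x : ℕ) < j → (nbrs G x).card ≤ s'.reg rDeg)
    he ⟨by decide, by decide⟩ rfl rfl ?_ ?_ ?_).mono (Nat.mul_le_mul_right _ (by omega)) ?_
  · rintro j s' r w hr h
    have : ¬ 5 = r := by rcases hr with rfl | rfl <;> decide
    simpa [this] using h
  · simp [h0]
  · rintro j hj s₁ ⟨h, h'⟩ hx hf he₁
    refine RunsTo.instr_seq ((RunsTo.count (T := 4) (w := 1) (c := 0)
      (P := fun y => G.Adj ⟨j, hj⟩ y) (he₁.set (by decide)) (by decide) rfl rfl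
      (by simp) ?_).seq (T₂ := 2) (by omega) fun s₂ h₂ hf₂ => ?_)
    · intro y s' hy hf' he'
      have hx' : s'.reg rX = j := (hf'.reg _ rfl).trans (by simp [hx])
      refine RunsTo.ifAdj (T := 2) (a := j) (b := y) hx' hy (fun c hc => ?_) fun c hc => ?_
      · have : G.Adj ⟨j, hj⟩ y := adjEntry_ne_zero.1 hc
        exact RunsTo.instr (by simp [Instr.eval, this, he'.one])
      · have : ¬ G.Adj ⟨j, hj⟩ y := fun h' => adjEntry_ne_zero.2 h' hc
        exact RunsTo.skip (by simp [this])
    · have h₂ : s₂.reg rCount = (nbrs G ⟨j, hj⟩).card := by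
        rw [h₂, nbrs, zero_add, one_mul]
      have hd₂ : s₂.reg rDeg = s₁.reg rDeg := (hf₂.reg _ rfl).trans (by simp)
      have hle := card_nbrs_le G ⟨j, hj⟩
      refine RunsTo.instr_seq (RunsTo.instr (T := 0) ⟨?_, fun x hx => ?_⟩)
      · simp [Instr.eval, h₂, hd₂]
        omega
      · simp only [Instr.eval, State.reg_set, if_true, h₂, hd₂]
        rcases Nat.lt_succ_iff_lt_or_eq.1 hx with hx | hx
        · have := h' x hx
          simp
          omega
        · obtain rfl : x = ⟨j, hj⟩ := Fin.ext hx
          simp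
          omega
  · rintro s' ⟨h, h'⟩ -
    exact le_antisymm h (maxDeg_le_of_forall fun x => h' x x.2)

theorem setup_spec (q K : ℕ) (hΔ : 0 < maxDeg G) :
    RunsTo G ω (.setup q K) State.init ((2 * K + 80) * (q ^ 3 + 1) * (n + 1) ^ 2) fun s' =>
      Ready G q s' ∧ s'.tossed = 0 ∧ arr n 0 s'.mem = Finset.univ ∧ s'.reg rBest = n ∧
      s'.reg rTrials = n * 2 ^ (K * numRounds G q) := by
  set R := numRounds G q with hR
  have hcost : (6 * (n + 1) + ((8 * (n + 1) + 7) * (n + 1) +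
      ((q ^ 3 * 1 + 1) + (R * ((K * 1 + 1) + 2) + 1 + 1 + 1) + 1 + 1))) + 1 + 1 + 1 + 1 ≤
      (2 * K + 80) * (q ^ 3 + 1) * (n + 1) ^ 2 := by
    have hR' : R * (K + 3) ≤ (q ^ 3 * n) * (K + 3) := Nat.mul_le_mul_right _ (numRounds_le G q hΔ)
    have hN : n ≤ (n + 1) ^ 2 := by nlinarith
    have h1 : q ^ 3 * n * (K + 3) ≤ (K + 3) * q ^ 3 * (n + 1) ^ 2 := by
      nlinarith [Nat.mul_le_mul_left ((K + 3) * q ^ 3) hN]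
    have h2 : q ^ 3 ≤ q ^ 3 * (n + 1) ^ 2 := Nat.le_mul_of_pos_right _ (by positivity)
    have h3 : 13 * (n + 1) + 8 * (n + 1) ^ 2 + 12 ≤ 33 * (n + 1) ^ 2 := by nlinarith
    calc _ = 13 * (n + 1) + 8 * (n + 1) ^ 2 + q ^ 3 + R * (K + 3) + 10 := by ring
      _ ≤ 33 * (n + 1) ^ 2 + q ^ 3 * (n + 1) ^ 2 + (K + 3) * q ^ 3 * (n + 1) ^ 2 := by omega
      _ ≤ 33 * (n + 1) ^ 2 + q ^ 3 * (n + 1) ^ 2 + (K + 3) * q ^ 3 * (n + 1) ^ 2 +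
          (K * q ^ 3 + 76 * q ^ 3 + 2 * K + 47) * (n + 1) ^ 2 := Nat.le_add_right _ _
      _ = _ := by ring
  have he₀ : Env n (((((State.init.set rOne 1).set rSize n).set rOffH (n + n)).set rOffW (n + n + n))) :=
    ⟨by simp [State.init], by simp, by simp, by simp; ring, by simp; ring⟩
  refine RunsTo.mono (RunsTo.instr_seq (RunsTo.instr_seq (RunsTo.instr_seq (RunsTo.instr_seq
    ((RunsTo.forEach (i := rX) (T := 2) (I := fun j s' => ∀ u : Fin n, (u : ℕ) < j →
      u ∈ arr n 0 s'.mem) ?_ ⟨by decide, by decide⟩ rfl rfl ?_ ?_ ?_).seq le_rfl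
      fun s₁ h₁ hf₁ => ?_))))) hcost fun _ h _ => h
  · simpa [Instr.eval] using he₀
  · intro j s' r w _ h
    exact h
  · simp
  · intro j hj s' h hx hf he
    refine RunsTo.setEntry (T := 0) (k := 0) (j := j) (c := 1) (by simp [he.zero]) hx he.one
      (by decide) fun a u hu => ?_
    simp only [arr_update_self]
    split_ifs with h'
    · simp
    · exact h u (by omega)
  have he₁ : Env n s₁ := Env.frame (by simpa [Instr.eval] using he₀) hf₁ rfl
  have h15 : s₁.reg rDeg = 0 := (hf₁.reg _ rfl).trans (by simp [Instr.eval, State.init])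
  have h17 : s₁.reg rWork = 0 := (hf₁.reg _ rfl).trans (by simp [Instr.eval, State.init])
  have ht₁ : s₁.tossed = 0 := (hf₁.tossed rfl).trans (by simp [Instr.eval, State.init])
  refine (findDeg_spec he₁ h15).seq le_rfl fun s₂ h₂ hf₂ => ?_
  have he₂ := he₁.frame hf₂ rfl
  have h27 : s₂.reg rWork = 0 := (hf₂.reg _ rfl).trans h17
  refine RunsTo.instr_seq (RunsTo.instr_seq ((RunsTo.rep (I := fun j s' => s'.mem = s₁.mem ∧
    s'.tossed = 0 ∧ Env n s' ∧ s'.reg rDeg = maxDeg G ∧ s'.reg rScale = q ∧ s'.reg rWork = j * n ∧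
    s'.reg rBest = n) (q ^ 3) ?_ ?_).seq le_rfl fun s₃ h₃ _ => ?_))
  · refine ⟨hf₂.mem rfl, (hf₂.tossed rfl).trans ht₁, (he₂.set (by decide)).set (by decide), ?_⟩
    simp [Instr.eval, h₂, h27, he₂.size, he₂.zero]
  · rintro j s' ⟨hm, ht, he, h5, h6, h7, h22⟩
    refine RunsTo.instr (T := 0) ⟨hm, ht, he.set (by decide), ?_⟩
    simp [Instr.eval, h5, h6, h7, h22, he.size]
    ring
  obtain ⟨hm, ht, he, h5, h6, h7, h22⟩ := h₃
  refine RunsTo.instr_seq (RunsTo.instr_seq ((RunsTo.countdown (M := q ^ 3 * n) (D := maxDeg G)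
    (I := fun j s' => s'.mem = s₁.mem ∧ s'.tossed = 0 ∧ Ready G q s' ∧ s'.reg rBest = n ∧
      s'.reg rTrials = n * 2 ^ (K * j)) ?_ ?_ hΔ (by decide) ?_ ?_ ?_ ?_ ?_).mono le_rfl ?_))
  · simp [Instr.eval, h7, he.zero]
  · simp [Instr.eval, h5]
  · clear * -
    induction K with
    | zero => rfl
    | succ K ih => simpa [Prog.rep, Prog.writes, Instr.writes] using ih
  · clear * -
    induction K with
    | zero => rfl
    | succ K ih => simpa [Prog.rep, Prog.writes, Instr.writes] using ih
  · rintro j s' v ⟨hm, ht, he, h22, h23⟩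
    exact ⟨hm, ht, ⟨he.toEnv.set (by decide), by simp [he.deg], by simp [he.scale],
      by simp [he.work]⟩, by simp [h22], by simp [h23]⟩
  · exact ⟨hm, ht, ⟨(he.set (by decide)).set (by decide), by simp [Instr.eval, h5],
      by simp [Instr.eval, h6], by simp [Instr.eval, h7]⟩, by simp [Instr.eval, h22],
      by simp [Instr.eval, he.size, he.zero]⟩
  · rintro j hj s' ⟨hm, ht, he, h22, h23⟩ hf
    refine (RunsTo.rep (I := fun i s' => s'.mem = s₁.mem ∧ s'.tossed = 0 ∧ Ready G q s' ∧
      s'.reg rBest = n ∧ s'.reg rTrials = n * 2 ^ (K * j + i)) K ⟨hm, ht, he, h22, h23⟩ ?_).mono le_rfl ?_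
    · rintro i s' ⟨hm, ht, he, h22, h23⟩
      refine RunsTo.instr (T := 0) ⟨hm, ht, ⟨he.toEnv.set (by decide), by simp [Instr.eval, he.deg],
        by simp [Instr.eval, he.scale], by simp [Instr.eval, he.work]⟩,
        by simp [Instr.eval, h22], ?_⟩
      simp [Instr.eval, h23, ← Nat.add_assoc, pow_succ]
      ring
    · exact fun s' h _ => by simpa [Nat.mul_succ] using h
  · rintro s' ⟨hm, ht, he, h22, h23⟩ -
    refine ⟨he, ht, ?_, h22, h23⟩
    ext u
    simp [hm, h₁ u u.2]

/-- The number of trials. -/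
noncomputable def numTrials (G : SimpleGraph (Fin n)) (q K : ℕ) : ℕ := n * 2 ^ (K * numRounds G q)

theorem main_spec (q K : ℕ) (hΔ : 0 < maxDeg G) :
    RunsTo G ω (.main q K) State.init
      ((2 * K + 383) * (q ^ 3 + 1) * (n + 1) ^ 4 * 2 ^ (K * numRounds G q)) fun s' =>
      let B := s'.output n
      (B = Finset.univ ∨ ∃ W, Grown G W B) ∧ B.card ≤ n ∧
      ∀ j < numTrials G q K, ∃ T, Grown G (trialSet G q ω (j * trialLen G q)) T ∧
        B.card ≤ T.card := by
  have hcost : (2 * K + 80) * (q ^ 3 + 1) * (n + 1) ^ 2 +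
      (numTrials G q K * (300 * (q ^ 3 + 1) * (n + 1) ^ 3 + 2) + 1) ≤
      (2 * K + 383) * (q ^ 3 + 1) * (n + 1) ^ 4 * 2 ^ (K * numRounds G q) := by
    rw [numTrials]
    set P := 2 ^ (K * numRounds G q) with hP
    have hP1 : 1 ≤ P := Nat.one_le_two_pow
    set Q := q ^ 3 + 1 with hQ
    have hQ1 : 1 ≤ Q := by omega
    set N := n + 1 with hN
    have hN1 : 1 ≤ N := by omega
    have a1 : (2 * K + 80) * Q * N ^ 2 ≤ (2 * K + 80) * Q * N ^ 4 * P :=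
      (Nat.mul_le_mul_left _ (Nat.pow_le_pow_right hN1 (by norm_num))).trans
        (Nat.le_mul_of_pos_right _ hP1)
    have hQN : 1 ≤ Q * N ^ 3 := Nat.mul_pos hQ1 (by positivity)
    have a2 : n * P * (300 * Q * N ^ 3 + 2) ≤ N * P * (302 * (Q * N ^ 3)) :=
      Nat.mul_le_mul (Nat.mul_le_mul_right _ (by omega)) (by nlinarith)
    have a3 : 1 ≤ Q * N ^ 4 * P := Nat.mul_pos (Nat.mul_pos hQ1 (by positivity)) hP1
    calc _ ≤ (2 * K + 80) * Q * N ^ 4 * P + (N * P * (302 * (Q * N ^ 3)) + Q * N ^ 4 * P) := by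
          omega
      _ = (2 * K + 383) * Q * N ^ 4 * P := by ring
  have hout : ∀ s' : State, s'.output n = arr n 0 s'.mem := fun s' => by
    ext u
    simp [State.output, mem_arr]
  refine (setup_spec q K hΔ).seq hcost fun s₁ h₁ hf₁ => ?_
  obtain ⟨he₁, ht₁, h0₁, hb₁, hN₁⟩ := h₁
  have key : numTrials G q K ⌈/⌉ 1 = numTrials G q K := ceilDiv_one _
  have := (RunsTo.countdown (G := G) (ω := ω) (c := rTrials) (d := rOne) (p := .trial)
    (M := numTrials G q K) (D := 1) (T := 300 * (q ^ 3 + 1) * (n + 1) ^ 3)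
    (I := fun j s' => Ready G q s' ∧ s'.tossed = j * trialLen G q ∧
      s'.reg rBest = (arr n 0 s'.mem).card ∧ (arr n 0 s'.mem).card ≤ n ∧
      (arr n 0 s'.mem = Finset.univ ∨ ∃ W, Grown G W (arr n 0 s'.mem)) ∧
      ∀ i < j, ∃ T, Grown G (trialSet G q ω (i * trialLen G q)) T ∧
        (arr n 0 s'.mem).card ≤ T.card) hN₁ he₁.one one_pos (by decide) rfl rfl ?_ ?_ ?_)
  · rw [key] at this
    refine this.mono le_rfl ?_
    rintro s' ⟨-, -, -, hn, hB, h⟩ -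
    rw [hout]
    exact ⟨hB, hn, h⟩
  · rintro j s' v ⟨he, ht, hb, h⟩
    exact ⟨⟨he.toEnv.set (by decide), by simp [he.deg], by simp [he.scale],
      by simp [he.work]⟩, ht, by simpa using hb, h⟩
  · refine ⟨he₁, by simp [ht₁], ?_⟩
    simp [h0₁, hb₁]
  · rintro j hj s₂ ⟨he₂, ht₂, hb₂, hn₂, hB₂, h₂⟩ -
    refine (trial_spec he₂ hΔ ht₂).mono le_rfl ?_
    rintro s₃ ⟨he₃, ht₃, T, hT, hI⟩ -
    have hle : (arr n 0 s₃.mem).card ≤ (arr n 0 s₂.mem).card ∧ (arr n 0 s₃.mem).card ≤ T.card := by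
      rcases hI with ⟨h, -, h'⟩ | ⟨h, -, h'⟩
      · rw [h]
        omega
      · rw [h]
        omega
    refine ⟨he₃, by rw [ht₃]; ring, ?_, hle.1.trans hn₂, ?_, fun i hi => ?_⟩
    · rcases hI with ⟨h, h', -⟩ | ⟨h, h', -⟩
      · rw [h', h, hb₂]
      · rw [h', h]
    · rcases hI with ⟨h, -⟩ | ⟨h, -⟩
      · rwa [h]
      · rw [h]
        exact .inr ⟨_, hT⟩
    · rcases Nat.lt_succ_iff_lt_or_eq.1 hi with hi | rfl
      · obtain ⟨T', hT', hle'⟩ := h₂ i hi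
        exact ⟨T', hT', hle.1.trans hle'⟩
      · exact ⟨T, hT, hle.2⟩

/-! ### The result of the growth -/

theorem induce_insert_connected {T : Finset (Fin n)} {x y : Fin n}
    (hT : (G.induce (T : Set (Fin n))).Connected) (hy : y ∈ T) (hxy : G.Adj x y) :
    (G.induce ((insert x T : Finset (Fin n)) : Set (Fin n))).Connected := by
  have h := G.induce_union_connected (s := T) (t := {x, y}) hT.preconnected
    (SimpleGraph.induce_pair_connected_of_adj hxy).preconnected ⟨y, hy, by simp⟩
  convert h using 2
  all_goals
    ext z
    simp only [Finset.coe_insert, Set.mem_insert_iff, Finset.mem_coe, Set.mem_union,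
      Set.mem_singleton_iff]
    constructor
    · tauto
    · rintro (h | h | rfl) <;> tauto

theorem induce_singleton_connected (x : Fin n) :
    (G.induce (({x} : Finset (Fin n)) : Set (Fin n))).Connected := by
  have : Subsingleton (({x} : Finset (Fin n)) : Set (Fin n)) := by simp
  have : Nonempty (({x} : Finset (Fin n)) : Set (Fin n)) := ⟨⟨x, by simp⟩⟩
  exact ⟨fun a b => by rw [Subsingleton.elim a b]⟩

theorem GrowStep.connected {W T T' : Finset (Fin n)} (h : GrowStep G W T T')
    (hT : T = ∅ ∨ (G.induce (T : Set (Fin n))).Connected) :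
    (G.induce (T' : Set (Fin n))).Connected := by
  have key : ∀ x, Reach G T x →
      (G.induce ((insert x T : Finset (Fin n)) : Set (Fin n))).Connected := by
    intro x hx
    rcases hT with rfl | hT
    · exact induce_singleton_connected x
    · rcases hx with rfl | ⟨y, hy, hxy⟩
      · exact induce_singleton_connected x
      · exact induce_insert_connected hT hy hxy
  cases h with
  | take x _ _ hx => exact key x hx
  | edge x y _ _ hx _ hxy => exact induce_insert_connected (key x hx) (by simp) hxy.symm

theorem Grown.isConnectedVertexCover {W T : Finset (Fin n)} (h : Grown G W T) (hG : G.Connected)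
    (hn : 2 ≤ n) : IsConnectedVertexCover G T := by
  obtain ⟨h, hst⟩ := h
  have hT : T = ∅ ∨ (G.induce (T : Set (Fin n))).Connected := by
    clear hst
    induction h with
    | refl => exact .inl rfl
    | tail _ hs ih => exact .inr (hs.connected ih)
  have hE := hst.edge
  have : Nontrivial (Fin n) := Fin.nontrivial_iff_two_le.2 hn
  rcases hT with rfl | hT
  · let v : Fin n := ⟨0, by omega⟩
    obtain ⟨y, hy⟩ := hG.preconnected.exists_adj_of_nontrivial v
    exact absurd hy (hE v (by simp) (.inl rfl) y (by simp))
  obtain ⟨t, ht⟩ := hT.nonempty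
  have hdom : ∀ v, v ∈ T ∨ ∃ y ∈ T, G.Adj v y := by
    by_contra! hv
    obtain ⟨v, hv⟩ := hv
    obtain ⟨p⟩ := hG.preconnected t v
    obtain ⟨d, -, h₁, h₂⟩ := p.exists_boundary_dart {v | v ∈ T ∨ ∃ y ∈ T, G.Adj v y} (.inl ht)
      fun h => h.elim hv.1 fun ⟨y, hy, hvy⟩ => hv.2 y hy hvy
    by_cases hd : d.fst ∈ T
    · exact h₂ (.inr ⟨_, hd, d.adj.symm⟩)
    · exact hE _ hd (.inr (h₁.resolve_left hd)) _ (fun h => h₂ (.inl h)) d.adj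
  refine ⟨fun u v huv => ?_, hT⟩
  by_contra! h
  exact hE u h.1 (.inr ((hdom u).resolve_left h.1)) v h.2 huv

/-- A set of vertices that induces a connected subgraph, phrased as the existence of an edge across
each nontrivial cut. -/
def Linked {n : ℕ} (G : SimpleGraph (Fin n)) (A : Finset (Fin n)) : Prop :=
  ∀ T : Finset (Fin n), (∃ a ∈ A, a ∈ T) → (∃ a ∈ A, a ∉ T) →
    ∃ x ∈ A, x ∉ T ∧ ∃ y ∈ A, y ∈ T ∧ G.Adj x y

theorem linked_of_connected {A : Finset (Fin n)} (hA : (G.induce (A : Set (Fin n))).Connected) :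
    Linked G A := by
  rintro T ⟨a, ha, haT⟩ ⟨b, hb, hbT⟩
  obtain ⟨p⟩ := hA.preconnected ⟨a, ha⟩ ⟨b, hb⟩
  obtain ⟨d, -, h₁, h₂⟩ := p.exists_boundary_dart {v | (v : Fin n) ∈ T} haT hbT
  exact ⟨d.snd, d.snd.2, h₂, d.fst, d.fst.2, h₁, d.adj.symm⟩

theorem linked_starSet (H : Finset (Fin n)) (v : ℕ) : Linked G (starSet G H v) := by
  have hadj : ∀ a ∈ starSet G H v, (a : ℕ) ≠ v → ∃ hv : v < n, G.Adj ⟨v, hv⟩ a := by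
    intro a ha hav
    simp only [starSet, Finset.mem_filter, Finset.mem_univ, true_and] at ha
    rcases ha with ha | ⟨ha, -⟩
    · exact absurd ha hav
    · simp only [adjEntry, ne_eq, ite_eq_right_iff, one_ne_zero, imp_false, not_not] at ha
      obtain ⟨hv, _, h⟩ := ha
      exact ⟨hv, h⟩
  have hmem : ∀ hv : v < n, (⟨v, hv⟩ : Fin n) ∈ starSet G H v := fun hv => by simp [starSet]
  rintro T ⟨a, ha, haT⟩ ⟨b, hb, hbT⟩
  by_cases hbv : (b : ℕ) = v
  · have hav : (a : ℕ) ≠ v := fun h => hbT (Fin.ext (h.trans hbv.symm) ▸ haT)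
    obtain ⟨hv, h⟩ := hadj a ha hav
    obtain rfl : b = ⟨v, hv⟩ := Fin.ext hbv
    exact ⟨_, hb, hbT, a, ha, haT, h⟩
  · obtain ⟨hv, h⟩ := hadj b hb hbv
    by_cases hvT : (⟨v, hv⟩ : Fin n) ∈ T
    · exact ⟨b, hb, hbT, _, hmem hv, hvT, h.symm⟩
    · have hav : (a : ℕ) ≠ v := fun h => hvT ((Fin.ext h : a = ⟨v, hv⟩) ▸ haT)
      obtain ⟨_, h'⟩ := hadj a ha hav
      exact ⟨_, hmem hv, hvT, a, ha, haT, h'⟩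

/-- `W` is the union of at most `R` linked sets. -/
def LinkedUnion {n : ℕ} (G : SimpleGraph (Fin n)) (W : Finset (Fin n)) (R : ℕ) : Prop :=
  ∃ I : Finset (Finset (Fin n)), I.card ≤ R ∧ (∀ A ∈ I, A ⊆ W ∧ Linked G A) ∧
    ∀ x ∈ W, ∃ A ∈ I, x ∈ A

theorem linkedUnion_empty : LinkedUnion G ∅ 0 := ⟨∅, by simp⟩

theorem LinkedUnion.union {W A : Finset (Fin n)} {R : ℕ} (h : LinkedUnion G W R)
    (hA : Linked G A) : LinkedUnion G (W ∪ A) (R + 1) := by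
  obtain ⟨I, hI, hIA, hIW⟩ := h
  refine ⟨insert A I, (Finset.card_insert_le _ _).trans (by omega), ?_, ?_⟩
  · intro B hB
    rcases Finset.mem_insert.1 hB with rfl | hB
    · exact ⟨Finset.subset_union_right, hA⟩
    · exact ⟨(hIA B hB).1.trans Finset.subset_union_left, (hIA B hB).2⟩
  · intro x hx
    rcases Finset.mem_union.1 hx with hx | hx
    · obtain ⟨B, hB, hxB⟩ := hIW x hx
      exact ⟨B, Finset.mem_insert_of_mem hB, hxB⟩
    · exact ⟨A, Finset.mem_insert_self _ _, hx⟩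

/-- Each edge taken by the growth has an end outside of `W`. If it avoids `W`, then it contains a new
vertex of `C \ W`. If it meets `W`, then it is the first one to reach a certain linked part of `W`,
because the rest of a part that has been reached is taken before any other edge. -/
theorem Grown.card_le {W T C : Finset (Fin n)} {R : ℕ} (h : Grown G W T)
    (hC : G.IsVertexCover (C : Set (Fin n))) (hW : LinkedUnion G W R) :
    T.card ≤ W.card + 2 * (C \ W).card + R := by
  obtain ⟨I, hI, hIA, hIW⟩ := hW
  have key : (T \ W).card ≤ 2 * ((C ∩ T) \ W).card +
      (I.filter fun A => ∃ a ∈ A, a ∈ T).card := by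
    obtain ⟨h, -⟩ := h
    induction h with
    | refl => simp
    | @tail T T' _ hs ih =>
      have mono1 : T ⊆ T' → ((C ∩ T) \ W).card ≤ ((C ∩ T') \ W).card := fun h =>
        Finset.card_le_card (Finset.sdiff_subset_sdiff (Finset.inter_subset_inter_left h) le_rfl)
      have mono2 : T ⊆ T' → (I.filter fun A => ∃ a ∈ A, a ∈ T).card ≤
          (I.filter fun A => ∃ a ∈ A, a ∈ T').card := fun h =>
        Finset.card_le_card (Finset.monotone_filter_right _ fun A _ ⟨a, ha, haT⟩ => ⟨a, ha, h haT⟩)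
      cases hs with
      | take x hxW hxT _ =>
        have hsub : T ⊆ insert x T := Finset.subset_insert _ _
        rw [Finset.insert_sdiff_of_mem _ hxW]
        have := mono1 hsub
        have := mono2 hsub
        omega
      | edge x y hno hxT hxR hyT hxy =>
        have hsub : T ⊆ insert y (insert x T) :=
          (Finset.subset_insert _ _).trans (Finset.subset_insert _ _)
        have h1 := mono1 hsub
        have h2 := mono2 hsub
        have hxW : x ∉ W := fun h => hno x h hxT hxR
        by_cases hyW : y ∈ W
        -- A part `A` that contains `y` was not reached before: otherwise, as `A` is linked, a vertex
        -- of `W` could have been taken instead of the edge.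
        · have hnew : (I.filter fun A => ∃ a ∈ A, a ∈ T).card + 1 ≤
              (I.filter fun A => ∃ a ∈ A, a ∈ insert y (insert x T)).card := by
            obtain ⟨A, hA, hyA⟩ := hIW y hyW
            refine Finset.card_lt_card ((Finset.ssubset_iff_of_subset
              (Finset.monotone_filter_right _ fun A _ ⟨a, ha, haT⟩ => ⟨a, ha, hsub haT⟩)).2
              ⟨A, by simp only [Finset.mem_filter]; exact ⟨hA, y, hyA, by simp⟩, fun hA' => ?_⟩)
            obtain ⟨z, hzA, hzT, u, -, huT, hzu⟩ := (hIA A hA).2 T (Finset.mem_filter.1 hA').2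
              ⟨y, hyA, hyT⟩
            exact hno z ((hIA A hA).1 hzA) hzT (.inr ⟨u, huT, hzu⟩)
          rw [Finset.insert_sdiff_of_mem _ hyW]
          rw [Finset.insert_sdiff_of_notMem _ hxW]
          have := Finset.card_insert_le x (T \ W)
          omega
        · have hnew : ((C ∩ T) \ W).card + 1 ≤ ((C ∩ insert y (insert x T)) \ W).card := by
            have : ∃ z ∈ C, z ∉ T ∧ z ∉ W ∧ z ∈ insert y (insert x T) := by
              rcases hC hxy with h | h
              · exact ⟨x, h, hxT, hxW, by simp⟩
              · exact ⟨y, h, hyT, hyW, by simp⟩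
            obtain ⟨z, hzC, hzT, hzW, hz⟩ := this
            refine Finset.card_lt_card ((Finset.ssubset_iff_of_subset
              (Finset.sdiff_subset_sdiff (Finset.inter_subset_inter_left hsub) le_rfl)).2
              ⟨z, ?_, ?_⟩)
            · simp only [Finset.mem_sdiff, Finset.mem_inter]
              exact ⟨⟨hzC, hz⟩, hzW⟩
            · simp [hzT]
          have : (insert y (insert x T) \ W).card ≤ (T \ W).card + 2 := by
            refine (Finset.card_le_card (t := insert y (insert x (T \ W))) ?_).trans
              ((Finset.card_insert_le _ _).trans
                (Nat.succ_le_succ (Finset.card_insert_le _ _)))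
            intro z
            simp only [Finset.mem_sdiff, Finset.mem_insert]
            tauto
          omega
  have h1 : T.card ≤ W.card + (T \ W).card := by
    rw [← Finset.card_inter_add_card_sdiff T W]
    have := Finset.card_le_card (Finset.inter_subset_right (s₁ := T) (s₂ := W))
    omega
  have h2 : ((C ∩ T) \ W).card ≤ (C \ W).card :=
    Finset.card_le_card (Finset.sdiff_subset_sdiff Finset.inter_subset_left le_rfl)
  have h3 := Finset.card_filter_le I fun A => ∃ a ∈ A, a ∈ T
  omega

/-- If the preferred set is a connected vertex cover, then nothing else is taken. -/
theorem Grown.subset {C T : Finset (Fin n)} (h : Grown G C T) (hC : IsConnectedVertexCover G C) :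
    T ⊆ C := by
  obtain ⟨h, -⟩ := h
  have hlink := linked_of_connected hC.connected
  induction h with
  | refl => simp
  | @tail T T' _ hs ih =>
    cases hs with
    | take x hx _ _ => exact Finset.insert_subset hx ih
    | edge x y hno hxT _ hyT hxy =>
      have hCT : ∀ c ∈ C, c ∈ T := by
        by_contra! hc
        obtain ⟨c, hc, hcT⟩ := hc
        by_cases hne : ∃ a ∈ C, a ∈ T
        · obtain ⟨z, hz, hzT, u, -, huT, hzu⟩ := hlink T hne ⟨c, hc, hcT⟩
          exact hno z hz hzT (.inr ⟨u, huT, hzu⟩)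
        · have : T = ∅ := by
            rw [Finset.eq_empty_iff_forall_notMem]
            exact fun a ha => hne ⟨a, ih ha, ha⟩
          exact hno c hc hcT (.inl this)
      rcases hC.cover hxy with h | h
      · exact absurd (hCT x h) hxT
      · exact absurd (hCT y h) hyT

/-! ### Counting edges -/

theorem sum_card_nbrs_inter (U : Finset (Fin n)) :
    ∑ x, (nbrs G x ∩ U).card = ∑ u ∈ U, (nbrs G u).card := by
  classical
  have := Finset.sum_card_bipartiteAbove_eq_sum_card_bipartiteBelow (s := Finset.univ) (t := U)
    (fun x u => G.Adj x u)
  convert this using 2 with x _ u _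
  · congr 1
    ext y
    simp [mem_nbrs, Finset.bipartiteAbove, and_comm]
  · congr 1
    ext y
    simp [mem_nbrs, Finset.bipartiteBelow, G.adj_comm]

/-- The left-hand side is twice the number of edges, and at most `|W| Δ` edges meet `W`. -/
theorem sum_card_nbrs_le (W : Finset (Fin n)) :
    ∑ x, (nbrs G x).card ≤ 2 * (W.card * maxDeg G) + ∑ x ∈ Wᶜ, (nbrs G x \ W).card := by
  have h1 : ∑ x ∈ W, (nbrs G x).card ≤ W.card * maxDeg G := by
    simpa using Finset.sum_le_card_nsmul W _ _ fun x _ => card_nbrs_le G x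
  have h2 : ∑ x ∈ Wᶜ, (nbrs G x).card =
      ∑ x ∈ Wᶜ, (nbrs G x ∩ W).card + ∑ x ∈ Wᶜ, (nbrs G x \ W).card := by
    rw [← Finset.sum_add_distrib]
    exact Finset.sum_congr rfl fun x _ => (Finset.card_inter_add_card_sdiff _ _).symm
  have h3 : ∑ x ∈ Wᶜ, (nbrs G x ∩ W).card ≤ ∑ x, (nbrs G x ∩ W).card :=
    Finset.sum_le_sum_of_subset (Finset.subset_univ _)
  rw [sum_card_nbrs_inter] at h3
  rw [← Finset.sum_add_sum_compl W]
  omega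

theorem nbrs_subset_of_notMem {C : Finset (Fin n)} (hC : G.IsVertexCover (C : Set (Fin n)))
    {x : Fin n} (hx : x ∉ C) : nbrs G x ⊆ C := fun _ hy =>
  (hC (mem_nbrs.1 hy)).resolve_left hx

theorem sum_card_nbrs_le_of_cover {C : Finset (Fin n)} (hC : G.IsVertexCover (C : Set (Fin n))) :
    ∑ x, (nbrs G x).card ≤ 2 * (C.card * maxDeg G) := by
  refine (sum_card_nbrs_le C).trans ?_
  rw [Finset.sum_eq_zero, add_zero]
  intro x hx
  rw [Finset.card_eq_zero, Finset.sdiff_eq_empty_iff_subset]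
  exact nbrs_subset_of_notMem hC (Finset.mem_compl.1 hx)

/-- The vertices with at least `Δ / q ^ 2` neighbours in `U`. -/
noncomputable def richSet {n : ℕ} (G : SimpleGraph (Fin n)) (q : ℕ) (U : Finset (Fin n)) :
    Finset (Fin n) :=
  Finset.univ.filter fun x => maxDeg G ≤ q ^ 2 * (nbrs G x ∩ U).card

/-- If few vertices have many neighbours in `U` and all vertices of `U` have large degree, then
`U` is small. -/
theorem card_le_of_richSet {q : ℕ} {U : Finset (Fin n)} (hq : 0 < q) (hΔ : 0 < maxDeg G)
    (hU : ∀ u ∈ U, maxDeg G ≤ q * (nbrs G u).card) (hX : q ^ 2 * (richSet G q U).card < n) :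
    q * U.card ≤ 2 * n := by
  -- Double counting of the pairs of a vertex and a neighbour in `U`: there are at least
  -- `|U| Δ / q` and at most `2 n Δ / q ^ 2` of them.
  have h1 : U.card * maxDeg G ≤ q * ∑ u ∈ U, (nbrs G u).card := by
    rw [Finset.mul_sum]
    simpa using Finset.card_nsmul_le_sum U _ _ hU
  have h2 : q ^ 2 * ∑ x, (nbrs G x ∩ U).card ≤ 2 * n * maxDeg G := by
    rw [Finset.mul_sum, ← Finset.sum_add_sum_compl (richSet G q U)]
    have a1 : ∑ x ∈ richSet G q U, q ^ 2 * (nbrs G x ∩ U).card ≤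
        (richSet G q U).card * (q ^ 2 * maxDeg G) := by
      simpa using Finset.sum_le_card_nsmul (richSet G q U) _ (q ^ 2 * maxDeg G) fun x _ =>
        Nat.mul_le_mul_left _
          ((Finset.card_le_card Finset.inter_subset_left).trans (card_nbrs_le G x))
    have a2 : ∑ x ∈ (richSet G q U)ᶜ, q ^ 2 * (nbrs G x ∩ U).card ≤
        (richSet G q U)ᶜ.card * maxDeg G := by
      simpa using Finset.sum_le_card_nsmul (richSet G q U)ᶜ _ (maxDeg G) fun x hx => by
        simp only [richSet, Finset.mem_compl, Finset.mem_filter, Finset.mem_univ, true_and,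
          not_le] at hx
        exact hx.le
    have a3 : (richSet G q U)ᶜ.card * maxDeg G ≤ n * maxDeg G :=
      Nat.mul_le_mul_right _ (by simpa using Finset.card_le_univ (richSet G q U)ᶜ)
    have a4 : q ^ 2 * (richSet G q U).card * maxDeg G ≤ n * maxDeg G :=
      Nat.mul_le_mul_right _ hX.le
    nlinarith
  rw [sum_card_nbrs_inter] at h2
  have h3 : q * maxDeg G * (q * U.card) ≤ q * maxDeg G * (2 * n) := by
    calc _ = q ^ 2 * (U.card * maxDeg G) := by ring
      _ ≤ q ^ 2 * (q * ∑ u ∈ U, (nbrs G u).card) := Nat.mul_le_mul_left _ h1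
      _ = q * (q ^ 2 * ∑ u ∈ U, (nbrs G u).card) := by ring
      _ ≤ q * (2 * n * maxDeg G) := Nat.mul_le_mul_left _ h2
      _ = _ := by ring
  exact Nat.le_of_mul_le_mul_left h3 (Nat.mul_pos hq hΔ)

/-- If only few vertices of the high-degree set `H` are missing from `W`, then `W` covers nearly
all edges and cannot be small. -/
theorem sum_card_nbrs_le_of_highSet {q : ℕ} {W₁ W : Finset (Fin n)} (h : W₁ ⊆ W)
    (hU : q * (highSet G q W₁ \ W).card ≤ 2 * n) :
    q * ∑ x, (nbrs G x).card ≤ 2 * q * W.card * maxDeg G + 3 * n * maxDeg G := by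
  have h1 := Nat.mul_le_mul_left q (sum_card_nbrs_le (G := G) W)
  have h2 : q * ∑ x ∈ Wᶜ, (nbrs G x \ W).card ≤
      ∑ x ∈ Wᶜ, ((if x ∈ highSet G q W₁ then q * maxDeg G else 0) + maxDeg G) := by
    rw [Finset.mul_sum]
    refine Finset.sum_le_sum fun x _ => ?_
    split_ifs with hx
    · have := (Finset.card_le_card (Finset.sdiff_subset (s := nbrs G x) (t := W))).trans
        (card_nbrs_le G x)
      have := Nat.mul_le_mul_left q this
      omega
    · simp only [highSet, Finset.mem_filter, Finset.mem_univ, true_and, not_le] at hx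
      have := Nat.mul_le_mul_left q
        (Finset.card_le_card (Finset.sdiff_subset_sdiff (le_refl (nbrs G x)) h))
      omega
  have h3 : ∑ x ∈ Wᶜ, (if x ∈ highSet G q W₁ then q * maxDeg G else 0) =
      (highSet G q W₁ \ W).card * (q * maxDeg G) := by
    rw [← Finset.sum_filter, Finset.sum_const, smul_eq_mul]
    congr 2
    ext x
    simp [and_comm]
  have h4 : Wᶜ.card ≤ n := by simpa using Finset.card_le_univ Wᶜ
  rw [Finset.sum_add_distrib, h3, Finset.sum_const, smul_eq_mul] at h2
  have h5 := Nat.mul_le_mul_right (maxDeg G) h4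
  have h6 := Nat.mul_le_mul_right (maxDeg G) hU
  nlinarith

/-! ### Good draws -/

/-- All draws for the random stars belong to the sets that are prescribed by the strategy `g`, which
assigns to the current set `W` the admissible results of the next draw. -/
def GoodRun {n : ℕ} (G : SimpleGraph (Fin n)) (H : Finset (Fin n))
    (g : Finset (Fin n) → Finset ℕ) (ω : ℕ → Bool) : ℕ → ℕ → Finset (Fin n) → Prop
  | _, 0, _ => True
  | k, R + 1, W => drawFrom ω 0 k (drawLen n) ∈ g W ∧
      GoodRun G H g ω (k + drawLen n) R (W ∪ starSet G H (drawFrom ω 0 k (drawLen n)))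

theorem GoodRun.invariant {H : Finset (Fin n)} {g : Finset (Fin n) → Finset ℕ} {ω : ℕ → Bool}
    {k R : ℕ} {W : Finset (Fin n)} (h : GoodRun G H g ω k R W) (P : ℕ → Finset (Fin n) → Prop)
    (h₀ : P 0 W) (step : ∀ j W v, P j W → v ∈ g W → P (j + 1) (W ∪ starSet G H v)) :
    P R (addStars G H ω k R W) := by
  suffices hs : ∀ j, P j W → P (j + R) (addStars G H ω k R W) by simpa using hs 0 h₀
  clear h₀
  induction R generalizing k W with
  | zero => exact fun j h => h
  | succ R ih =>
    intro j hj
    have := ih h.2 (j + 1) (step j W _ hj h.1)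
    rwa [show j + 1 + R = j + (R + 1) by omega] at this

/-- The numbers that are no vertices. Drawing one of them adds nothing to `W`. -/
def idle (n : ℕ) : Finset ℕ := Finset.Ico n (2 ^ drawLen n)

/-- Draw from `X` if it has at least `n / a` elements; do nothing otherwise. In both cases the
admissible numbers have density at least `1 / (4 a)`. -/
def drawOrIdle (a : ℕ) (X : Finset (Fin n)) : Finset ℕ :=
  if n ≤ a * X.card then X.map Fin.valEmbedding else idle n

theorem starSet_idle {H : Finset (Fin n)} {v : ℕ} (hv : v ∈ idle n) : starSet G H v = ∅ := by
  have hv : n ≤ v := (Finset.mem_Ico.1 hv).1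
  ext u
  have hu := u.2
  have h1 : (u : ℕ) ≠ v := by omega
  have h2 : adjEntry G v u = 0 := if_neg fun ⟨h, _⟩ => absurd h (by omega)
  simp [starSet, h1, h2]

theorem mem_starSet {H : Finset (Fin n)} {x u : Fin n} :
    u ∈ starSet G H x ↔ u = x ∨ (u ∈ nbrs G x ∧ u ∈ H) := by
  simp only [starSet, Finset.mem_filter, Finset.mem_univ, true_and, adjEntry_ne_zero, mem_nbrs,
    Fin.ext_iff]

theorem GoodRun.addStars_idle {H : Finset (Fin n)} {ω : ℕ → Bool} {k R : ℕ} {W : Finset (Fin n)}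
    (h : GoodRun G H (fun _ => idle n) ω k R W) : addStars G H ω k R W = W := by
  refine h.invariant (fun _ W' => W' = W) rfl ?_
  rintro j _ v rfl hv
  rw [starSet_idle hv, Finset.union_empty]

/-- A potential argument: as long as many draws `x` add at least `Δ / a` neighbours to `W`, such
a draw is made, and otherwise nothing happens. The number of rounds is too large for the former
to be the case all the time. -/
theorem potential_step {a j Δ : ℕ} {H W X : Finset (Fin n)} {v : ℕ}
    (hX : ∀ x ∈ X, Δ ≤ a * (nbrs G x ∩ (H \ W)).card)
    (h : a * X.card < n ∨ j * Δ ≤ a * W.card) (hv : v ∈ drawOrIdle a X) :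
    (a * X.card < n ∧ starSet G H v = ∅) ∨ (j + 1) * Δ ≤ a * (W ∪ starSet G H v).card := by
  by_cases hn : n ≤ a * X.card
  · rw [drawOrIdle, if_pos hn] at hv
    obtain ⟨x, hx, rfl⟩ := Finset.mem_map.1 hv
    right
    have hsub : W ∪ (nbrs G x ∩ (H \ W)) ⊆ W ∪ starSet G H (Fin.valEmbedding x) := by
      refine Finset.union_subset_union le_rfl fun u hu => ?_
      simp only [Finset.mem_inter, Finset.mem_sdiff] at hu
      exact mem_starSet.2 (.inr ⟨hu.1, hu.2.1⟩)
    have hdisj : Disjoint W (nbrs G x ∩ (H \ W)) := by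
      rw [Finset.disjoint_left]
      simp +contextual
    have hcard := Finset.card_le_card hsub
    rw [Finset.card_union_of_disjoint hdisj] at hcard
    have h1 := Nat.mul_le_mul_left a hcard
    have h2 := hX x hx
    have h3 := h.resolve_left (by omega)
    nlinarith
  · rw [drawOrIdle, if_neg hn] at hv
    exact .inl ⟨by omega, starSet_idle hv⟩

/-- The strategy of the first phase: centres of high degree outside of the cover `C`. -/
noncomputable def outerStrategy (G : SimpleGraph (Fin n)) (q : ℕ) (C W : Finset (Fin n)) :
    Finset ℕ :=
  drawOrIdle q (highSet G q W \ C)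

/-- The strategy of the second phase: centres with many neighbours in `H`. -/
noncomputable def innerStrategy (G : SimpleGraph (Fin n)) (q : ℕ) (H W : Finset (Fin n)) :
    Finset ℕ :=
  drawOrIdle (q ^ 2) (richSet G q (H \ W))

theorem mul_le_numRounds_mul (G : SimpleGraph (Fin n)) (q : ℕ) (hΔ : 0 < maxDeg G) :
    q ^ 3 * n ≤ numRounds G q * maxDeg G := by
  rw [mul_comm _ (maxDeg G), ← ceilDiv_le_iff_le_mul hΔ, numRounds]

theorem numRounds_mul_lt (G : SimpleGraph (Fin n)) (q : ℕ) (hΔ : 0 < maxDeg G) :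
    numRounds G q * maxDeg G < q ^ 3 * n + maxDeg G := by
  rcases Nat.eq_zero_or_pos (numRounds G q) with h | h
  · rw [h]
    omega
  · obtain ⟨r, hr⟩ : ∃ r, numRounds G q = r + 1 := ⟨numRounds G q - 1, by omega⟩
    have h' : ¬ numRounds G q ≤ r := by omega
    rw [numRounds, ceilDiv_le_iff_le_mul hΔ, not_le] at h'
    rw [hr, Nat.succ_mul, Nat.mul_comm r]
    omega

/-- The first phase ends with few vertices of high degree outside of `C`, and `W` contains no vertices
outside of `C` but the centres of the stars. -/
theorem outer_phase {q k : ℕ} {ω : ℕ → Bool} {C : Finset (Fin n)} (hq : 2 ≤ q) (hn : 0 < n)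
    (hΔ : 0 < maxDeg G) (hC : G.IsVertexCover (C : Set (Fin n)))
    (h : GoodRun G Finset.univ (outerStrategy G q C) ω k (numRounds G q) ∅) :
    let W := addStars G Finset.univ ω k (numRounds G q) ∅
    q * (highSet G q W \ C).card < n ∧ (W \ C).card ≤ numRounds G q ∧
      LinkedUnion G W (numRounds G q) := by
  intro W
  -- If the second alternative held after all rounds, then `W` would have more than `n` vertices.
  have key := h.invariant (fun j W => (q * (highSet G q W \ C).card < n ∨
    j * maxDeg G ≤ q * W.card) ∧ (W \ C).card ≤ j ∧ LinkedUnion G W j)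
    ⟨.inr (by simp), by simp, linkedUnion_empty⟩ ?_
  · refine ⟨key.1.resolve_right fun h' => ?_, key.2⟩
    have h1 := mul_le_numRounds_mul G q hΔ
    have h2 : q * W.card ≤ q * n := Nat.mul_le_mul_left _ (by simpa using Finset.card_le_univ W)
    have h3 : q * n < q ^ 3 * n := Nat.mul_lt_mul_of_pos_right
      (by nlinarith [Nat.mul_le_mul hq hq]) hn
    have h4 : numRounds G q * maxDeg G ≤ q * W.card := h'
    omega
  · rintro j W v ⟨h1, h2, h3⟩ hv
    have h4 := potential_step (Δ := maxDeg G) (H := Finset.univ) (G := G) (fun x hx => by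
      simp only [highSet, Finset.mem_sdiff, Finset.mem_filter, Finset.mem_univ, true_and] at hx
      have : nbrs G x ∩ (Finset.univ \ W) = nbrs G x \ W := by
        ext
        simp
      rw [this]
      exact hx.1) h1 hv
    refine ⟨h4.imp (fun h => ?_) id, ?_, h3.union (linked_starSet _ _)⟩
    · rw [h.2, Finset.union_empty]
      exact h.1
    · by_cases hn : n ≤ q * (highSet G q W \ C).card
      · rw [outerStrategy, drawOrIdle, if_pos hn] at hv
        obtain ⟨x, hx, rfl⟩ := Finset.mem_map.1 hv
        have hxC : x ∉ C := (Finset.mem_sdiff.1 hx).2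
        have hsub : (W ∪ starSet G Finset.univ (Fin.valEmbedding x)) \ C ⊆ insert x (W \ C) := by
          intro u hu
          simp only [Finset.mem_sdiff, Finset.mem_union, Finset.mem_insert] at hu ⊢
          rcases hu with ⟨hu | hu, huC⟩
          · exact .inr ⟨hu, huC⟩
          · rcases mem_starSet.1 hu with hu | ⟨hu, -⟩
            · exact .inl hu
            · exact absurd (nbrs_subset_of_notMem hC hxC hu) huC
        have := (Finset.card_le_card hsub).trans (Finset.card_insert_le _ _)
        omega
      · rw [outerStrategy, drawOrIdle, if_neg hn] at hv
        rw [starSet_idle hv, Finset.union_empty]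
        omega

/-- The second phase ends with few vertices that have many neighbours in `H \ W`, and it adds no
vertices outside of `H` but the centres of the stars. -/
theorem inner_phase {q k R : ℕ} {ω : ℕ → Bool} {H W₁ : Finset (Fin n)} (hq : 2 ≤ q) (hn : 0 < n)
    (hΔ : 0 < maxDeg G) (hW₁ : LinkedUnion G W₁ R)
    (h : GoodRun G H (innerStrategy G q H) ω k (numRounds G q) W₁) :
    let W := addStars G H ω k (numRounds G q) W₁
    q ^ 2 * (richSet G q (H \ W)).card < n ∧ W₁ ⊆ W ∧ (W \ (W₁ ∪ H)).card ≤ numRounds G q ∧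
      LinkedUnion G W (R + numRounds G q) := by
  intro W
  have key := h.invariant (fun j W => (q ^ 2 * (richSet G q (H \ W)).card < n ∨
    j * maxDeg G ≤ q ^ 2 * W.card) ∧ W₁ ⊆ W ∧ (W \ (W₁ ∪ H)).card ≤ j ∧ LinkedUnion G W (R + j))
    ⟨.inr (by simp), le_rfl, ?_, hW₁⟩ ?_
  · refine ⟨key.1.resolve_right fun h' => ?_, key.2⟩
    have h1 := mul_le_numRounds_mul G q hΔ
    have h2 : q ^ 2 * W.card ≤ q ^ 2 * n :=
      Nat.mul_le_mul_left _ (by simpa using Finset.card_le_univ W)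
    have h3 : q ^ 2 * n < q ^ 3 * n := Nat.mul_lt_mul_of_pos_right
      (Nat.pow_lt_pow_right hq (by norm_num)) hn
    have h4 : numRounds G q * maxDeg G ≤ q ^ 2 * W.card := h'
    omega
  · simp
  · rintro j W v ⟨h1, h2, h3, h5⟩ hv
    have h4 := potential_step (Δ := maxDeg G) (H := H) (G := G) (fun x hx => by
      simpa [richSet] using hx) h1 hv
    refine ⟨h4.imp (fun h => ?_) id, h2.trans Finset.subset_union_left, ?_,
      h5.union (linked_starSet _ _)⟩
    · rw [h.2, Finset.union_empty]
      exact h.1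
    · by_cases hn : n ≤ q ^ 2 * (richSet G q (H \ W)).card
      · rw [innerStrategy, drawOrIdle, if_pos hn] at hv
        obtain ⟨x, hx, rfl⟩ := Finset.mem_map.1 hv
        have hsub : (W ∪ starSet G H (Fin.valEmbedding x)) \ (W₁ ∪ H) ⊆
            insert x (W \ (W₁ ∪ H)) := by
          intro u hu
          simp only [Finset.mem_sdiff, Finset.mem_union, Finset.mem_insert] at hu ⊢
          rcases hu with ⟨hu | hu, huC⟩
          · exact .inr ⟨hu, huC⟩
          · rcases mem_starSet.1 hu with hu | ⟨-, hu⟩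
            · exact .inl hu
            · exact absurd (.inr hu) huC
        have := (Finset.card_le_card hsub).trans (Finset.card_insert_le _ _)
        omega
      · rw [innerStrategy, drawOrIdle, if_neg hn] at hv
        rw [starSet_idle hv, Finset.union_empty]
        omega

/-- The size of the connected vertex cover that is grown after two phases of good draws; with
`γ = ∑ deg / (2 Δ n)` the bound says `|T| ≤ 2 |C| - γ n + O(n / q)`. -/
theorem Grown.card_le_of_phases {q k k' : ℕ} {ω : ℕ → Bool} {C W₁ W T : Finset (Fin n)}
    (hq : 2 ≤ q) (hΔ : q ^ 4 ≤ maxDeg G) (hC : G.IsVertexCover (C : Set (Fin n)))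
    (h₁ : GoodRun G Finset.univ (outerStrategy G q C) ω k (numRounds G q) ∅)
    (hW₁ : addStars G Finset.univ ω k (numRounds G q) ∅ = W₁)
    (h₂ : GoodRun G (highSet G q W₁) (innerStrategy G q (highSet G q W₁)) ω k' (numRounds G q) W₁)
    (hW : addStars G (highSet G q W₁) ω k' (numRounds G q) W₁ = W) (hT : Grown G W T) :
    2 * maxDeg G * q * T.card + q * ∑ x, (nbrs G x).card ≤
      4 * maxDeg G * q * C.card + 31 * n * maxDeg G := by
  have hΔ0 : 0 < maxDeg G := lt_of_lt_of_le (by positivity) hΔ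
  have hΔn : maxDeg G ≤ n := maxDeg_le_of_forall fun x => by
    simpa using Finset.card_le_univ (nbrs G x)
  have hn : 0 < n := by omega
  obtain ⟨a1, a2, a3⟩ := outer_phase hq hn hΔ0 hC h₁
  rw [hW₁] at a1 a2 a3
  obtain ⟨b1, b2, b3, b4⟩ := inner_phase hq hn hΔ0 a3 h₂
  rw [hW] at b1 b2 b3 b4
  set R := numRounds G q with hR
  have hU := card_le_of_richSet (by omega) hΔ0 (fun u hu => by
    simp only [highSet, Finset.mem_sdiff, Finset.mem_filter, Finset.mem_univ, true_and] at hu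
    exact hu.1.trans (Nat.mul_le_mul_left _ (Finset.card_le_card Finset.sdiff_subset))) b1
  have hD := sum_card_nbrs_le_of_highSet b2 hU
  have hTW := hT.card_le hC b4
  have hWC : (W \ C).card ≤ 2 * R + (highSet G q W₁ \ C).card := by
    have hsub : W \ C ⊆ (W₁ \ C) ∪ ((highSet G q W₁ \ C) ∪ (W \ (W₁ ∪ highSet G q W₁))) := by
      intro x
      simp only [Finset.mem_sdiff, Finset.mem_union]
      tauto
    have c1 := Finset.card_le_card hsub
    have c2 := Finset.card_union_le (W₁ \ C)
      ((highSet G q W₁ \ C) ∪ (W \ (W₁ ∪ highSet G q W₁)))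
    have c3 := Finset.card_union_le (highSet G q W₁ \ C) (W \ (W₁ ∪ highSet G q W₁))
    omega
  have hCW : (C \ W).card + W.card = C.card + (W \ C).card := by
    rw [Finset.card_sdiff_add_card, Finset.union_comm, ← Finset.card_sdiff_add_card, add_comm]
  -- Here `Δ ≥ q ^ 4` is needed: the number of stars is negligible.
  have hqR : q * R ≤ 2 * n := by
    have d1 : R * maxDeg G < q ^ 3 * n + maxDeg G := numRounds_mul_lt G q hΔ0
    have d3 : q ≤ n := (Nat.le_self_pow (by norm_num) q).trans (hΔ.trans hΔn)
    refine Nat.le_of_mul_le_mul_right (c := maxDeg G) ?_ hΔ0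
    calc q * R * maxDeg G = q * (R * maxDeg G) := by ring
      _ ≤ q * (q ^ 3 * n + maxDeg G) := Nat.mul_le_mul_left _ d1.le
      _ = q ^ 4 * n + q * maxDeg G := by ring
      _ ≤ maxDeg G * n + n * maxDeg G :=
          Nat.add_le_add (Nat.mul_le_mul_right _ hΔ) (Nat.mul_le_mul_right _ d3)
      _ = 2 * n * maxDeg G := by ring
  have hfin : q * T.card + q * W.card ≤ 2 * (q * C.card) + 14 * n := by
    have e1 : T.card + W.card ≤ 2 * C.card + 6 * R + 2 * (highSet G q W₁ \ C).card := by omega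
    have e2 := Nat.mul_le_mul_left q e1
    nlinarith
  have hfin' := Nat.mul_le_mul_left (2 * maxDeg G) hfin
  nlinarith

/-! ### Coin tosses -/

/-- The average of `f` over the outcomes of the tosses `k, …, k + L - 1`; the other outcomes are
given by `ω`. -/
noncomputable def coinAvg : ℕ → ℕ → ((ℕ → Bool) → ℝ) → (ℕ → Bool) → ℝ
  | _, 0, f, ω => f ω
  | k, L + 1, f, ω => (coinAvg (k + 1) L f (Function.update ω k true) +
      coinAvg (k + 1) L f (Function.update ω k false)) / 2

theorem coinAvg_mono {k L : ℕ} {f g : (ℕ → Bool) → ℝ} {ω : ℕ → Bool}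
    (h : ∀ ω', (∀ i < k, ω' i = ω i) → f ω' ≤ g ω') : coinAvg k L f ω ≤ coinAvg k L g ω := by
  induction L generalizing k ω with
  | zero => exact h ω fun _ _ => rfl
  | succ L ih =>
    have key : ∀ b, coinAvg (k + 1) L f (Function.update ω k b) ≤
        coinAvg (k + 1) L g (Function.update ω k b) := fun b =>
      ih fun ω' h' => h ω' fun i hi => by
        rw [h' i (by omega), Function.update_of_ne (by omega)]
    have h1 := key true
    have h2 := key false
    simp only [coinAvg]
    linarith

theorem coinAvg_congr {k L : ℕ} {f g : (ℕ → Bool) → ℝ} {ω : ℕ → Bool}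
    (h : ∀ ω', (∀ i < k, ω' i = ω i) → f ω' = g ω') : coinAvg k L f ω = coinAvg k L g ω :=
  le_antisymm (coinAvg_mono fun ω' h' => (h ω' h').le) (coinAvg_mono fun ω' h' => (h ω' h').ge)

theorem coinAvg_add (k L M : ℕ) (f : (ℕ → Bool) → ℝ) (ω : ℕ → Bool) :
    coinAvg k (L + M) f ω = coinAvg k L (coinAvg (k + L) M f) ω := by
  induction L generalizing k ω with
  | zero => simp [coinAvg]
  | succ L ih =>
    rw [show L + 1 + M = (L + M) + 1 by omega, coinAvg, coinAvg, ih, ih,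
      show k + 1 + L = k + (L + 1) by omega]

theorem coinAvg_zero (k L : ℕ) (ω : ℕ → Bool) : coinAvg k L (fun _ => 0) ω = 0 := by
  induction L generalizing k ω with
  | zero => rfl
  | succ L ih => simp [coinAvg, ih]

theorem coinAvg_const_mul (k L : ℕ) (c : ℝ) (f : (ℕ → Bool) → ℝ) (ω : ℕ → Bool) :
    coinAvg k L (fun ω => c * f ω) ω = c * coinAvg k L f ω := by
  induction L generalizing k ω with
  | zero => rfl
  | succ L ih =>
    simp only [coinAvg, ih]
    ring

theorem coinAvg_one_sub (k L : ℕ) (f : (ℕ → Bool) → ℝ) (ω : ℕ → Bool) :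
    coinAvg k L (fun ω => 1 - f ω) ω = 1 - coinAvg k L f ω := by
  induction L generalizing k ω with
  | zero => rfl
  | succ L ih =>
    simp only [coinAvg, ih]
    ring

open Classical in
/-- The probability of `E` with respect to the tosses `k, …, k + L - 1`; the other outcomes are
given by `ω`. -/
noncomputable def coinProb (k L : ℕ) (E : (ℕ → Bool) → Prop) (ω : ℕ → Bool) : ℝ :=
  coinAvg k L (fun ω => if E ω then 1 else 0) ω

theorem coinProb_mono {k L : ℕ} {E F : (ℕ → Bool) → Prop} {ω : ℕ → Bool}
    (h : ∀ ω', (∀ i < k, ω' i = ω i) → E ω' → F ω') : coinProb k L E ω ≤ coinProb k L F ω := by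
  refine coinAvg_mono fun ω' h' => ?_
  by_cases hE : E ω'
  · rw [if_pos hE, if_pos (h ω' h' hE)]
  · rw [if_neg hE]
    split_ifs <;> norm_num

theorem coinProb_nonneg (k L : ℕ) (E : (ℕ → Bool) → Prop) (ω : ℕ → Bool) :
    0 ≤ coinProb k L E ω := by
  rw [← coinAvg_zero k L ω]
  refine coinAvg_mono fun ω' _ => ?_
  split_ifs <;> norm_num

theorem coinProb_not (k L : ℕ) (E : (ℕ → Bool) → Prop) (ω : ℕ → Bool) :
    coinProb k L (fun ω => ¬ E ω) ω = 1 - coinProb k L E ω := by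
  rw [coinProb, coinProb, ← coinAvg_one_sub]
  refine coinAvg_congr fun ω' _ => ?_
  split_ifs <;> norm_num

theorem coinProb_succ (k L : ℕ) (E : (ℕ → Bool) → Prop) (ω : ℕ → Bool) :
    coinProb k (L + 1) E ω = (coinProb (k + 1) L E (Function.update ω k true) +
      coinProb (k + 1) L E (Function.update ω k false)) / 2 := rfl

/-- A lower bound for the probability of two successive events, the second of which may depend on
the first tosses, too. -/
theorem mul_le_coinProb {k L M : ℕ} {E F : (ℕ → Bool) → Prop} {ω : ℕ → Bool} {p p' : ℝ}
    (hp' : 0 ≤ p') (hE : DependsOn E (Set.Iio (k + L))) (h : p ≤ coinProb k L E ω)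
    (h' : ∀ ω', E ω' → p' ≤ coinProb (k + L) M F ω') :
    p * p' ≤ coinProb k (L + M) (fun ω => E ω ∧ F ω) ω := by
  classical
  refine (mul_le_mul_of_nonneg_right h hp').trans ?_
  rw [mul_comm, coinProb, ← coinAvg_const_mul, coinProb, coinAvg_add]
  refine coinAvg_mono fun ω₁ _ => ?_
  by_cases hω₁ : E ω₁
  · rw [if_pos hω₁, mul_one]
    refine (h' ω₁ hω₁).trans (coinProb_mono fun ω₂ h₂ hF => ⟨?_, hF⟩)
    rwa [hE (fun i hi => h₂ i hi)]
  · rw [if_neg hω₁, mul_zero]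
    exact coinProb_nonneg _ _ (fun ω => E ω ∧ F ω) ω₁

/-- The probability that all trials fail. -/
theorem coinProb_forall_not_le {L : ℕ} {E : ℕ → (ℕ → Bool) → Prop} {p : ℝ} (hp1 : p ≤ 1)
    (hE : ∀ k, DependsOn (E k) (Set.Iio (k + L))) (hp : ∀ k ω, p ≤ coinProb k L (E k) ω)
    (N k : ℕ) (ω : ℕ → Bool) :
    coinProb k (N * L) (fun ω => ∀ j < N, ¬ E (k + j * L) ω) ω ≤ (1 - p) ^ N := by
  classical
  induction N generalizing k ω with
  | zero =>
    rw [Nat.zero_mul]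
    simp [coinProb, coinAvg]
  | succ N ih =>
    rw [Nat.succ_mul, Nat.add_comm, coinProb, coinAvg_add]
    calc _ ≤ coinAvg k L (fun ω => (1 - p) ^ N * if ¬ E k ω then 1 else 0) ω := by
          refine coinAvg_mono fun ω₁ _ => ?_
          by_cases h : E k ω₁
          · rw [if_neg (not_not.2 h), mul_zero]
            refine (coinAvg_mono (g := fun _ => 0) fun ω₂ h₂ => le_of_eq (if_neg ?_)).trans
              (coinAvg_zero _ _ _).le
            intro h'
            have := h' 0 (by omega)
            rw [Nat.zero_mul, Nat.add_zero, hE k (fun i hi => h₂ i hi)] at this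
            exact this h
          · rw [if_pos h, mul_one]
            refine le_trans (coinProb_mono (F := fun ω => ∀ j < N, ¬ E (k + L + j * L) ω)
              fun ω₂ _ h' j hj => ?_) (ih (k + L) ω₁)
            have := h' (j + 1) (by omega)
            rwa [Nat.succ_mul, Nat.add_comm (j * L), ← Nat.add_assoc] at this
      _ = (1 - p) ^ N * coinProb k L (fun ω => ¬ E k ω) ω := by
          rw [coinProb, ← coinAvg_const_mul]
          refine coinAvg_congr fun ω' _ => ?_
          by_cases h : E k ω' <;> simp [h]
      _ ≤ (1 - p) ^ N * (1 - p) := by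
          refine mul_le_mul_of_nonneg_left ?_ (pow_nonneg (by linarith) _)
          rw [coinProb_not]
          linarith [hp k ω]
      _ = _ := (pow_succ _ _).symm

instance : IsProbabilityMeasure coinMeasure := by
  rw [coinMeasure]
  infer_instance

theorem coinMeasure_cylinder (k : ℕ) (ω : ℕ → Bool) :
    coinMeasure.real {ω' | ∀ i < k, ω' i = ω i} = (1 / 2) ^ k := by
  have hset : {ω' : ℕ → Bool | ∀ i < k, ω' i = ω i} =
      Set.pi (Finset.range k) fun i => {ω i} := by
    ext ω'
    simp
  have hb : ∀ b : Bool, (PMF.uniformOfFintype Bool).toMeasure {b} = 2⁻¹ := fun b => by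
    rw [PMF.toMeasure_apply_singleton _ _ (measurableSet_singleton b)]
    simp
  rw [hset, measureReal_def, coinMeasure, Measure.infinitePi_pi _
    fun i _ => measurableSet_singleton _]
  simp [hb]

/-- The recursively defined probability agrees with the measure on infinite sequences. -/
theorem coinMeasure_inter_cylinder {E : (ℕ → Bool) → Prop} (L k : ℕ)
    (hE : DependsOn E (Set.Iio (k + L))) (ω : ℕ → Bool) :
    coinMeasure.real ({ω' | E ω'} ∩ {ω' | ∀ i < k, ω' i = ω i}) =
      (1 / 2) ^ k * coinProb k L E ω := by
  induction L generalizing k ω with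
  | zero =>
    have hiff : ∀ ω' : ℕ → Bool, (∀ i < k, ω' i = ω i) → (E ω' ↔ E ω) := fun ω' h =>
      iff_of_eq (hE fun i hi => h i hi)
    by_cases h : E ω
    · have hset : {ω' | E ω'} ∩ {ω' | ∀ i < k, ω' i = ω i} = {ω' | ∀ i < k, ω' i = ω i} := by
        ext ω'
        simp only [Set.mem_inter_iff, Set.mem_ofPred_eq, and_iff_right_iff_imp]
        exact fun h' => (hiff ω' h').2 h
      rw [hset, coinMeasure_cylinder, coinProb, coinAvg, if_pos h, mul_one]
    · have hset : {ω' | E ω'} ∩ {ω' | ∀ i < k, ω' i = ω i} = ∅ := by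
        ext ω'
        simp only [Set.mem_inter_iff, Set.mem_ofPred_eq, Set.mem_empty_iff_false, iff_false, not_and]
        exact fun h' h'' => h ((hiff ω' h'').1 h')
      rw [hset, coinProb, coinAvg, if_neg h, mul_zero, measureReal_empty]
  | succ L ih =>
    have hE' : DependsOn E (Set.Iio (k + 1 + L)) := by
      rwa [show k + 1 + L = k + (L + 1) by omega]
    have hcyl : ∀ b, {ω' : ℕ → Bool | ∀ i < k + 1, ω' i = Function.update ω k b i} =
        {ω' | ∀ i < k, ω' i = ω i} ∩ {ω' | ω' k = b} := by
      intro b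
      ext ω'
      simp only [Set.mem_inter_iff, Set.mem_ofPred_eq]
      constructor
      · intro h
        exact ⟨fun i hi => by rw [h i (by omega), Function.update_of_ne (by omega)],
          by rw [h k (by omega), Function.update_self]⟩
      · rintro ⟨h, h'⟩ i hi
        rcases Nat.lt_succ_iff_lt_or_eq.1 hi with hi | rfl
        · rw [h i hi, Function.update_of_ne (by omega)]
        · rw [h', Function.update_self]
    have hmeas : MeasurableSet {ω' : ℕ → Bool | ω' k = true} :=
      (measurable_pi_apply k : Measurable fun ω : ℕ → Bool => ω k) (measurableSet_singleton true)
    have hcompl : {ω' : ℕ → Bool | ω' k = true}ᶜ = {ω' | ω' k = false} := by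
      ext ω'
      simp
    rw [← measureReal_inter_add_sdiff hmeas, Set.sdiff_eq, hcompl, Set.inter_assoc, Set.inter_assoc,
      ← hcyl, ← hcyl, ih _ hE', ih _ hE', coinProb_succ]
    ring

theorem coinMeasure_eq_coinProb {E : (ℕ → Bool) → Prop} {L : ℕ} (hE : DependsOn E (Set.Iio L))
    (ω : ℕ → Bool) : coinMeasure.real {ω' | E ω'} = coinProb 0 L E ω := by
  have := coinMeasure_inter_cylinder L 0 (by rwa [Nat.zero_add]) ω
  simpa using this

/-! ### The probability of a good trial -/

theorem drawFrom_congr {a k L : ℕ} {ω ω' : ℕ → Bool} (h : ∀ i < k + L, k ≤ i → ω i = ω' i) :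
    drawFrom ω a k L = drawFrom ω' a k L := by
  induction L generalizing a k with
  | zero => rfl
  | succ L ih =>
    rw [drawFrom, drawFrom, h k (by omega) le_rfl]
    exact ih fun i hi hk => h i (by omega) (by omega)

/-- A number that is drawn bit by bit, continuing the binary digits of `a`, is uniformly distributed
on the numbers that begin with `a`. -/
theorem coinProb_drawFrom (k L a : ℕ) (S : Finset ℕ) (ω : ℕ → Bool) :
    coinProb k L (fun ω => drawFrom ω a k L ∈ S) ω =
      (S ∩ Finset.Ico (a * 2 ^ L) ((a + 1) * 2 ^ L)).card / 2 ^ L := by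
  induction L generalizing k a ω with
  | zero =>
    have : S ∩ Finset.Ico (a * 2 ^ 0) ((a + 1) * 2 ^ 0) = if a ∈ S then {a} else ∅ := by
      ext x
      split_ifs with h
      · simp only [Finset.mem_inter, Finset.mem_Ico, Finset.mem_singleton]
        constructor
        · omega
        · rintro rfl
          exact ⟨h, by omega⟩
      · simp only [Finset.mem_inter, Finset.mem_Ico, Finset.notMem_empty, iff_false]
        rintro ⟨h', h''⟩
        obtain rfl : x = a := by omega
        exact h h'
    rw [this]
    by_cases h : a ∈ S <;> simp [coinProb, coinAvg, drawFrom, h]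
  | succ L ih =>
    have key : ∀ b : Bool, coinProb (k + 1) L (fun ω => drawFrom ω a k (L + 1) ∈ S)
        (Function.update ω k b) = (S ∩ Finset.Ico ((2 * a + b.toNat) * 2 ^ L)
          ((2 * a + b.toNat + 1) * 2 ^ L)).card / 2 ^ L := by
      intro b
      rw [← ih (k + 1) (2 * a + b.toNat) (Function.update ω k b)]
      have hk : ∀ ω' : ℕ → Bool, (∀ i < k + 1, ω' i = Function.update ω k b i) → ω' k = b :=
        fun ω' h => by rw [h k (by omega), Function.update_self]
      refine le_antisymm (coinProb_mono fun ω' h h' => ?_) (coinProb_mono fun ω' h h' => ?_)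
      · rwa [drawFrom, hk ω' h] at h'
      · rwa [drawFrom, hk ω' h]
    have hsplit : S ∩ Finset.Ico (a * 2 ^ (L + 1)) ((a + 1) * 2 ^ (L + 1)) =
        (S ∩ Finset.Ico ((2 * a + 1) * 2 ^ L) ((2 * a + 1 + 1) * 2 ^ L)) ∪
          (S ∩ Finset.Ico ((2 * a + 0) * 2 ^ L) ((2 * a + 0 + 1) * 2 ^ L)) := by
      rw [← Finset.inter_union_distrib_left, Finset.union_comm,
        Finset.Ico_union_Ico_eq_Ico (Nat.mul_le_mul_right _ (by omega))
          (Nat.mul_le_mul_right _ (by omega))]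
      congr 2 <;> ring
    have hdisj : Disjoint (S ∩ Finset.Ico ((2 * a + 1) * 2 ^ L) ((2 * a + 1 + 1) * 2 ^ L))
        (S ∩ Finset.Ico ((2 * a + 0) * 2 ^ L) ((2 * a + 0 + 1) * 2 ^ L)) := by
      rw [Finset.disjoint_left]
      simp only [Finset.mem_inter, Finset.mem_Ico]
      intro x h h'
      have h1 := h.2.1
      have h2 := h'.2.2
      rw [Nat.add_zero] at h2
      omega
    rw [coinProb_succ, key, key, hsplit, Finset.card_union_of_disjoint hdisj]
    push_cast
    simp only [Bool.toNat_true, Bool.toNat_false]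
    field_simp
    ring

/-- A prescribed pattern of `L` tosses. -/
theorem coinProb_eq_pattern (k L : ℕ) (c : ℕ → Bool) (ω : ℕ → Bool) :
    (1 / 2) ^ L ≤ coinProb k L (fun ω => ∀ i < L, ω (k + i) = c i) ω := by
  induction L generalizing k c ω with
  | zero => simp [coinProb, coinAvg]
  | succ L ih =>
    have key : (1 / 2) ^ L ≤ coinProb (k + 1) L (fun ω => ∀ i < L + 1, ω (k + i) = c i)
        (Function.update ω k (c 0)) := by
      refine (ih (k + 1) (fun i => c (i + 1)) _).trans (coinProb_mono fun ω' h h' i hi => ?_)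
      rcases i with _ | i
      · rw [Nat.add_zero, h k (by omega), Function.update_self]
      · rw [← h' i (by omega), show k + 1 + i = k + (i + 1) by omega]
    have h1 := coinProb_nonneg (k + 1) L (fun ω => ∀ i < L + 1, ω (k + i) = c i)
      (Function.update ω k true)
    have h2 := coinProb_nonneg (k + 1) L (fun ω => ∀ i < L + 1, ω (k + i) = c i)
      (Function.update ω k false)
    rw [coinProb_succ, pow_succ]
    rcases hc : c 0 with _ | _ <;> rw [hc] at key <;> linarith

theorem addStars_congr {H : Finset (Fin n)} {k R : ℕ} {W : Finset (Fin n)} {ω ω' : ℕ → Bool}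
    (h : ∀ i < k + R * drawLen n, k ≤ i → ω i = ω' i) :
    addStars G H ω k R W = addStars G H ω' k R W := by
  induction R generalizing k W with
  | zero => rfl
  | succ R ih =>
    rw [Nat.succ_mul] at h
    rw [addStars, addStars, drawFrom_congr (ω' := ω') fun i hi hk => h i (by omega) hk]
    exact ih fun i hi hk => h i (by omega) (by omega)

theorem GoodRun.congr {H : Finset (Fin n)} {g : Finset (Fin n) → Finset ℕ} {k R : ℕ}
    {W : Finset (Fin n)} {ω ω' : ℕ → Bool} (h : ∀ i < k + R * drawLen n, k ≤ i → ω i = ω' i) :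
    GoodRun G H g ω k R W ↔ GoodRun G H g ω' k R W := by
  induction R generalizing k W with
  | zero => rfl
  | succ R ih =>
    rw [Nat.succ_mul] at h
    rw [GoodRun, GoodRun, drawFrom_congr (ω' := ω') fun i hi hk => h i (by omega) hk,
      ih fun i hi hk => h i (by omega) (by omega)]

theorem le_coinProb_goodRun {H : Finset (Fin n)} {g : Finset (Fin n) → Finset ℕ} {p : ℝ}
    (hp : 0 ≤ p) (hg : ∀ W, p * 2 ^ drawLen n ≤ (g W ∩ Finset.range (2 ^ drawLen n)).card)
    (k R : ℕ) (W : Finset (Fin n)) (ω : ℕ → Bool) :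
    p ^ R ≤ coinProb k (R * drawLen n) (fun ω => GoodRun G H g ω k R W) ω := by
  induction R generalizing k W ω with
  | zero => simp [coinProb, coinAvg, GoodRun]
  | succ R ih =>
    rw [Nat.succ_mul, Nat.add_comm (R * drawLen n), pow_succ, mul_comm]
    refine mul_le_coinProb (E := fun ω => drawFrom ω 0 k (drawLen n) ∈ g W)
      (F := fun ω => GoodRun G H g ω (k + drawLen n) R
        (W ∪ starSet G H (drawFrom ω 0 k (drawLen n)))) (pow_nonneg hp R) ?_ ?_ ?_
    · intro ω ω' h
      simp only
      rw [drawFrom_congr (ω' := ω') fun i hi _ => h i hi]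
    · rw [coinProb_drawFrom, le_div_iff₀ (by positivity)]
      rw [Nat.zero_mul, Nat.zero_add, Nat.one_mul, ← Finset.range_eq_Ico]
      exact hg W
    · intro ω₁ _
      refine (ih (k + drawLen n) (W ∪ starSet G H (drawFrom ω₁ 0 k (drawLen n))) ω₁).trans
        (coinProb_mono fun ω₂ h h' => ?_)
      rwa [drawFrom_congr (ω' := ω₁) fun i hi _ => h i hi]

theorem two_mul_le_two_pow_drawLen (n : ℕ) : 2 * n ≤ 2 ^ drawLen n :=
  Nat.le_pow_clog (by norm_num) _

theorem two_pow_drawLen_lt (hn : 0 < n) : 2 ^ drawLen n < 4 * n := by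
  have h := Nat.pow_pred_clog_lt_self (b := 2) (by norm_num) (x := 2 * n) (by omega)
  have hpos : 0 < drawLen n := Nat.clog_pos (by norm_num) (by omega)
  obtain ⟨b, hb⟩ : ∃ b, drawLen n = b + 1 := ⟨drawLen n - 1, by omega⟩
  have h' : 2 ^ b < 2 * n := by
    change 2 ^ (drawLen n - 1) < 2 * n at h
    rwa [hb] at h
  rw [hb, pow_succ]
  omega

theorem card_idle_ge (n : ℕ) :
    (1 / 2 : ℝ) * 2 ^ drawLen n ≤ (idle n ∩ Finset.range (2 ^ drawLen n)).card := by
  have h := two_mul_le_two_pow_drawLen n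
  have hset : idle n ∩ Finset.range (2 ^ drawLen n) = idle n := by
    rw [Finset.inter_eq_left]
    intro x hx
    exact Finset.mem_range.2 (Finset.mem_Ico.1 hx).2
  rw [hset, idle, Nat.card_Ico, Nat.cast_sub (by omega)]
  have h' : (2 * n : ℝ) ≤ 2 ^ drawLen n := by exact_mod_cast h
  push_cast
  linarith

theorem card_drawOrIdle_ge {a : ℕ} (hn : 0 < n) (ha : 0 < a) (X : Finset (Fin n)) :
    (1 / (4 * a) : ℝ) * 2 ^ drawLen n ≤
      (drawOrIdle a X ∩ Finset.range (2 ^ drawLen n)).card := by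
  have ha' : (1 : ℝ) ≤ a := by exact_mod_cast ha
  rw [drawOrIdle]
  split_ifs with h
  · have hset : X.map Fin.valEmbedding ∩ Finset.range (2 ^ drawLen n) = X.map Fin.valEmbedding := by
      rw [Finset.inter_eq_left]
      intro x hx
      obtain ⟨y, -, rfl⟩ := Finset.mem_map.1 hx
      have h1 := two_mul_le_two_pow_drawLen n
      have h2 := y.2
      exact Finset.mem_range.2 (by simp; omega)
    rw [hset, Finset.card_map, one_div_mul_eq_div, div_le_iff₀ (by positivity)]
    have h1 : (2 ^ drawLen n : ℝ) ≤ 4 * n := by exact_mod_cast (two_pow_drawLen_lt hn).le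
    have h2 : (n : ℝ) ≤ a * X.card := by exact_mod_cast h
    linarith
  · refine le_trans (mul_le_mul_of_nonneg_right ?_ (by positivity)) (card_idle_ge n)
    rw [div_le_div_iff₀ (by positivity) (by norm_num)]
    linarith

/-- The trial with the coin tosses from the `k`-th on starts with the set `W₀` and makes draws
according to the strategies `g₁` and `g₂`. The second strategy is informed of the set `H`. -/
def GoodTrial (G : SimpleGraph (Fin n)) (q : ℕ) (W₀ : Finset (Fin n))
    (g₁ : Finset (Fin n) → Finset ℕ) (g₂ : Finset (Fin n) → Finset (Fin n) → Finset ℕ) (k : ℕ)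
    (ω : ℕ → Bool) : Prop :=
  trialStart n ω k = W₀ ∧ GoodRun G Finset.univ g₁ ω (k + 1 + n) (numRounds G q) W₀ ∧
    GoodRun G (highSet G q (trialMid G q ω k)) (g₂ (highSet G q (trialMid G q ω k))) ω
      (k + 1 + n + numRounds G q * drawLen n) (numRounds G q) (trialMid G q ω k)

theorem trialStart_congr {k : ℕ} {ω ω' : ℕ → Bool} (h : ∀ i < k + 1 + n, ω i = ω' i) :
    trialStart n ω k = trialStart n ω' k := by
  ext u
  have hu := u.2
  simp only [trialStart, Finset.mem_filter, Finset.mem_univ, true_and]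
  rw [h k (by omega), h (k + 1 + u) (by omega)]

theorem trialMid_congr {q k : ℕ} {ω ω' : ℕ → Bool}
    (h : ∀ i < k + 1 + n + numRounds G q * drawLen n, ω i = ω' i) :
    trialMid G q ω k = trialMid G q ω' k := by
  rw [trialMid, trialMid, trialStart_congr fun i hi => h i (by omega)]
  exact addStars_congr fun i hi _ => h i hi

theorem dependsOn_goodTrial (q : ℕ) (W₀ : Finset (Fin n)) (g₁ : Finset (Fin n) → Finset ℕ)
    (g₂ : Finset (Fin n) → Finset (Fin n) → Finset ℕ) (k : ℕ) :
    DependsOn (GoodTrial G q W₀ g₁ g₂ k) (Set.Iio (k + trialLen G q)) := by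
  intro ω ω' h
  have h : ∀ i < k + trialLen G q, ω i = ω' i := h
  rw [trialLen] at h
  have hmid : trialMid G q ω k = trialMid G q ω' k := trialMid_congr fun i hi => h i (by omega)
  rw [GoodTrial, GoodTrial, hmid, trialStart_congr fun i hi => h i (by omega)]
  have h1 : GoodRun G Finset.univ g₁ ω (k + 1 + n) (numRounds G q) W₀ ↔ GoodRun G Finset.univ g₁ ω'
    (k + 1 + n) (numRounds G q) W₀ := GoodRun.congr fun i hi _ => h i (by omega)
  rw [h1, GoodRun.congr (ω' := ω') fun i hi _ => h i (by omega)]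

theorem le_coinProb_goodTrial {q k : ℕ} {W₀ : Finset (Fin n)} {g₁ : Finset (Fin n) → Finset ℕ}
    {g₂ : Finset (Fin n) → Finset (Fin n) → Finset ℕ} {p₀ p : ℝ} {ω : ℕ → Bool} (hp : 0 ≤ p)
    (h₀ : p₀ ≤ coinProb k (1 + n) (fun ω => trialStart n ω k = W₀) ω)
    (h₁ : ∀ W, p * 2 ^ drawLen n ≤ (g₁ W ∩ Finset.range (2 ^ drawLen n)).card)
    (h₂ : ∀ H W, p * 2 ^ drawLen n ≤ (g₂ H W ∩ Finset.range (2 ^ drawLen n)).card) :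
    p₀ * p ^ (2 * numRounds G q) ≤ coinProb k (trialLen G q) (GoodTrial G q W₀ g₁ g₂ k) ω := by
  set R := numRounds G q with hR
  have hpR := pow_nonneg hp R
  have h1 : p₀ * p ^ R ≤ coinProb k (1 + n + R * drawLen n) (fun ω => trialStart n ω k = W₀ ∧
      GoodRun G Finset.univ g₁ ω (k + 1 + n) R W₀) ω := by
    refine mul_le_coinProb hpR ?_ h₀ fun ω' _ => ?_
    · intro ω ω' h
      simp only
      rw [trialStart_congr fun i hi => h i (by rw [Set.mem_Iio]; omega)]
    · rw [← Nat.add_assoc]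
      exact le_coinProb_goodRun hp h₁ _ _ _ _
  rw [two_mul, pow_add, ← mul_assoc, trialLen]
  refine (mul_le_coinProb (F := fun ω => GoodRun G (highSet G q (trialMid G q ω k))
    (g₂ (highSet G q (trialMid G q ω k))) ω (k + 1 + n + R * drawLen n) R (trialMid G q ω k))
    hpR ?_ h1 fun ω' _ => ?_).trans (coinProb_mono fun ω' _ h => ⟨h.1.1, h.1.2, h.2⟩)
  · intro ω ω' h
    have h : ∀ i < k + (1 + n + R * drawLen n), ω i = ω' i := h
    simp only
    rw [trialStart_congr fun i hi => h i (by omega),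
      GoodRun.congr (ω' := ω') fun i hi _ => h i (by omega)]
  · rw [show k + (1 + n + R * drawLen n) = k + 1 + n + R * drawLen n by omega]
    refine (le_coinProb_goodRun (G := G) (H := highSet G q (trialMid G q ω' k)) hp
      (h₂ (highSet G q (trialMid G q ω' k)))
      (k + 1 + n + R * drawLen n) R (trialMid G q ω' k) ω').trans (coinProb_mono fun ω₂ h h' => ?_)
    rwa [trialMid_congr (ω' := ω') fun i hi => h i hi]

theorem coinProb_true (k L : ℕ) (ω : ℕ → Bool) : coinProb k L (fun _ => True) ω = 1 := by
  have h := coinProb_not k L (fun _ => False) ω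
  rw [show coinProb k L (fun _ => False) ω = 0 by simp [coinProb, coinAvg_zero]] at h
  simpa using h

/-- The trial starts with the empty set if the first toss is `1`, whatever the others are. -/
theorem half_le_coinProb_start (k : ℕ) (ω : ℕ → Bool) :
    1 / 2 ≤ coinProb k (1 + n) (fun ω => trialStart n ω k = ∅) ω := by
  have h := mul_le_coinProb (k := k) (L := 1) (M := n) (E := fun ω => ω k = true)
    (F := fun _ => True) (ω := ω) (p := 1 / 2) (p' := 1) zero_le_one ?_ ?_ ?_
  · rw [mul_one] at h
    refine h.trans (coinProb_mono fun ω' _ h' => ?_)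
    ext u
    have := Bool.toNat_le (ω' (k + 1 + u))
    simp [trialStart, h'.1]
    cases ω' (k + 1 + u) <;> simp
  · intro ω ω' h
    simp only
    rw [h k (by simp)]
  · simp [coinProb, coinAvg]
  · intro ω' _
    exact (coinProb_true _ _ _).ge

/-- Every set is guessed with probability `2 ^ (-(n + 1))`: the first toss must be `0`, and the others
are prescribed by the set. -/
theorem pow_le_coinProb_start (k : ℕ) (W₀ : Finset (Fin n)) (ω : ℕ → Bool) :
    (1 / 2) ^ (1 + n) ≤ coinProb k (1 + n) (fun ω => trialStart n ω k = W₀) ω := by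
  classical
  refine (coinProb_eq_pattern k (1 + n) (fun i => if h : i - 1 < n then
    decide (0 < i ∧ (⟨i - 1, h⟩ : Fin n) ∈ W₀) else false) ω).trans (coinProb_mono fun ω' _ h => ?_)
  have h0 : ω' k = false := by
    rw [← Nat.add_zero k, h 0 (by omega)]
    split_ifs <;> simp
  ext u
  have hu := u.2
  have h1 := h (1 + u) (by omega)
  rw [← Nat.add_assoc] at h1
  simp only [Nat.add_sub_cancel_left] at h1
  rw [dif_pos hu] at h1
  simp [trialStart, h0, h1]

/-! ### The approximation factor -/

open Classical in
theorem avgDeg_eq (G : SimpleGraph (Fin n)) : avgDeg G = (∑ x, ((nbrs G x).card : ℝ)) / n := by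
  rw [avgDeg]
  congr 1
  exact Finset.sum_congr rfl fun x _ => congrArg _ (degree_eq_card_nbrs x)

theorem avgDeg_div_nonneg (G : SimpleGraph (Fin n)) : 0 ≤ avgDeg G / (2 * maxDeg G) := by
  rw [avgDeg_eq]
  exact div_nonneg (div_nonneg (Finset.sum_nonneg fun _ _ => Nat.cast_nonneg _) (Nat.cast_nonneg _))
    (mul_nonneg zero_le_two (Nat.cast_nonneg _))

theorem sum_card_nbrs_eq (G : SimpleGraph (Fin n)) (hn : 0 < n) (hΔ : 0 < maxDeg G) :
    ∑ x, ((nbrs G x).card : ℝ) = 2 * maxDeg G * (avgDeg G / (2 * maxDeg G) * n) := by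
  have hn : (n : ℝ) ≠ 0 := by exact_mod_cast hn.ne'
  have hΔ : (maxDeg G : ℝ) ≠ 0 := by exact_mod_cast hΔ.ne'
  rw [avgDeg_eq]
  generalize ∑ x, ((nbrs G x).card : ℝ) = S
  generalize (maxDeg G : ℝ) = Δ at *
  field_simp

theorem IsInstance.maxDeg_pos (hG : IsInstance G) : 0 < maxDeg G := by
  have hn := hG.two_le
  have : Nontrivial (Fin n) := Fin.nontrivial_iff_two_le.2 hn
  obtain ⟨y, hy⟩ := hG.connected.preconnected.exists_adj_of_nontrivial (⟨0, by omega⟩ : Fin n)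
  exact lt_of_lt_of_le (Finset.card_pos.2 ⟨y, mem_nbrs.2 hy⟩) (card_nbrs_le G _)

theorem isConnectedVertexCover_univ (hG : G.Connected) :
    IsConnectedVertexCover G Finset.univ := by
  refine ⟨fun u v _ => .inl (by simp), ?_⟩
  rw [Finset.coe_univ]
  exact (SimpleGraph.induceUnivIso G).connected_iff.2 hG

/-- The final estimate, where `γ` is `d̄ / (2 Δ)`, `c` is the size of the optimal cover, `t` the
size of the grown one and `b` the size of the output. -/
theorem le_ratio_mul {γ ε n c t b q : ℝ} (hε : 0 < ε) (hγ : ε / 2 ≤ γ) (hq : 32 / ε ^ 2 ≤ q)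
    (hn : 0 < n) (hbn : b ≤ n) (hbt : b ≤ t) (hc : γ * n ≤ c)
    (ht : q * t + q * (γ * n) ≤ 2 * (q * c) + 31 / 2 * n) :
    b ≤ (2 / (1 + γ) + ε) * c := by
  have hγ0 : 0 < γ := by linarith
  have hc0 : 0 < c := lt_of_lt_of_le (by positivity) hc
  have hq0 : 0 < q := lt_of_lt_of_le (by positivity) hq
  have hεc : 0 < ε * c := by positivity
  rcases le_total ((1 + γ) * n) (2 * c) with h | h
  · have : n ≤ 2 / (1 + γ) * c := by
      rw [div_mul_eq_mul_div, le_div_iff₀ (by linarith)]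
      linarith
    linarith
  · have h1 : 2 * c - γ * n ≤ 2 / (1 + γ) * c := by
      rw [div_mul_eq_mul_div, le_div_iff₀ (by linarith)]
      nlinarith
    have h2 : 31 / 2 * n ≤ q * (ε * c) := by
      have e1 : 32 ≤ q * ε ^ 2 := by rwa [div_le_iff₀ (by positivity)] at hq
      have e2 : ε / 2 * n ≤ c := le_trans (mul_le_mul_of_nonneg_right hγ hn.le) hc
      have e3 : q * ε * (ε / 2 * n) ≤ q * ε * c := mul_le_mul_of_nonneg_left e2 (by positivity)
      nlinarith
    have h3 : q * t ≤ q * (2 * c - γ * n + ε * c) := by linarith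
    have h4 := le_of_mul_le_mul_left h3 hq0
    linarith

theorem half_pow_le (q : ℕ) (hq : 0 < q) : (1 / 2 : ℝ) ^ (4 * q ^ 2) ≤ 1 / (4 * (q ^ 2 : ℕ)) := by
  have h : 4 * q ^ 2 ≤ 2 ^ (4 * q ^ 2) := Nat.lt_two_pow_self.le
  rw [one_div_pow]
  refine one_div_le_one_div_of_le (by positivity) ?_
  exact_mod_cast h

/-- `K = 8 q ^ 2 + q + 1` is large enough for `2 R` draws of probability `p ≥ 2 ^ (-4 q ^ 2)` and a
start of probability `2 ^ (-m)` with `m ≤ (q + 1) R`. -/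
theorem half_pow_le_mul {q R m : ℕ} {p p₀ : ℝ} (hp : (1 / 2 : ℝ) ^ (4 * q ^ 2) ≤ p)
    (hp₀ : (1 / 2 : ℝ) ^ m ≤ p₀) (hm : m ≤ (q + 1) * R) :
    (1 / 2 : ℝ) ^ ((8 * q ^ 2 + q + 1) * R) ≤ p₀ * p ^ (2 * R) := by
  calc (1 / 2 : ℝ) ^ ((8 * q ^ 2 + q + 1) * R)
      = (1 / 2) ^ ((q + 1) * R) * ((1 / 2) ^ (4 * q ^ 2)) ^ (2 * R) := by
        rw [← pow_mul, ← pow_add]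
        congr 1
        ring
    _ ≤ (1 / 2) ^ m * p ^ (2 * R) := mul_le_mul
        (pow_le_pow_of_le_one (by norm_num) (by norm_num) hm)
        (pow_le_pow_left₀ (by positivity) hp _) (by positivity) (by positivity)
    _ ≤ _ := mul_le_mul_of_nonneg_right hp₀
        (pow_nonneg (le_trans (by positivity) hp) _)

theorem numRounds_pos {q : ℕ} (hq : 0 < q) (hn : 0 < n) (hΔ : 0 < maxDeg G) :
    0 < numRounds G q := by
  have h := mul_le_numRounds_mul G q hΔ
  have h' : 0 < q ^ 3 * n := by positivity
  exact Nat.pos_of_mul_pos_right (h'.trans_le h)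

/-- For every connected vertex cover `C` there are coin tosses of probability `2 ^ (- O(n / Δ))`
that make a trial good enough in comparison with `C`. If `Δ` is bounded, then the trial guesses `C`
itself. If `d̄ / Δ` is small, then it guesses the empty set, so that the growth only takes edges and
arrives at a factor of 2. Otherwise the trial follows the two strategies. -/
theorem IsInstance.exists_goodTrial (hG : IsInstance G) {ε : ℝ} (hε : 0 < ε) {q : ℕ} (hq : 2 ≤ q)
    (hqε : 32 / ε ^ 2 ≤ q) {C : Finset (Fin n)} (hC : IsConnectedVertexCover G C) :
    ∃ W₀ g₁ g₂, (∀ k ω, (1 / 2 : ℝ) ^ ((8 * q ^ 2 + q + 1) * numRounds G q) ≤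
        coinProb k (trialLen G q) (GoodTrial G q W₀ g₁ g₂ k) ω) ∧
      ∀ k ω T, GoodTrial G q W₀ g₁ g₂ k ω → Grown G (trialSet G q ω k) T →
        ∀ b : ℕ, b ≤ n → b ≤ T.card →
          (b : ℝ) ≤ (2 / (1 + avgDeg G / (2 * maxDeg G)) + ε) * C.card := by
  have hn := hG.two_le
  have hn0 : (0 : ℝ) < n := by exact_mod_cast (by omega : 0 < n)
  have hΔ := hG.maxDeg_pos
  have hΔ' : (0 : ℝ) < maxDeg G := by exact_mod_cast hΔ
  have hR := numRounds_pos (q := q) (by omega) (by omega) hΔ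
  set R := numRounds G q with hR_def
  set γ := avgDeg G / (2 * maxDeg G) with hγ
  have hsum : (∑ x, ((nbrs G x).card : ℝ)) = 2 * maxDeg G * (γ * n) := by
    exact sum_card_nbrs_eq G (by omega) hΔ
  have hγ0 : 0 ≤ γ := avgDeg_div_nonneg G
  have hγ1 : γ ≤ 1 := by
    have h1 : (∑ x, ((nbrs G x).card : ℝ)) ≤ n * maxDeg G := by
      refine (Finset.sum_le_card_nsmul _ _ (maxDeg G : ℝ) fun x _ => ?_).trans (by simp)
      exact_mod_cast card_nbrs_le G x
    rw [hsum] at h1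
    have h2 : maxDeg G * n * γ ≤ maxDeg G * n * 1 := by nlinarith [mul_pos hΔ' hn0]
    exact le_of_mul_le_mul_left h2 (mul_pos hΔ' hn0)
  have hp := half_pow_le q (by omega)
  have hidle : ∀ W : Finset (Fin n), 1 / (4 * (q ^ 2 : ℕ)) * 2 ^ drawLen n ≤
      ((idle n ∩ Finset.range (2 ^ drawLen n)).card : ℝ) := fun _ => by
    refine le_trans (mul_le_mul_of_nonneg_right ?_ (by positivity)) (card_idle_ge n)
    have : (1 : ℝ) ≤ (q ^ 2 : ℕ) := by exact_mod_cast Nat.one_le_pow _ _ (by omega)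
    rw [div_le_div_iff₀ (by positivity) (by norm_num)]
    linarith
  have hp_nonneg : (0 : ℝ) ≤ 1 / (4 * (q ^ 2 : ℕ)) := by positivity
  by_cases hΔq : q ^ 4 ≤ maxDeg G
  · by_cases hγε : γ ≤ ε / 2
    · refine ⟨∅, fun _ => idle n, fun _ _ => idle n, fun k ω => ?_, ?_⟩
      · exact (half_pow_le_mul (m := 1) hp (by norm_num)
          (Nat.mul_pos (by omega) hR)).trans
          (le_coinProb_goodTrial hp_nonneg (half_le_coinProb_start k ω) hidle fun _ => hidle)
      · rintro k ω T ⟨h0, h1, h2⟩ hT b - hb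
        have hmid : trialMid G q ω k = ∅ := by
          rw [trialMid, h0]
          exact h1.addStars_idle
        rw [trialSet, h2.addStars_idle, hmid] at hT
        have h3 := hT.card_le hC.cover linkedUnion_empty
        have h4 : (b : ℝ) ≤ 2 * C.card := by
          exact_mod_cast hb.trans (h3.trans (by simp))
        refine h4.trans (mul_le_mul_of_nonneg_right ?_ (by positivity))
        have h5 : 2 - 2 * γ ≤ 2 / (1 + γ) := by
          rw [le_div_iff₀ (by linarith)]
          nlinarith
        linarith
    · refine ⟨∅, outerStrategy G q C, innerStrategy G q, fun k ω => ?_, ?_⟩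
      · refine (half_pow_le_mul (m := 1) hp (by norm_num)
          (Nat.mul_pos (by omega) hR)).trans
          (le_coinProb_goodTrial hp_nonneg (half_le_coinProb_start k ω) (fun W => ?_)
            fun H W => card_drawOrIdle_ge (by omega) (by positivity) _)
        refine le_trans (mul_le_mul_of_nonneg_right ?_ (by positivity))
          (card_drawOrIdle_ge (a := q) (by omega) (by omega) _)
        refine one_div_le_one_div_of_le (by positivity) ?_
        exact_mod_cast Nat.mul_le_mul_left 4 (Nat.le_self_pow (by norm_num) q)
      · rintro k ω T ⟨h0, h1, h2⟩ hT b hbn hbT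
        have hmid : addStars G Finset.univ ω (k + 1 + n) (numRounds G q) ∅ = trialMid G q ω k := by
          rw [trialMid, h0]
        have h3 := Grown.card_le_of_phases hq hΔq hC.cover h1 hmid h2 rfl hT
        have h4 := sum_card_nbrs_le_of_cover hC.cover
        have h3' : (2 * maxDeg G * q * T.card + q * ∑ x, ((nbrs G x).card : ℝ)) ≤
            4 * maxDeg G * q * C.card + 31 * n * maxDeg G := by exact_mod_cast h3
        have h4' : (∑ x, ((nbrs G x).card : ℝ)) ≤ 2 * (C.card * maxDeg G) := by exact_mod_cast h4
        rw [hsum] at h3' h4'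
        refine le_ratio_mul hε (not_le.1 hγε).le hqε hn0 (by exact_mod_cast hbn)
          (by exact_mod_cast hbT : (b : ℝ) ≤ T.card) ?_ ?_
        · refine le_of_mul_le_mul_left ?_ (by positivity : (0 : ℝ) < 2 * maxDeg G)
          linarith
        · refine le_of_mul_le_mul_left ?_ (by positivity : (0 : ℝ) < 2 * maxDeg G)
          linarith
  -- As `R ≥ n / q`, the set `C` itself can be guessed with probability `2 ^ (-O(R))`.
  · have hnR : n ≤ q * R := by
      have h1 := mul_le_numRounds_mul G q hΔ
      have h2 : R * maxDeg G ≤ R * q ^ 4 := Nat.mul_le_mul_left _ (by omega)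
      refine Nat.le_of_mul_le_mul_left (c := q ^ 3) ?_ (by positivity)
      calc q ^ 3 * n ≤ R * q ^ 4 := h1.trans h2
        _ = q ^ 3 * (q * R) := by ring
    refine ⟨C, fun _ => idle n, fun _ _ => idle n, fun k ω => ?_, ?_⟩
    · exact (half_pow_le_mul (m := 1 + n) hp le_rfl (by rw [Nat.succ_mul]; omega)).trans
        (le_coinProb_goodTrial hp_nonneg (pow_le_coinProb_start k C ω) hidle fun _ => hidle)
    · rintro k ω T ⟨h0, h1, h2⟩ hT b - hb
      have hmid : trialMid G q ω k = C := by
        rw [trialMid, h0]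
        exact h1.addStars_idle
      rw [trialSet, h2.addStars_idle, hmid] at hT
      have h3 : (b : ℝ) ≤ 1 * C.card := by
        rw [one_mul]
        exact_mod_cast hb.trans (Finset.card_le_card (hT.subset hC))
      refine h3.trans (mul_le_mul_of_nonneg_right ?_ (by positivity))
      have h5 : 1 ≤ 2 / (1 + γ) := by
        rw [le_div_iff₀ (by linarith)]
        linarith
      linarith

theorem one_sub_half_pow_pow_le {m n : ℕ} (hn : 0 < n) :
    (1 - (1 / 2 : ℝ) ^ m) ^ (n * 2 ^ m) ≤ 1 / n := by
  have h0 : (0 : ℝ) ≤ 1 - (1 / 2) ^ m :=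
    sub_nonneg.2 (pow_le_one₀ (by norm_num) (by norm_num))
  calc (1 - (1 / 2 : ℝ) ^ m) ^ (n * 2 ^ m) ≤ (Real.exp (-(1 / 2) ^ m)) ^ (n * 2 ^ m) :=
        pow_le_pow_left₀ h0 (Real.one_sub_le_exp_neg _) _
    _ = Real.exp (-n) := by
        rw [← Real.exp_nat_mul]
        congr 1
        push_cast
        rw [one_div_pow]
        field_simp
    _ ≤ 1 / n := by
        rw [Real.exp_neg, ← one_div]
        refine one_div_le_one_div_of_le (by exact_mod_cast hn) ?_
        linarith [Real.add_one_le_exp (n : ℝ)]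

theorem IsInstance.outputs (hG : IsInstance G) (q K : ℕ) (ω : ℕ → Bool) :
    ∃ S, (Prog.main q K).Outputs G ω S ∧ IsConnectedVertexCover G S ∧ S.card ≤ n ∧
      ∀ j < numTrials G q K, ∃ T, Grown G (trialSet G q ω (j * trialLen G q)) T ∧
        S.card ≤ T.card := by
  obtain ⟨s, k, he, -, h1, h2, h3⟩ := main_spec (ω := ω) q K hG.maxDeg_pos
  refine ⟨_, ⟨s, k, he, rfl⟩, ?_, h2, h3⟩
  rcases h1 with h1 | ⟨W, h1⟩
  · rw [h1]
    exact isConnectedVertexCover_univ hG.connected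
  · exact h1.isConnectedVertexCover hG.connected hG.two_le

theorem IsInstance.le_coinMeasure (hG : IsInstance G) {ε : ℝ} (hε : 0 < ε) {q : ℕ} (hq : 2 ≤ q)
    (hqε : 32 / ε ^ 2 ≤ q) :
    1 - 1 / (n : ℝ) ≤ coinMeasure.real {ω | ∃ S, (Prog.main q (8 * q ^ 2 + q + 1)).Outputs G ω S ∧
      IsApproxConnectedVertexCover G (2 / (1 + avgDeg G / (2 * (maxDeg G : ℝ))) + ε) S} := by
  set K := 8 * q ^ 2 + q + 1 with hK
  set L := trialLen G q with hL
  set N := numTrials G q K with hN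
  have hn : 0 < n := by have := hG.two_le; omega
  obtain ⟨C, hC, hmin⟩ : ∃ C, IsConnectedVertexCover G C ∧
      ∀ T, IsConnectedVertexCover G T → C.card ≤ T.card := by
    classical
    obtain ⟨C, hC, h⟩ := Finset.exists_min_image
      (Finset.univ.filter fun C => IsConnectedVertexCover G C) Finset.card
      ⟨Finset.univ, by simpa using isConnectedVertexCover_univ hG.connected⟩
    exact ⟨C, by simpa using hC, fun T hT => h T (by simpa using hT)⟩
  obtain ⟨W₀, g₁, g₂, hp, hgood⟩ := hG.exists_goodTrial hε hq hqε hC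
  have hdep : DependsOn (fun ω => ∀ j < N, ¬ GoodTrial G q W₀ g₁ g₂ (0 + j * L) ω)
      (Set.Iio (N * L)) := by
    intro ω ω' h
    have h : ∀ i < N * L, ω i = ω' i := h
    refine forall_congr fun j => forall_congr fun hj => congrArg Not ?_
    refine dependsOn_goodTrial q W₀ g₁ g₂ (0 + j * L) fun i hi => h i ?_
    have hi : i < 0 + j * L + L := hi
    have : (j + 1) * L ≤ N * L := Nat.mul_le_mul_right _ hj
    rw [Nat.succ_mul] at this
    omega
  have hfail := coinProb_forall_not_le (p := (1 / 2 : ℝ) ^ (K * numRounds G q))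
    (E := GoodTrial G q W₀ g₁ g₂) (pow_le_one₀ (by norm_num) (by norm_num))
    (dependsOn_goodTrial q W₀ g₁ g₂) hp N 0 fun _ => false
  have hnot : DependsOn (fun ω => ¬ ∀ j < N, ¬ GoodTrial G q W₀ g₁ g₂ (0 + j * L) ω)
      (Set.Iio (N * L)) := fun _ _ h => congrArg Not (hdep h)
  have hprob := coinMeasure_eq_coinProb hnot fun _ => false
  rw [coinProb_not] at hprob
  have hsub := measureReal_mono (μ := coinMeasure)
    (show {ω | ¬ ∀ j < N, ¬ GoodTrial G q W₀ g₁ g₂ (0 + j * L) ω} ⊆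
      {ω | ∃ S, (Prog.main q K).Outputs G ω S ∧ IsApproxConnectedVertexCover G
        (2 / (1 + avgDeg G / (2 * (maxDeg G : ℝ))) + ε) S} from ?_)
  · refine le_trans ?_ hsub
    rw [hprob]
    linarith [hfail.trans (one_sub_half_pow_pow_le (m := K * numRounds G q) hn)]
  · intro ω hω
    have hω : ¬ ∀ j < N, ¬ GoodTrial G q W₀ g₁ g₂ (0 + j * L) ω := hω
    push Not at hω
    obtain ⟨j, hj, hω⟩ := hω
    rw [Nat.zero_add] at hω
    obtain ⟨S, hS, hS', hSn, hST⟩ := hG.outputs q K ω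
    obtain ⟨T, hT, hST⟩ := hST j hj
    refine ⟨S, hS, hS', fun T' hT' => (hgood _ ω T hω hT S.card hSn hST).trans ?_⟩
    refine mul_le_mul_of_nonneg_left (by exact_mod_cast hmin T' hT') ?_
    have := avgDeg_div_nonneg G
    positivity

/-! ### The running time -/

/-- The number of steps is `n ^ O(1) * 2 ^ O(x)` if `Δ ≥ c n / x`, with constants that depend only on
`q`, `K` and `c`. -/
theorem exists_cost_le (q K : ℕ) {c : ℝ} (hc : 0 < c) :
    ∃ (a : ℕ) (b : ℝ), 0 ≤ b ∧ ∀ (n : ℕ) (G : SimpleGraph (Fin n)) (x : ℝ), 2 ≤ n → 0 < maxDeg G →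
      0 < x → c * (n / x) ≤ maxDeg G →
      ((2 * K + 383) * (q ^ 3 + 1) * (n + 1) ^ 4 * 2 ^ (K * numRounds G q) : ℕ) ≤
        (n : ℝ) ^ a * 2 ^ (b * x) := by
  set A := (2 * K + 383) * (q ^ 3 + 1) * 2 ^ K with hA
  refine ⟨A + 8, K * q ^ 3 / c, by positivity, fun n G x hn hΔ hx h => ?_⟩
  have hΔ' : (0 : ℝ) < maxDeg G := by exact_mod_cast hΔ
  have hR : (numRounds G q : ℝ) ≤ q ^ 3 / c * x + 1 := by
    have h1 : (numRounds G q : ℝ) * maxDeg G ≤ q ^ 3 * n + maxDeg G := by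
      exact_mod_cast (numRounds_mul_lt G q hΔ).le
    have h2 : (n : ℝ) ≤ x / c * maxDeg G := by
      rw [← mul_div_assoc, div_le_iff₀ hx] at h
      rw [div_mul_eq_mul_div, le_div_iff₀ hc]
      linarith
    refine le_of_mul_le_mul_right (h1.trans ?_) hΔ'
    have h3 := mul_le_mul_of_nonneg_left h2 (by positivity : (0 : ℝ) ≤ q ^ 3)
    calc (q : ℝ) ^ 3 * n + maxDeg G ≤ q ^ 3 * (x / c * maxDeg G) + maxDeg G := by linarith
      _ = _ := by ring
  have hpow : (2 : ℝ) ^ (K * numRounds G q) ≤ 2 ^ K * 2 ^ (K * q ^ 3 / c * x) := by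
    rw [← Real.rpow_natCast, ← Real.rpow_natCast, ← Real.rpow_add two_pos]
    refine Real.rpow_le_rpow_of_exponent_le one_le_two ?_
    push_cast
    calc (K : ℝ) * numRounds G q ≤ K * (q ^ 3 / c * x + 1) :=
          mul_le_mul_of_nonneg_left hR (by positivity)
      _ = _ := by ring
  -- `A ≤ 2 ^ A ≤ n ^ A` and `n + 1 ≤ n ^ 2`.
  have hpoly : A * (n + 1) ^ 4 ≤ n ^ (A + 8) := by
    rw [pow_add]
    refine Nat.mul_le_mul (Nat.lt_two_pow_self.le.trans (Nat.pow_le_pow_left hn _)) ?_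
    rw [show n ^ 8 = (n ^ 2) ^ 4 by ring]
    exact Nat.pow_le_pow_left (by nlinarith) _
  have hpoly' : (A : ℝ) * (n + 1) ^ 4 ≤ n ^ (A + 8) := by exact_mod_cast hpoly
  calc (((2 * K + 383) * (q ^ 3 + 1) * (n + 1) ^ 4 * 2 ^ (K * numRounds G q) : ℕ) : ℝ)
      = (2 * K + 383) * (q ^ 3 + 1) * (n + 1) ^ 4 * 2 ^ (K * numRounds G q) := by push_cast; ring
    _ ≤ (2 * K + 383) * (q ^ 3 + 1) * (n + 1) ^ 4 * (2 ^ K * 2 ^ (K * q ^ 3 / c * x)) :=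
        mul_le_mul_of_nonneg_left hpow (by positivity)
    _ = A * (n + 1) ^ 4 * 2 ^ (K * q ^ 3 / c * x) := by
        rw [hA]
        push_cast
        ring
    _ ≤ _ := mul_le_mul_of_nonneg_right hpoly' (by positivity)

theorem exists_runsInTime (q K : ℕ) {c : ℝ} (hc : 0 < c) :
    ∃ (a : ℕ) (b : ℝ), 0 ≤ b ∧ ∀ ψ T : ℕ → ℝ, (∀ᶠ n in atTop, 0 < ψ n) →
      (∀ᶠ n : ℕ in atTop, (n : ℝ) ^ a * 2 ^ (b * ψ n) ≤ T n) →
      (Prog.main q K).RunsInTime c ψ T := by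
  obtain ⟨a, b, hb, h⟩ := exists_cost_le q K hc
  refine ⟨a, b, hb, fun ψ T hψ hT => ?_⟩
  filter_upwards [hψ, hT] with n hψ hT G hG hΔ ω
  obtain ⟨s, k, he, hk, -⟩ := main_spec (ω := ω) q K hG.maxDeg_pos
  exact ⟨s, k, he, le_trans (by exact_mod_cast hk)
    ((h n G (ψ n) hG.two_le hG.maxDeg_pos hψ hΔ).trans hT)⟩

theorem tendsto_log_natCast_atTop : Tendsto (fun n : ℕ => Real.log n) atTop atTop :=
  Real.tendsto_log_atTop.comp tendsto_natCast_atTop_atTop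

theorem eventually_one_le_logloglog : ∀ᶠ n : ℕ in atTop, 1 ≤ logloglog n :=
  (Real.tendsto_log_atTop.comp (Real.tendsto_log_atTop.comp
    tendsto_log_natCast_atTop)).eventually_ge_atTop 1

theorem two_rpow_le_exp {x : ℝ} (hx : 0 ≤ x) : (2 : ℝ) ^ x ≤ Real.exp x := by
  rw [← Real.exp_one_rpow]
  exact Real.rpow_le_rpow zero_le_two (by linarith [Real.add_one_le_exp (1 : ℝ)]) hx

/-- The factor 2 is there for `1 / log 2`. -/
theorem natCast_pow_le_two_rpow {n : ℕ} (hn : 0 < n) (a : ℕ) :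
    (n : ℝ) ^ a ≤ 2 ^ (2 * a * Real.log n) := by
  have hn' : (0 : ℝ) < n := by exact_mod_cast hn
  have hlog : 0 ≤ Real.log n := Real.log_natCast_nonneg n
  rw [← Real.rpow_natCast, Real.rpow_def_of_pos hn', Real.rpow_def_of_pos two_pos]
  refine Real.exp_le_exp.2 ?_
  have h2 : 1 ≤ 2 * Real.log 2 := by linarith [Real.log_two_gt_d9]
  calc Real.log n * a = 1 * (a * Real.log n) := by ring
    _ ≤ 2 * Real.log 2 * (a * Real.log n) := mul_le_mul_of_nonneg_right h2 (by positivity)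
    _ = _ := by ring

theorem exists_runsInTime_logloglog (q K : ℕ) {c : ℝ} (hc : 0 < c) :
    ∃ C : ℝ, ∀ ψ : ℕ → ℝ, (∀ᶠ n in atTop, 0 < ψ n) → (Prog.main q K).RunsInTime c ψ fun n =>
      (n : ℝ) ^ C * (2 : ℝ) ^ (C * (ψ n * logloglog n)) := by
  obtain ⟨a, b, hb, h⟩ := exists_runsInTime q K hc
  refine ⟨max a b, fun ψ hψ => h ψ _ hψ ?_⟩
  filter_upwards [hψ, eventually_one_le_logloglog, eventually_ge_atTop 1] with n hψ hl hn
  have hn' : (1 : ℝ) ≤ n := by exact_mod_cast hn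
  refine mul_le_mul ?_ (Real.rpow_le_rpow_of_exponent_le one_le_two ?_) (by positivity)
    (by positivity)
  · rw [← Real.rpow_natCast]
    exact Real.rpow_le_rpow_of_exponent_le hn' (le_max_left _ _)
  · refine mul_le_mul (le_max_right _ _) ?_ hψ.le (hb.trans (le_max_right _ _))
    exact le_mul_of_one_le_right hψ.le hl

theorem exists_runsInTime_polynomial (q K : ℕ) {c : ℝ} (hc : 0 < c) {ψ : ℕ → ℝ}
    (hψ : ∀ᶠ n in atTop, 0 < ψ n)
    (hO : ψ =O[atTop] fun n : ℕ => Real.log n / logloglog n) :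
    ∃ k : ℕ, (Prog.main q K).RunsInTime c ψ fun n => (n : ℝ) ^ k := by
  obtain ⟨a, b, hb, h⟩ := exists_runsInTime q K hc
  obtain ⟨B, hB, hO⟩ := hO.exists_pos
  refine ⟨a + ⌈b * B⌉₊, h ψ _ hψ ?_⟩
  filter_upwards [hψ, hO.bound, eventually_one_le_logloglog, eventually_ge_atTop 1]
    with n hψ hO hl hn
  have hn' : (1 : ℝ) ≤ n := by exact_mod_cast hn
  have hlog : 0 ≤ Real.log n := Real.log_natCast_nonneg n
  rw [Real.norm_of_nonneg hψ.le, Real.norm_of_nonneg (by positivity)] at hO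
  have hψB : b * ψ n ≤ b * B * Real.log n := by
    rw [mul_assoc]
    exact mul_le_mul_of_nonneg_left (hO.trans
      (mul_le_mul_of_nonneg_left (div_le_self hlog hl) hB.le)) hb
  rw [pow_add]
  refine mul_le_mul_of_nonneg_left ?_ (by positivity)
  calc (2 : ℝ) ^ (b * ψ n) ≤ Real.exp (b * ψ n) := two_rpow_le_exp (mul_nonneg hb hψ.le)
    _ ≤ Real.exp (Real.log n * (b * B)) := Real.exp_le_exp.2 (by linarith)
    _ = (n : ℝ) ^ (b * B) := (Real.rpow_def_of_pos (by linarith) _).symm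
    _ ≤ (n : ℝ) ^ (⌈b * B⌉₊ : ℝ) := Real.rpow_le_rpow_of_exponent_le hn' (Nat.le_ceil _)
    _ = _ := Real.rpow_natCast _ _

theorem exists_runsInTime_quasipolynomial (q K : ℕ) {c : ℝ} (hc : 0 < c) {ψ : ℕ → ℝ} {j : ℕ}
    (hψ : ∀ᶠ n in atTop, 0 < ψ n) (hO : ψ =O[atTop] fun n : ℕ => Real.log n ^ j) :
    ∃ k : ℕ, (Prog.main q K).RunsInTime c ψ fun n => (2 : ℝ) ^ (Real.log n ^ k) := by
  obtain ⟨a, b, hb, h⟩ := exists_runsInTime q K hc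
  obtain ⟨B, hB, hO⟩ := hO.exists_pos
  refine ⟨j + 2, h ψ _ hψ ?_⟩
  filter_upwards [hψ, hO.bound, tendsto_log_natCast_atTop.eventually_ge_atTop (2 * a + b * B),
    tendsto_log_natCast_atTop.eventually_ge_atTop 1, eventually_ge_atTop 1] with n hψ hO hl hl1 hn
  set l := Real.log n with hl_def
  rw [Real.norm_of_nonneg hψ.le, Real.norm_of_nonneg (by positivity)] at hO
  calc (n : ℝ) ^ a * 2 ^ (b * ψ n) ≤ 2 ^ (2 * a * l) * 2 ^ (b * ψ n) :=
        mul_le_mul_of_nonneg_right (natCast_pow_le_two_rpow hn a) (by positivity)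
    _ = 2 ^ (2 * a * l + b * ψ n) := (Real.rpow_add two_pos _ _).symm
    _ ≤ 2 ^ (l ^ (j + 2)) := by
        refine Real.rpow_le_rpow_of_exponent_le one_le_two ?_
        have h1 : l ≤ l ^ (j + 1) := le_self_pow₀ hl1 (by omega)
        have h2 : l ^ j ≤ l ^ (j + 1) := pow_le_pow_right₀ hl1 (by omega)
        have h3 : b * ψ n ≤ b * (B * l ^ (j + 1)) := mul_le_mul_of_nonneg_left
          (hO.trans (mul_le_mul_of_nonneg_left h2 hB.le)) hb
        have h4 : 2 * a * l ≤ 2 * a * l ^ (j + 1) := mul_le_mul_of_nonneg_left h1 (by positivity)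
        have h5 := mul_le_mul_of_nonneg_right hl (by positivity : (0 : ℝ) ≤ l ^ (j + 1))
        rw [show j + 2 = (j + 1) + 1 by omega, pow_succ l (j + 1)]
        linarith

theorem theorem3p2 (ε : ℝ) (hε : 0 < ε) :
    ∃ P : Prog,
      -- feasibility for all coin tosses, and the approximation factor with high probability
      (∀ (n : ℕ) (G : SimpleGraph (Fin n)), IsInstance G →
        (∀ ω : ℕ → Bool, ∃ S, P.Outputs G ω S ∧ IsConnectedVertexCover G S) ∧
        1 - 1 / (n : ℝ) ≤ coinMeasure.real
          {ω | ∃ S, P.Outputs G ω S ∧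
            IsApproxConnectedVertexCover G (2 / (1 + avgDeg G / (2 * (maxDeg G : ℝ))) + ε) S}) ∧
      -- running time
      (∀ c : ℝ, 0 < c →
        (∃ C : ℝ, ∀ ψ : ℕ → ℝ, (∀ᶠ n in atTop, 0 < ψ n) →
          P.RunsInTime c ψ fun n =>
            (n : ℝ) ^ C * (2 : ℝ) ^ (C * (ψ n * logloglog n))) ∧
        -- polynomial time
        (∀ ψ : ℕ → ℝ, (∀ᶠ n in atTop, 0 < ψ n) →
          (ψ =O[atTop] fun n : ℕ => Real.log n / logloglog n) →
            ∃ k : ℕ, P.RunsInTime c ψ fun n => (n : ℝ) ^ k) ∧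
        -- quasi-polynomial time
        (∀ ψ : ℕ → ℝ, (∀ᶠ n in atTop, 0 < ψ n) →
          (∃ j : ℕ, ψ =O[atTop] fun n : ℕ => Real.log n ^ j) →
            ∃ k : ℕ, P.RunsInTime c ψ fun n => (2 : ℝ) ^ (Real.log n ^ k))) := by
  obtain ⟨q, hq⟩ := exists_nat_ge (32 / ε ^ 2)
  have hq' : 32 / ε ^ 2 ≤ (q + 2 : ℕ) := by
    push_cast
    linarith
  refine ⟨.main (q + 2) (8 * (q + 2) ^ 2 + (q + 2) + 1), fun n G hG =>
    ⟨fun ω => ?_, hG.le_coinMeasure hε (by omega) hq'⟩, fun c hc =>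
    ⟨exists_runsInTime_logloglog _ _ hc, fun ψ hψ hO => exists_runsInTime_polynomial _ _ hc hψ hO,
      fun ψ hψ ⟨j, hO⟩ => exists_runsInTime_quasipolynomial _ _ hc hψ hO⟩⟩
  obtain ⟨S, hS, hS', -⟩ := hG.outputs (q + 2) (8 * (q + 2) ^ 2 + (q + 2) + 1) ω
  exact ⟨S, hS, hS'⟩
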